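/- **Setting.** A *monotone separable network* is given by measurable functions $f_l:\mathbb R^l\times K^l\to\mathbb R$ ($l\ge 1$) such that, with $X_{[m,n]}(N)=f_{n-m+1}(\{T_l,\zeta_l\}_{m\le l\le n})$ for integers $m\le n$, every nondecreasing input sequence $N=\{T_n\}_{n\in\mathbb Z}$ and all marks $\{\zeta_n\}$ in the measurable space $K$: (1) $X_{[m,n]}(N)\ge T_n$; (2) $X_{[m,n]}(N')\ge X_{[m,n]}(N)$ whenever $N'\ge N$ pointwise; (3) $X_{[m,n]}(c+N)=X_{[m,n]}(N)+c$ for $c\in\mathbb R$; (4) if $m\le l<n$ and $X_{[m,l]}(N)\le T_{l+1}$, then $X_{[m,n]}(N)=X_{[l+1,n]}(N)$. Put $Z_{[m,n]}(N)=X_{[m,n]}(N)-T_n$, and let $Z=\lim_{n\to\infty}Z_{[-n,0]}(N)\in[0,\infty]$ be the stationary maximal dater. Let $\{T_n\}$ and $\{\zeta_n\}$ be random with $T_n\le T_{n+1}$ a.s., $\tau_n=T_{n+1}-T_n$, $a=\mathbf E\tau_n<\infty$, let $Q$ be the input with all points equal to $0$, let $\gamma(0)=\lim_{n\to\infty}\mathbf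 E Z_{[-n,-1]}(Q)/n$, and assume stability: $\gamma(0)<a$. **Assumptions.** (IA) The sequences $\{\zeta_n\}$ and $\{\tau_n\}$ are mutually independent and each is i.i.d. (AA) For all $i$, $Z_{[i,i]}=Y_i^{(1)}+\dots+Y_i^{(r)}$ a.s., where the $Y_i^{(j)}$ are nonnegative random variables, independent of $\{\tau_n\}$, and the vectors $(Y_i^{(1)},\dots,Y_i^{(r)})$, $i\in\mathbb Z$, are i.i.d. (with arbitrary dependence between components); moreover $Z_{[n,0]}(Q)\ge\max_{1\le j\le r}\sum_{i=n}^0Y_i^{(j)}$ a.s. for all $n\le 0$. (SE) $F$ is a distribution function on $[0,\infty)$ with tail $\overline F=1-F$ and finite first moment $\int_0^\infty\overline F(u)\,du$; $F$ and the integrated tail distribution $F^s$ on $[0,\infty)$, $\overline{F^s}(x)=\min\{1,\int_x^\infty\overline F(u)\,du\}$, $x\ge 0$, are both subexponential (a distribution function $G$ on $[0,\infty)$ with $\overline G>0$ everywhere is subexponential if $\mathbf P(\xi_1+\xi_2>x)\sim 2\overline G(x)$ for $\xi_1,\xi_2$ independent with distribution $G$); and $\mathbf P(Y_1^{(j)}>x)/\overline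 F(x)\to d^{(j)}$ as $x\to\infty$ for $j=1,\dots,r$, with $\sum_jd^{(j)}>0$. (H) $\mathbf P(\sum_jY_1^{(j)}>x)\sim\mathbf P(\max_jY_1^{(j)}>x)\sim\sum_j\mathbf P(Y_1^{(j)}>x)\sim\sum_jd^{(j)}\,\overline F(x)$ as $x\to\infty$. Let $b^{(j)}=\mathbf EY_1^{(j)}$, and let $$\underline R=\max_{1\le j\le r}\ \sup_{n\le 0}\Big(\sum_{i=n}^{0}Y_i^{(j)}-\sum_{i=n}^{-1}\tau_i\Big)$$ be the stationary response time of the lower bound fork-join queue. **Theorem.** Under stability, (IA), (AA), (SE) and (H), $$\liminf_{x\to\infty}\frac{\mathbf P(Z>x)}{\overline{F^s}(x)}\ \ge\ \lim_{x\to\infty}\frac{\mathbf P(\underline R>x)}{\overline{F^s}(x)}\ =\ \sum_{j=1}^r\frac{d^{(j)}}{a-b^{(j)}},$$ and $\mathbf P(Z>x)=\Theta(\overline{F^s}(x))$ as $x\to\infty$. -/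

import Mathlib

open MeasureTheory ProbabilityTheory Filter Topology Asymptotics

namespace MonSep

noncomputable section

/-! ## Tails and subexponential distributions -/

/-- `f(x) ~ c g(x)` as `x → ∞`, i.e. `f(x) / g(x) → c`. -/
def TailEquiv (f : ℝ → ℝ) (c : ℝ) (g : ℝ → ℝ) : Prop :=
  Tendsto (fun x => f x / g x) atTop (𝓝 c)

/-- The tail `1 - F` of a distribution function. -/
def tail (F : ℝ → ℝ) (x : ℝ) : ℝ := 1 - F x

/-- `F` is the distribution function of a law `ν` on `[0, ∞)` with `F(x) < 1` for all `x`, and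
`P(ξ₁ + ξ₂ > x) ~ 2 P(ξ₁ > x)` for independent `ξ₁, ξ₂` with law `ν`
(the law of `ξ₁ + ξ₂` is the convolution of `ν` with itself). -/
def IsSubexponential (F : ℝ → ℝ) : Prop :=
  ∃ ν : Measure ℝ, IsProbabilityMeasure ν ∧ ν (Set.Iio 0) = 0 ∧
    (∀ x, F x = ν.real (Set.Iic x)) ∧
    (∀ x, 0 < tail F x) ∧
    TailEquiv (fun x => (Measure.conv ν ν).real (Set.Ioi x)) 2 (tail F)

/-- The integrated tail distribution function `F^s`, a distribution function on `[0, ∞)`: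
`F^s(x) = 1 - min (1, ∫_x^∞ (1 - F(u)) du)` for `x ≥ 0`, and `0` for `x < 0`. -/
def integratedTailCDF (F : ℝ → ℝ) (x : ℝ) : ℝ :=
  if x < 0 then 0 else 1 - min 1 (∫ u in Set.Ioi x, tail F u)

/-! ## Monotone separable networks -/

section Network

variable {K : Type*}

/-- Time of last activity `X_{[m,n]}(N) = f_{n-m+1}((T_l, ζ_l), m ≤ l ≤ n)` when the network starts
empty and is fed by the arrivals `T_m, …, T_n`; meaningful for `m ≤ n`. -/
def lastActivity (f : (l : ℕ) → (Fin l → ℝ) → (Fin l → K) → ℝ)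
    (T : ℤ → ℝ) (ζ : ℤ → K) (m n : ℤ) : ℝ :=
  f (n - m + 1).toNat (fun i => T (m + (i : ℕ))) (fun i => ζ (m + (i : ℕ)))

/-- The maximal dater `Z_{[m,n]}(N) = X_{[m,n]}(N) - T_n`. -/
def dater (f : (l : ℕ) → (Fin l → ℝ) → (Fin l → K) → ℝ)
    (T : ℤ → ℝ) (ζ : ℤ → K) (m n : ℤ) : ℝ :=
  lastActivity f T ζ m n - T n

/-- The functions `f_l` define a monotone separable network: the four properties hold for all
arrival sequences `T` (points in nondecreasing order) and all marks `ζ`. -/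
structure IsMonotoneSeparable (f : (l : ℕ) → (Fin l → ℝ) → (Fin l → K) → ℝ) : Prop where
  causality : ∀ (T : ℤ → ℝ) (ζ : ℤ → K), Monotone T → ∀ m n : ℤ, m ≤ n →
    T n ≤ lastActivity f T ζ m n
  externalMonotonicity : ∀ (T T' : ℤ → ℝ) (ζ : ℤ → K), Monotone T → Monotone T' →
    (∀ n, T n ≤ T' n) → ∀ m n : ℤ, m ≤ n →
    lastActivity f T ζ m n ≤ lastActivity f T' ζ m n
  homogeneity : ∀ (T : ℤ → ℝ) (ζ : ℤ → K), Monotone T → ∀ (c : ℝ) (m n : ℤ), m ≤ n →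
    lastActivity f (fun k => c + T k) ζ m n = lastActivity f T ζ m n + c
  separability : ∀ (T : ℤ → ℝ) (ζ : ℤ → K), Monotone T → ∀ m l n : ℤ, m ≤ l → l < n →
    lastActivity f T ζ m l ≤ T (l + 1) →
    lastActivity f T ζ m n = lastActivity f T ζ (l + 1) n

end Network

/-! ## Stochastic setting -/

section Stochastic

variable {Ω K : Type*}

/-- Interarrival times `τ_n = T_{n+1} - T_n`. -/
def interarrival (T : ℤ → Ω → ℝ) (n : ℤ) (ω : Ω) : ℝ := T (n + 1) ω - T n ω

/-- The stationary maximal dater `Z = lim_{n → ∞} Z_{[-n,0]}(N) ∈ [0, ∞]`. -/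
def stationaryDater (f : (l : ℕ) → (Fin l → ℝ) → (Fin l → K) → ℝ)
    (T : ℤ → Ω → ℝ) (ζ : ℤ → Ω → K) (ω : Ω) : EReal :=
  limUnder atTop
    (fun n : ℕ => ((dater f (fun k => T k ω) (fun k => ζ k ω) (-(n : ℤ)) 0 : ℝ) : EReal))

/-- Maximal daters `Z_{[m,n]}(Q)` for the degenerate input `Q`, all of whose points are `0`. -/
def degenerateDater (f : (l : ℕ) → (Fin l → ℝ) → (Fin l → K) → ℝ)
    (ζ : ℤ → Ω → K) (m n : ℤ) (ω : Ω) : ℝ :=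
  dater f (fun _ => 0) (fun k => ζ k ω) m n

variable {r : ℕ}

/-- Stationary response time `R^{(j)} = sup_{n ≤ 0} (∑_{i=n}^0 Y_i^{(j)} - ∑_{i=n}^{-1} τ_i)` of
the single server queue with service times `Y_i^{(j)}` and interarrival times `τ_i`. -/
def responseTime (T : ℤ → Ω → ℝ) (Y : ℤ → Fin r → Ω → ℝ) (j : Fin r) (ω : Ω) : EReal :=
  ⨆ n : {n : ℤ // n ≤ 0},
    ((∑ i ∈ Finset.Icc (n : ℤ) 0, Y i j ω - ∑ i ∈ Finset.Icc (n : ℤ) (-1), interarrival T i ω : ℝ) :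
      EReal)

/-- Stationary response time `max_j R^{(j)}` of the lower bound fork-join queue. -/
def forkJoinResponseTime (T : ℤ → Ω → ℝ) (Y : ℤ → Fin r → Ω → ℝ) (ω : Ω) : EReal :=
  ⨆ j : Fin r, responseTime T Y j ω

variable [MeasurableSpace Ω]

/-- The constant `γ(0) = lim_{n → ∞} E Z_{[-n,-1]}(Q) / n`. -/
def gammaZero (f : (l : ℕ) → (Fin l → ℝ) → (Fin l → K) → ℝ)
    (ζ : ℤ → Ω → K) (μ : Measure Ω) : ℝ :=
  limUnder atTop
    (fun n : ℕ => (∫ ω, degenerateDater f ζ (-(n : ℤ)) (-1) ω ∂μ) / (n : ℝ))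

/-- Assumption (IA). -/
structure AssumptionIA [MeasurableSpace K] (T : ℤ → Ω → ℝ) (ζ : ℤ → Ω → K)
    (μ : Measure Ω) : Prop where
  indep : IndepFun (fun ω n => ζ n ω) (fun ω n => interarrival T n ω) μ
  indep_marks : iIndepFun ζ μ
  ident_marks : ∀ n, IdentDistrib (ζ n) (ζ 0) μ μ
  indep_interarrival : iIndepFun (interarrival T) μ
  ident_interarrival : ∀ n, IdentDistrib (interarrival T n) (interarrival T 0) μ μ

/-- Assumption (AA), with `Y i j = Y_i^{(j)}`. -/
structure AssumptionAA (f : (l : ℕ) → (Fin l → ℝ) → (Fin l → K) → ℝ)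
    (T : ℤ → Ω → ℝ) (ζ : ℤ → Ω → K) (Y : ℤ → Fin r → Ω → ℝ) (μ : Measure Ω) : Prop where
  nonneg : ∀ i j, ∀ᵐ ω ∂μ, 0 ≤ Y i j ω
  indep : IndepFun (fun ω i j => Y i j ω) (fun ω n => interarrival T n ω) μ
  indep_vectors : iIndepFun (fun i ω j => Y i j ω) μ
  ident_vectors : ∀ i, IdentDistrib (fun ω j => Y i j ω) (fun ω j => Y 0 j ω) μ μ
  dater_eq_sum : ∀ i : ℤ, ∀ᵐ ω ∂μ,
    dater f (fun k => T k ω) (fun k => ζ k ω) i i = ∑ j, Y i j ω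
  max_le_dater : ∀ n : ℤ, n ≤ 0 → ∀ᵐ ω ∂μ,
    (⨆ j : Fin r, ∑ i ∈ Finset.Icc n 0, Y i j ω) ≤ degenerateDater f ζ n 0 ω

/-- Assumption (SE) for the reference distribution function `F` and the constants `d^{(j)}`. -/
structure AssumptionSE (F : ℝ → ℝ) (d : Fin r → ℝ) (Y : ℤ → Fin r → Ω → ℝ)
    (μ : Measure Ω) : Prop where
  subexp : IsSubexponential F
  finite_moment : IntegrableOn (tail F) (Set.Ioi 0)
  subexp_integrated : IsSubexponential (integratedTailCDF F)
  tails : ∀ j, TailEquiv (fun x => μ.real {ω | x < Y 1 j ω}) (d j) (tail F)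
  sum_pos : 0 < ∑ j, d j

/-- Assumption (H). -/
structure AssumptionH (F : ℝ → ℝ) (d : Fin r → ℝ) (Y : ℤ → Fin r → Ω → ℝ)
    (μ : Measure Ω) : Prop where
  sum_max : TailEquiv (fun x => μ.real {ω | x < ∑ j, Y 1 j ω}) 1
    (fun x => μ.real {ω | x < ⨆ j, Y 1 j ω})
  max_sum_tails : TailEquiv (fun x => μ.real {ω | x < ⨆ j, Y 1 j ω}) 1
    (fun x => ∑ j, μ.real {ω | x < Y 1 j ω})
  sum_tails : TailEquiv (fun x => ∑ j, μ.real {ω | x < Y 1 j ω}) (∑ j, d j) (tail F)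

end Stochastic

end

end MonSep

namespace MonSep

/-! ## Subexponential laws -/

/-! The dater `Z` is squeezed pathwise between two single-server quantities, and the tails of these
follow from random walks with subexponential increments.

Lower side: moving the arrivals of `[-k,0]` back to `T_{-k}` only decreases the last activity, so `Z
≥ Z_{[-k,0]}(Q) - (T_0 - T_{-k})`, and (AA) turns this into domination of the fork-join response
time (`forkJoin_le_stationaryDater`). Upper side: cut the arrivals into blocks of `L` customers and
move each block to its last point. Separability and homogeneity then yield a Lindley recursion, so
`Z` is at most the response time of a queue whose services are the block daters under `Q` and whose
interarrival times are sums of `L` of the `τ`'s (`exists_dater_le_block_walk`). Subadditivity and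
`γ(0) < a` provide an `L` for which this queue is stable (`exists_block_of_gammaZero_lt`). A block
dater is at most a sum of `L` i.i.d. single-customer daters, so its tail is `O(F̄)` because `F` is
subexponential.

Upper bound for a walk of drift `-m`: stop it when it first crosses the line `b - kα`, with `α < m`.
The law of the crossing value has small mass when `b` is large, and its tail is at most `∑ₙ P(X > x
- b + nα)`, of order `F̄ˢ(x)/α`. If the maximum over `N` steps has tail at most `K F̄ˢ`, convolution
with this law bounds the maximum over `N+1` steps with coefficient `c/α + η + Kη`. That map
preserves a fixed bound, and a last application with `α` near `m` gives `c/m` (`maxWalk_tail_le`).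

Lower bound for the parallel queues: one service time, `n` places back, exceeds `x + y + n(a - b_j +
ε')` while the intervening walk stays above its mean line. Bonferroni is applied over `j` and over
`n`. Overlaps at equal `n` are negligible by (H), and overlaps at distinct `n` contribute
`O(F̄ˢ(x)²)` by independence (`IsIID.le_response_tail`). -/

/-- A subexponential law on `[0, ∞)`. -/
structure SubexpLaw (ν : Measure ℝ) : Prop where
  prob : IsProbabilityMeasure ν
  nonneg : ν (Set.Iio 0) = 0
  pos : ∀ x, 0 < ν.real (Set.Ioi x)
  conv : Tendsto (fun x => (ν.prod ν).real {p | x < p.1 + p.2} / ν.real (Set.Ioi x)) atTop (𝓝 2)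

theorem IsSubexponential.exists_law {F : ℝ → ℝ} (hF : IsSubexponential F) :
    ∃ ν : Measure ℝ, SubexpLaw ν ∧ ∀ x, tail F x = ν.real (Set.Ioi x) := by
  obtain ⟨ν, hp, h0, hcdf, hpos, hconv⟩ := hF
  have ht : ∀ x, tail F x = ν.real (Set.Ioi x) := by
    intro x
    rw [tail, hcdf, ← Set.compl_Iic, probReal_compl_eq_one_sub measurableSet_Iic]
  refine ⟨ν, ⟨hp, h0, fun x => ht x ▸ hpos x, ?_⟩, ht⟩
  refine hconv.congr fun x => ?_
  beta_reduce
  rw [ht, Measure.conv, map_measureReal_apply (by fun_prop) measurableSet_Ioi]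
  rfl

theorem tendsto_measureReal_Ioi (ν : Measure ℝ) [IsProbabilityMeasure ν] :
    Tendsto (fun x => ν.real (Set.Ioi x)) atTop (𝓝 0) := by
  have h := (tendsto_cdf_atTop ν).const_sub 1
  rw [sub_self] at h
  refine h.congr fun x => ?_
  rw [cdf_eq_real, ← Set.compl_Iic, probReal_compl_eq_one_sub measurableSet_Iic]

theorem antitone_measureReal_Ioi (ν : Measure ℝ) [IsFiniteMeasure ν] :
    Antitone fun x => ν.real (Set.Ioi x) :=
  fun _ _ h => measureReal_mono (Set.Ioi_subset_Ioi h)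

/-- Two measures with comparable tails give comparable mass to regions above a graph. -/
theorem prod_measureReal_le_of_tail_le {α : Type*} [MeasurableSpace α] (G : Measure α)
    (θ₁ θ₂ : Measure ℝ) [IsFiniteMeasure G] [IsFiniteMeasure θ₁] [IsFiniteMeasure θ₂] {K A : ℝ}
    (hK : 0 ≤ K) (h : ∀ y, A ≤ y → θ₁.real (Set.Ioi y) ≤ K * θ₂.real (Set.Ioi y))
    {S : Set α} (hS : MeasurableSet S) {g : α → ℝ} (hg : Measurable g) (hgS : ∀ v ∈ S, A ≤ g v) :
    (G.prod θ₁).real {p | p.1 ∈ S ∧ g p.1 < p.2} ≤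
      K * (G.prod θ₂).real {p | p.1 ∈ S ∧ g p.1 < p.2} := by
  have hm : MeasurableSet {p : α × ℝ | p.1 ∈ S ∧ g p.1 < p.2} :=
    (measurable_fst hS).inter (measurableSet_lt (hg.comp measurable_fst) measurable_snd)
  have key : (G.prod θ₁) {p | p.1 ∈ S ∧ g p.1 < p.2} ≤
      ENNReal.ofReal K * (G.prod θ₂) {p | p.1 ∈ S ∧ g p.1 < p.2} := by
    rw [Measure.prod_apply hm, Measure.prod_apply hm, ← lintegral_const_mul' _ _ (by simp)]
    refine lintegral_mono fun v => ?_
    by_cases hv : v ∈ S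
    · have e : Prod.mk v ⁻¹' {p : α × ℝ | p.1 ∈ S ∧ g p.1 < p.2} = Set.Ioi (g v) := by
        ext w; simp [hv]
      simp only [e]
      have h2 := ENNReal.ofReal_le_ofReal (h _ (hgS v hv))
      rwa [ENNReal.ofReal_mul hK, ofReal_measureReal, ofReal_measureReal] at h2
    · have e : Prod.mk v ⁻¹' {p : α × ℝ | p.1 ∈ S ∧ g p.1 < p.2} = ∅ := by
        ext w; simp [hv]
      simp [e]
  have h2 := ENNReal.toReal_mono (by finiteness) key
  rwa [ENNReal.toReal_mul, ENNReal.toReal_ofReal hK] at h2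

namespace SubexpLaw

variable {ν : Measure ℝ}

theorem real_Icc (hν : SubexpLaw ν) (y : ℝ) :
    ν.real (Set.Icc 0 y) = 1 - ν.real (Set.Ioi y) := by
  have := hν.prob
  rw [← Set.compl_Iic, probReal_compl_eq_one_sub measurableSet_Iic, sub_sub_cancel]
  refine measureReal_congr ?_
  have : ∀ᵐ x ∂ν, 0 ≤ x := by
    rw [ae_iff]; simpa [Set.Iio_def] using hν.nonneg
  filter_upwards [this] with x hx
  apply propext
  change (0 ≤ x ∧ x ≤ y) ↔ x ≤ y
  simp [hx]

theorem real_Ici_zero (hν : SubexpLaw ν) : ν.real (Set.Ici 0) = 1 := by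
  have := hν.prob
  rw [← Set.compl_Iio, probReal_compl_eq_one_sub measurableSet_Iio, measureReal_def, hν.nonneg]
  simp

theorem eventually_conv_le (hν : SubexpLaw ν) {ε : ℝ} (hε : 0 < ε) :
    ∀ᶠ x in atTop, (ν.prod ν).real {p | x < p.1 + p.2} ≤ (2 + ε) * ν.real (Set.Ioi x) := by
  filter_upwards [hν.conv.eventually (eventually_le_nhds (show (2 : ℝ) < 2 + ε by linarith))] with x hx
  rwa [div_le_iff₀ (hν.pos x)] at hx

/-- The region `u + v > x` contains three disjoint rectangles, of masses `t(x)`, `(1 - t(y)) t(x)`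
and `(t(y) - t(x)) t(x - y)`, where `t` is the tail. As the total is at most `(2 + δ) t(x)`, the
ratio `t(x - y)/t(x)` is at most about `(t(y) + δ)/(t(y) - t(x))`, and `t(x)` tends to `0`. -/
theorem long_tailed (hν : SubexpLaw ν) (y : ℝ) {ε : ℝ} (hε : 0 < ε) :
    ∀ᶠ x in atTop, ν.real (Set.Ioi (x - y)) ≤ (1 + ε) * ν.real (Set.Ioi x) := by
  have := hν.prob
  rcases le_or_gt y 0 with hy | hy
  · refine Eventually.of_forall fun x => ?_
    have h1 : ν.real (Set.Ioi (x - y)) ≤ ν.real (Set.Ioi x) :=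
      antitone_measureReal_Ioi ν (by linarith)
    nlinarith [hν.pos x]
  have hty := hν.pos y
  have hδ : 0 < ε * ν.real (Set.Ioi y) / 2 := by positivity
  have hη : 0 < ε * ν.real (Set.Ioi y) / (2 * (1 + ε)) := by positivity
  filter_upwards [hν.eventually_conv_le hδ,
    (tendsto_measureReal_Ioi ν).eventually (eventually_le_nhds hη), eventually_ge_atTop y]
    with x hx1 hx2 hxy
  rw [le_div_iff₀ (by positivity)] at hx2
  have hsub : (Set.Ioi x ×ˢ Set.Ici 0 ∪ Set.Icc 0 y ×ˢ Set.Ioi x) ∪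
      Set.Ioc y x ×ˢ Set.Ioi (x - y) ⊆ {p : ℝ × ℝ | x < p.1 + p.2} := by
    rintro ⟨u, v⟩ ((⟨h1, h2⟩ | ⟨h1, h2⟩) | ⟨h1, h2⟩) <;>
      simp only [Set.mem_Ioi, Set.mem_Ici, Set.mem_Icc, Set.mem_Ioc, Set.mem_ofPred_eq] at *
    · linarith
    · linarith [h1.1]
    · linarith [h1.1]
  have hle := measureReal_mono (μ := ν.prod ν) hsub
  rw [measureReal_union, measureReal_union, measureReal_prod_prod, measureReal_prod_prod,
    measureReal_prod_prod, hν.real_Icc, hν.real_Ici_zero] at hle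
  · have h3 : ν.real (Set.Ioc y x) = ν.real (Set.Ioi y) - ν.real (Set.Ioi x) := by
      rw [← Set.Ioi_sdiff_Ioi, measureReal_sdiff (Set.Ioi_subset_Ioi hxy) measurableSet_Ioi]
    rw [h3] at hle
    have htx := hν.pos x
    set ty := ν.real (Set.Ioi y)
    set tx := ν.real (Set.Ioi x)
    set s := ν.real (Set.Ioi (x - y))
    have h4 : (ty - tx) * s ≤ (ty + ε * ty / 2) * tx := by nlinarith
    have h5 : ty + ε * ty / 2 ≤ (1 + ε) * (ty - tx) := by nlinarith
    have h6 : 0 < ty - tx := by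
      by_contra h
      nlinarith
    have h7 : (ty - tx) * s ≤ (ty - tx) * ((1 + ε) * tx) := by nlinarith
    exact le_of_mul_le_mul_left h7 h6
  · rw [Set.disjoint_left]
    rintro ⟨u, v⟩ ⟨h1, h2⟩ ⟨h3, h4⟩
    simp only [Set.mem_Ioi, Set.mem_Icc] at *
    linarith [h3.2]
  · exact measurableSet_Icc.prod measurableSet_Ioi
  · rw [Set.disjoint_left]
    rintro ⟨u, v⟩ (⟨h1, h2⟩ | ⟨h1, h2⟩) ⟨h3, h4⟩
    · simp only [Set.mem_Ioi, Set.mem_Ioc] at *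
      linarith [h3.2]
    · simp only [Set.mem_Icc, Set.mem_Ioc] at *
      linarith [h3.1, h1.2]
  · exact measurableSet_Ioc.prod measurableSet_Ioi

/-- Two large jumps: for independent variables the sum exceeds `x` with both terms large with
probability negligible compared with the tail. -/
theorem both_large (hν : SubexpLaw ν) {ε : ℝ} (hε : 0 < ε) :
    ∃ A₀ : ℝ, ∀ A, A₀ ≤ A → ∀ᶠ x in atTop,
      (ν.prod ν).real {p | A < p.1 ∧ max A (x - p.1) < p.2} ≤ ε * ν.real (Set.Ioi x) := by
  have := hν.prob
  obtain ⟨A₀, hA₀⟩ := eventually_atTop.1 ((tendsto_measureReal_Ioi ν).eventually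
    (eventually_le_nhds (show (0 : ℝ) < ε / 4 by positivity)))
  refine ⟨A₀, fun A hA => ?_⟩
  filter_upwards [hν.eventually_conv_le (half_pos hε), eventually_ge_atTop A] with x hx hxA
  -- The two strips already carry `2(1 - t(A)) t(x)` of the at most `(2 + ε/2) t(x)` available. What
  -- is left is `(ε/2 + 2t(A)) t(x)`, hence the choice `t(A) ≤ ε/4`.
  have hsub : ({p : ℝ × ℝ | A < p.1 ∧ max A (x - p.1) < p.2} ∪ Set.Icc 0 A ×ˢ Set.Ioi x) ∪
      Set.Ioi x ×ˢ Set.Icc 0 A ⊆ {p : ℝ × ℝ | x < p.1 + p.2} := by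
    rintro ⟨u, v⟩ ((⟨h1, h2⟩ | ⟨h1, h2⟩) | ⟨h1, h2⟩) <;>
      simp only [Set.mem_Ioi, Set.mem_Icc, Set.mem_ofPred_eq, max_lt_iff] at *
    · linarith [h2.2]
    · linarith [h1.1]
    · linarith [h2.1]
  have hle := measureReal_mono (μ := ν.prod ν) hsub
  rw [measureReal_union, measureReal_union, measureReal_prod_prod, measureReal_prod_prod,
    hν.real_Icc] at hle
  · have htx := hν.pos x
    have := hA₀ A hA
    nlinarith
  · rw [Set.disjoint_left]
    rintro ⟨u, v⟩ ⟨h1, h2⟩ ⟨h3, h4⟩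
    simp only [Set.mem_Icc] at *
    linarith [h3.2]
  · exact measurableSet_Icc.prod measurableSet_Ioi
  · rw [Set.disjoint_left]
    rintro ⟨u, v⟩ (⟨h1, h2⟩ | ⟨h1, h2⟩) ⟨h3, h4⟩
    · simp only [Set.mem_Icc, max_lt_iff] at *
      linarith [h4.2, h2.1]
    · simp only [Set.mem_Ioi, Set.mem_Icc] at *
      linarith [h1.2]
  · exact measurableSet_Ioi.prod measurableSet_Icc

/-- Convolution with a measure whose tail is dominated by that of a subexponential law. -/
theorem conv_tail_le (hν : SubexpLaw ν) (G : Measure ℝ) [IsFiniteMeasure G] {c : ℝ} (hc : 0 ≤ c)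
    (hG : ∀ᶠ x in atTop, G.real (Set.Ioi x) ≤ c * ν.real (Set.Ioi x)) {ε : ℝ} (hε : 0 < ε) :
    ∃ A₀ : ℝ, ∀ A, A₀ ≤ A → ∀ᶠ x in atTop, ∀ (K : ℝ) (θ : Measure ℝ), 0 ≤ K →
      IsProbabilityMeasure θ → (∀ y, A ≤ y → θ.real (Set.Ioi y) ≤ K * ν.real (Set.Ioi y)) →
      (G.prod θ).real {p | x < p.1 + p.2} ≤
        (c + ε + K * (G.real Set.univ + ε)) * ν.real (Set.Ioi x) := by
  have := hν.prob
  obtain ⟨x₁, hx₁⟩ := eventually_atTop.1 hG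
  set γ := G.real Set.univ with hγ
  have hγ0 : 0 ≤ γ := measureReal_nonneg
  have hε' : 0 < ε / (2 * (c + 1)) := by positivity
  obtain ⟨A₀, hA₀⟩ := hν.both_large hε'
  refine ⟨max A₀ x₁, fun A hA => ?_⟩
  have hδ : 0 < ε / (2 * (c + γ + 1)) := by positivity
  -- No threshold on `x` involves `K` or `θ`; this uniformity is what allows the bound to be
  -- iterated along the walk.
  filter_upwards [hA₀ A (le_trans (le_max_left _ _) hA), hν.long_tailed A hδ,
    eventually_ge_atTop (x₁ + A), eventually_ge_atTop (A + A)] with x h1 h2 h3 h4 K θ hK hθ hle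
  have hx₁A : x₁ ≤ A := le_trans (le_max_right _ _) hA
  have htx := hν.pos x
  have hsub : {p : ℝ × ℝ | x < p.1 + p.2} ⊆ (Set.Ioi (x - A) ×ˢ Set.univ ∪
      Set.univ ×ˢ Set.Ioi (x - A)) ∪ {p | p.1 ∈ Set.Ioc A (x - A) ∧ x - p.1 < p.2} := by
    rintro ⟨u, v⟩ h
    simp only [Set.mem_ofPred_eq, Set.mem_union, Set.mem_prod, Set.mem_Ioi, Set.mem_univ, and_true,
      true_and, Set.mem_Ioc] at *
    by_cases hu : x - A < u
    · exact Or.inl (Or.inl hu)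
    by_cases hv : x - A < v
    · exact Or.inl (Or.inr hv)
    · exact Or.inr ⟨⟨by linarith, by linarith⟩, by linarith⟩
  have hS1 : (G.prod θ).real (Set.Ioi (x - A) ×ˢ Set.univ) ≤
      c * ((1 + ε / (2 * (c + γ + 1))) * ν.real (Set.Ioi x)) := by
    rw [measureReal_prod_prod, probReal_univ, mul_one]
    exact (hx₁ _ (by linarith)).trans (by gcongr)
  have hS2 : (G.prod θ).real (Set.univ ×ˢ Set.Ioi (x - A)) ≤
      γ * (K * ((1 + ε / (2 * (c + γ + 1))) * ν.real (Set.Ioi x))) := by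
    rw [measureReal_prod_prod]
    refine mul_le_mul_of_nonneg_left ?_ hγ0
    exact (hle _ (by linarith)).trans (by gcongr)
  -- Here both terms exceed `A`. Replacing `θ` by `ν` costs a factor `K`; exchanging the coordinates
  -- and replacing `G` by `ν` costs `c`; what remains is the two-large-jumps event for `ν`.
  have hS3 : (G.prod θ).real {p | p.1 ∈ Set.Ioc A (x - A) ∧ x - p.1 < p.2} ≤
      K * (c * (ε / (2 * (c + 1)) * ν.real (Set.Ioi x))) := by
    refine (prod_measureReal_le_of_tail_le G θ ν hK hle measurableSet_Ioc
      (g := fun v => x - v) (by fun_prop) (fun v hv => by linarith [hv.2])).trans ?_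
    refine mul_le_mul_of_nonneg_left ?_ hK
    have hm : MeasurableSet {p : ℝ × ℝ | p.1 ∈ Set.Ioi A ∧ max A (x - p.1) < p.2} :=
      (measurable_fst measurableSet_Ioi).inter (measurableSet_lt
        (f := fun p : ℝ × ℝ => max A (x - p.1)) (g := Prod.snd) (by fun_prop) (by fun_prop))
    calc (G.prod ν).real {p | p.1 ∈ Set.Ioc A (x - A) ∧ x - p.1 < p.2}
        ≤ (G.prod ν).real (Prod.swap ⁻¹' {p | p.1 ∈ Set.Ioi A ∧ max A (x - p.1) < p.2}) := by
          refine measureReal_mono ?_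
          rintro ⟨u, v⟩ ⟨⟨h5, h6⟩, h7⟩
          simp only [Set.mem_preimage, Prod.swap_prod_mk, Set.mem_ofPred_eq, Set.mem_Ioi,
            max_lt_iff] at *
          exact ⟨by linarith, h5, by linarith⟩
      _ = (ν.prod G).real {p | p.1 ∈ Set.Ioi A ∧ max A (x - p.1) < p.2} := by
          rw [← Measure.prod_swap (μ := G), map_measureReal_apply measurable_swap hm]
      _ ≤ c * (ν.prod ν).real {p | p.1 ∈ Set.Ioi A ∧ max A (x - p.1) < p.2} :=
          prod_measureReal_le_of_tail_le ν G ν hc (fun y hy => hx₁ y (hx₁A.trans hy))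
            measurableSet_Ioi (g := fun v => max A (x - v)) (by fun_prop) (fun v _ => le_max_left _ _)
      _ ≤ _ := mul_le_mul_of_nonneg_left h1 hc
  have htot := (measureReal_mono (μ := G.prod θ) hsub).trans
    ((measureReal_union_le _ _).trans (add_le_add_left (measureReal_union_le _ _) _))
  refine htot.trans ?_
  have e1 : (c + γ) * (ε / (2 * (c + γ + 1))) ≤ ε / 2 := by
    rw [mul_div_assoc', div_le_iff₀ (by positivity)]; nlinarith
  have e2 : c * (ε / (2 * (c + 1))) ≤ ε / 2 := by
    rw [mul_div_assoc', div_le_iff₀ (by positivity)]; nlinarith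
  set δ := ε / (2 * (c + γ + 1))
  have e3 : c * δ ≤ ε := by nlinarith
  have e4 : γ * δ + c * (ε / (2 * (c + 1))) ≤ ε := by nlinarith
  calc _ ≤ c * ((1 + δ) * ν.real (Set.Ioi x)) + γ * (K * ((1 + δ) * ν.real (Set.Ioi x))) +
        K * (c * (ε / (2 * (c + 1)) * ν.real (Set.Ioi x))) := by gcongr
    _ = (c + c * δ + K * (γ + (γ * δ + c * (ε / (2 * (c + 1)))))) * ν.real (Set.Ioi x) := by ring
    _ ≤ _ := by gcongr

end SubexpLaw

/-! ## Random walks with negative drift -/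

/-- A sequence of independent identically distributed random variables. -/
structure IsIID {Ω E : Type*} [MeasurableSpace Ω] [MeasurableSpace E] (X : ℕ → Ω → E)
    (μ : Measure Ω) : Prop where
  meas : ∀ n, Measurable (X n)
  indep : iIndepFun X μ
  ident : ∀ n, IdentDistrib (X n) (X 0) μ μ

/-- The maximum of the first `N` partial sums of a sequence, the empty sum included. -/
noncomputable def maxWalk (N : ℕ) (x : ℕ → ℝ) : ℝ :=
  (Finset.range (N + 1)).sup' Finset.nonempty_range_add_one fun n => ∑ i ∈ Finset.range n, x i

theorem lt_maxWalk {N : ℕ} {x : ℕ → ℝ} {a : ℝ} :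
    a < maxWalk N x ↔ ∃ n ≤ N, a < ∑ i ∈ Finset.range n, x i := by
  simp [maxWalk, Finset.lt_sup'_iff]

theorem measurable_maxWalk (N : ℕ) : Measurable (maxWalk N) := by
  have : maxWalk N = (Finset.range (N + 1)).sup' Finset.nonempty_range_add_one
      fun n => fun x : ℕ → ℝ => ∑ i ∈ Finset.range n, x i := by
    ext x; simp [maxWalk, Finset.sup'_apply]
  rw [this]
  exact Finset.measurable_sup' _ fun n _ => by fun_prop

/-- A uniform bound along an increasing union passes to the union. -/
theorem measureReal_exists_le {Ω : Type*} [MeasurableSpace Ω] {μ : Measure Ω} [IsFiniteMeasure μ]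
    {p : ℕ → Ω → Prop} {C : ℝ} (h : ∀ N, μ.real {ω | ∃ n ≤ N, p n ω} ≤ C) :
    μ.real {ω | ∃ n, p n ω} ≤ C := by
  have hmono : Monotone fun N => {ω | ∃ n ≤ N, p n ω} := by
    rintro N M hNM ω ⟨n, hn, h⟩
    exact ⟨n, hn.trans hNM, h⟩
  have hU : {ω | ∃ n, p n ω} = ⋃ N, {ω | ∃ n ≤ N, p n ω} := by
    ext ω
    simp only [Set.mem_iUnion, Set.mem_ofPred_eq]
    exact ⟨fun ⟨n, h⟩ => ⟨n, n, le_rfl, h⟩, fun ⟨_, n, _, h⟩ => ⟨n, h⟩⟩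
  rw [hU]
  have := (ENNReal.tendsto_toReal (measure_ne_top μ _)).comp
    (tendsto_measure_iUnion_atTop (μ := μ) hmono)
  exact le_of_tendsto' this h

/-! ### Independence of past and future for i.i.d. sequences -/

section Independence

variable {Ω E : Type*} [MeasurableSpace Ω] [MeasurableSpace E] {μ : Measure Ω}

theorem IsIID.indepFun_past_future {X : ℕ → Ω → E} (hX : IsIID X μ) (n : ℕ) :
    IndepFun (fun ω (i : Fin n) => X i ω) (fun ω k => X (n + k) ω) μ := by
  have := hX.indep.isProbabilityMeasure
  classical
  refine IndepFun.process_indepFun_process (fun i => hX.meas _) (fun k => hX.meas _) fun I J => ?_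
  have hdisj : Disjoint (I.image (fun i : Fin n => (i : ℕ))) (J.image (fun k => n + k)) := by
    rw [Finset.disjoint_left]
    intro a ha hb
    obtain ⟨i, _, rfl⟩ := Finset.mem_image.1 ha
    obtain ⟨k, _, hk⟩ := Finset.mem_image.1 hb
    have := i.2
    omega
  have h := hX.indep.indepFun_finset _ _ hdisj hX.meas
  exact h.comp
    (φ := fun y (i : I) => y ⟨(i : Fin n), Finset.mem_image_of_mem _ i.2⟩)
    (ψ := fun y (k : J) => y ⟨n + k, Finset.mem_image_of_mem _ k.2⟩)
    (by fun_prop) (by fun_prop)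

theorem IsIID.identDistrib_shift {X : ℕ → Ω → E} (hX : IsIID X μ) (n : ℕ) :
    IdentDistrib (fun ω k => X (n + k) ω) (fun ω k => X k ω) μ μ :=
  IdentDistrib.pi (fun k => (hX.ident (n + k)).trans (hX.ident k).symm)
    (hX.indep.precomp (add_right_injective n)) hX.indep

theorem IsIID.shift {X : ℕ → Ω → E} (hX : IsIID X μ) (n : ℕ) :
    IsIID (fun k => X (n + k)) μ :=
  ⟨fun _ => hX.meas _, hX.indep.precomp (add_right_injective n),
    fun k => (hX.ident (n + k)).trans (hX.ident (n + 0)).symm⟩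

theorem IsIID.comp {F : Type*} [MeasurableSpace F] {X : ℕ → Ω → E} (hX : IsIID X μ) {g : E → F}
    (hg : Measurable g) : IsIID (fun n ω => g (X n ω)) μ :=
  ⟨fun n => hg.comp (hX.meas n), hX.indep.comp (fun _ => g) (fun _ => hg),
    fun n => (hX.ident n).comp hg⟩

/-- The joint law is a product, so fixing `U` leaves the tail of `W`. This is applied with `U` the
walk up to a crossing time, `B` the crossing event and `W` the later maximum. -/
theorem measure_mem_and_lt_add {U : Ω → E} {W : Ω → ℝ} [IsProbabilityMeasure μ]
    (hUm : Measurable U) (hWm : Measurable W)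
    (h : IndepFun U W μ) {B : Set E} (hB : MeasurableSet B) {s : E → ℝ} (hs : Measurable s)
    (x : ℝ) :
    μ {ω | U ω ∈ B ∧ x < s (U ω) + W ω} =
      (((μ.restrict (U ⁻¹' B)).map (fun ω => s (U ω))).prod (μ.map W)) {p | x < p.1 + p.2} := by
  have := Measure.isProbabilityMeasure_map hWm.aemeasurable (μ := μ)
  have hm : MeasurableSet {p : ℝ × ℝ | x < p.1 + p.2} := by measurability
  have hm2 : MeasurableSet {p : E × ℝ | p.1 ∈ B ∧ x < s p.1 + p.2} :=
    (measurable_fst hB).inter (measurableSet_lt (f := fun _ => x)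
      (g := fun p : E × ℝ => s p.1 + p.2) measurable_const (by fun_prop))
  have e1 : {ω | U ω ∈ B ∧ x < s (U ω) + W ω} =
      (fun ω => (U ω, W ω)) ⁻¹' {p : E × ℝ | p.1 ∈ B ∧ x < s p.1 + p.2} := rfl
  rw [e1, ← Measure.map_apply (hUm.prodMk hWm) hm2,
    h.map_prod_eq_prod_map_map hUm.aemeasurable hWm.aemeasurable,
    Measure.prod_apply hm2, Measure.prod_apply hm, lintegral_map (measurable_measure_prodMk_left hm2)
      hUm, lintegral_map (measurable_measure_prodMk_left hm)
      (show Measurable fun ω => s (U ω) from hs.comp hUm),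
    ← lintegral_indicator (hUm hB)]
  refine lintegral_congr fun ω => ?_
  by_cases hω : U ω ∈ B
  · rw [Set.indicator_of_mem (show ω ∈ U ⁻¹' B from hω)]
    congr 1
    ext w
    simp [hω]
  · rw [Set.indicator_of_notMem (show ω ∉ U ⁻¹' B from hω)]
    convert measure_empty (μ := μ.map W)
    ext w
    simp [hω]

end Independence

/-! ### First crossing of a sloping line -/

section Walk

variable {Ω : Type*} [MeasurableSpace Ω] {μ : Measure Ω} {X : ℕ → Ω → ℝ}

/-- Extension of a finite sequence by zero. -/
def extendZero (n : ℕ) (y : Fin n → ℝ) (k : ℕ) : ℝ := if h : k < n then y ⟨k, h⟩ else 0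

theorem measurable_extendZero (n : ℕ) : Measurable (extendZero n) := by
  refine measurable_pi_lambda _ fun k => ?_
  unfold extendZero
  split_ifs with h
  · exact measurable_pi_apply _
  · exact measurable_const

theorem sum_extendZero {n j : ℕ} (hj : j ≤ n) (x : ℕ → ℝ) :
    ∑ i ∈ Finset.range j, extendZero n (fun i => x i) i = ∑ i ∈ Finset.range j, x i := by
  refine Finset.sum_congr rfl fun i hi => ?_
  have := Finset.mem_range.1 hi
  simp [extendZero, show i < n by omega]

/-- Sequences whose partial sums exceed the line `b - k α` for the first time at `k = n`. -/
def firstCrossing (b α : ℝ) (n : ℕ) : Set (ℕ → ℝ) :=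
  {x | b - n * α < ∑ i ∈ Finset.range n, x i ∧
    ∀ j < n, ∑ i ∈ Finset.range j, x i ≤ b - j * α}

theorem measurableSet_firstCrossing (b α : ℝ) (n : ℕ) : MeasurableSet (firstCrossing b α n) := by
  refine MeasurableSet.inter (measurableSet_lt (f := fun _ => b - n * α)
    (g := fun x : ℕ → ℝ => ∑ i ∈ Finset.range n, x i) measurable_const (by fun_prop)) ?_
  have : {x : ℕ → ℝ | ∀ j < n, ∑ i ∈ Finset.range j, x i ≤ b - j * α} =
      ⋂ j, ⋂ (_ : j < n), {x : ℕ → ℝ | ∑ i ∈ Finset.range j, x i ≤ b - j * α} := by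
    ext; simp
  rw [show (fun x : ℕ → ℝ => ∀ j < n, ∑ i ∈ Finset.range j, x i ≤ b - j * α) =
    {x : ℕ → ℝ | ∀ j < n, ∑ i ∈ Finset.range j, x i ≤ b - j * α} from rfl, this]
  exact MeasurableSet.iInter fun j => MeasurableSet.iInter fun _ =>
    measurableSet_le (by fun_prop) measurable_const

theorem extendZero_mem_firstCrossing {b α : ℝ} {n : ℕ} {x : ℕ → ℝ} :
    extendZero n (fun i => x i) ∈ firstCrossing b α n ↔ x ∈ firstCrossing b α n := by
  change (_ ∧ _) ↔ (_ ∧ _)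
  rw [sum_extendZero le_rfl]
  refine and_congr_right fun _ => forall₂_congr fun j hj => ?_
  rw [sum_extendZero hj.le]

/-- The (defective) law of the value of the walk at the first crossing of the line `b - k α`. -/
noncomputable def crossingLaw (X : ℕ → Ω → ℝ) (μ : Measure Ω) (b α : ℝ) : Measure ℝ :=
  Measure.sum fun n => (μ.restrict {ω | (fun k => X k ω) ∈ firstCrossing b α n}).map
    fun ω => ∑ i ∈ Finset.range n, X i ω

theorem measurableSet_crossing (hX : ∀ n, Measurable (X n)) (b α : ℝ) (n : ℕ) :
    MeasurableSet {ω | (fun k => X k ω) ∈ firstCrossing b α n} :=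
  (measurable_pi_lambda _ hX) (measurableSet_firstCrossing b α n)

/-- The first-crossing events for different indices are disjoint, so their total mass is the
probability of ever crossing. -/
theorem crossingLaw_univ_le (hX : ∀ n, Measurable (X n)) (b α : ℝ) :
    crossingLaw X μ b α Set.univ ≤ μ {ω | ∃ n : ℕ, b - n * α < ∑ i ∈ Finset.range n, X i ω} := by
  rw [crossingLaw, Measure.sum_apply _ MeasurableSet.univ]
  have : ∀ n, (μ.restrict {ω | (fun k => X k ω) ∈ firstCrossing b α n}).map
      (fun ω => ∑ i ∈ Finset.range n, X i ω) Set.univ =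
      μ {ω | (fun k => X k ω) ∈ firstCrossing b α n} := by
    intro n
    rw [Measure.map_apply (Finset.measurable_fun_sum _ fun i _ => hX i) MeasurableSet.univ,
      Set.preimage_univ, Measure.restrict_apply_univ]
  simp_rw [this]
  rw [← measure_iUnion]
  · refine measure_mono (Set.iUnion_subset fun n ω h => ⟨n, h.1⟩)
  · intro n m hnm
    rw [Function.onFun, Set.disjoint_left]
    intro ω h1 h2
    rcases lt_or_gt_of_ne hnm with h | h
    · exact absurd h1.1 (not_lt.2 (h2.2 n h))
    · exact absurd h2.1 (not_lt.2 (h1.2 m h))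
  · exact measurableSet_crossing hX b α

/-- Just before a first crossing at `n + 1` the walk is at most `b - nα`, so landing above `x`
forces the last step above `x - b + nα`. Index `0` contributes nothing because `b ≥ 0`. -/
theorem crossingLaw_Ioi_le (hX : IsIID X μ) {b α : ℝ} (hb : 0 ≤ b) (x : ℝ) :
    crossingLaw X μ b α (Set.Ioi x) ≤ ∑' n : ℕ, μ {ω | x - b + n * α < X 0 ω} := by
  rw [crossingLaw, Measure.sum_apply _ measurableSet_Ioi, tsum_eq_zero_add' ENNReal.summable]
  have h0 : (μ.restrict {ω | (fun k => X k ω) ∈ firstCrossing b α 0}).map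
      (fun ω => ∑ i ∈ Finset.range 0, X i ω) (Set.Ioi x) = 0 := by
    have : {ω | (fun k => X k ω) ∈ firstCrossing b α 0} = ∅ := by
      ext ω; simp [firstCrossing, hb]
    simp [this]
  rw [h0, zero_add]
  refine ENNReal.tsum_le_tsum fun n => ?_
  have hS : Measurable fun ω => ∑ i ∈ Finset.range (n + 1), X i ω :=
    Finset.measurable_fun_sum _ fun i _ => hX.meas i
  rw [Measure.map_apply hS measurableSet_Ioi, Measure.restrict_apply (hS measurableSet_Ioi)]
  have h1 : μ {ω | x - b + n * α < X n ω} = μ {ω | x - b + n * α < X 0 ω} :=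
    (hX.ident n).measure_mem_eq measurableSet_Ioi
  rw [← h1]
  refine measure_mono ?_
  rintro ω ⟨h2, h3⟩
  have h4 := h3.2 n (Nat.lt_succ_self n)
  have h5 : x < ∑ i ∈ Finset.range (n + 1), X i ω := h2
  rw [Finset.sum_range_succ] at h5
  change x - b + n * α < X n ω
  linarith

theorem measureReal_lt_maxWalk_zero {y : ℝ} (hy : 0 ≤ y) :
    μ.real {ω | y < maxWalk 0 (fun k => X k ω)} = 0 := by
  have : {ω | y < maxWalk 0 (fun k => X k ω)} = ∅ := by
    ext ω; simp [maxWalk, hy]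
  simp [this]

variable [IsProbabilityMeasure μ]

/-- Renewal inequality at the first crossing. -/
theorem measure_lt_maxWalk_succ_le (hX : IsIID X μ) {b α : ℝ} (hα : 0 ≤ α) (hb : 0 ≤ b) {x : ℝ}
    (hx : b ≤ x) (N : ℕ) :
    μ {ω | x < maxWalk (N + 1) (fun k => X k ω)} ≤
      ((crossingLaw X μ b α).prod (μ.map fun ω => maxWalk N fun k => X k ω))
        {p | x < p.1 + p.2} := by
  have hmw : ∀ n, Measurable fun ω => maxWalk N fun k => X (n + k) ω := fun n =>
    (measurable_maxWalk N).comp (measurable_pi_lambda _ fun k => hX.meas _)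
  have hmw0 : Measurable fun ω => maxWalk N fun k => X k ω :=
    (measurable_maxWalk N).comp (measurable_pi_lambda _ fun k => hX.meas _)
  have := Measure.isProbabilityMeasure_map hmw0.aemeasurable (μ := μ)
  have hsub : {ω | x < maxWalk (N + 1) (fun k => X k ω)} ⊆
      ⋃ n, {ω | (fun k => X k ω) ∈ firstCrossing b α n ∧
        x < ∑ i ∈ Finset.range n, X i ω + maxWalk N fun k => X (n + k) ω} := by
    intro ω hω
    obtain ⟨k, hk, hxk⟩ := lt_maxWalk.1 (show x < maxWalk (N + 1) (fun k => X k ω) from hω)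
    have hex : ∃ n : ℕ, b - n * α < ∑ i ∈ Finset.range n, X i ω :=
      ⟨k, by have : 0 ≤ k * α := by positivity
             linarith⟩
    classical
    have hfind := Nat.find_spec hex
    have hmin : ∀ j < Nat.find hex, ∑ i ∈ Finset.range j, X i ω ≤ b - j * α := fun j hj =>
      not_lt.1 (Nat.find_min hex hj)
    have hle : Nat.find hex ≤ k := Nat.find_min' hex (by
      have : 0 ≤ k * α := by positivity
      linarith)
    -- A crossing uses at least one step, so at most `N` of the `N + 1` steps remain after it.
    have hpos : Nat.find hex ≠ 0 := by
      intro h0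
      rw [h0] at hfind
      simp at hfind
      linarith
    refine Set.mem_iUnion.2 ⟨Nat.find hex, ⟨hfind, hmin⟩, ?_⟩
    obtain ⟨l, hl⟩ := Nat.exists_eq_add_of_le hle
    set n := Nat.find hex
    have h1 : x < ∑ i ∈ Finset.range n, X i ω + ∑ i ∈ Finset.range l, X (n + i) ω := by
      rw [← Finset.sum_range_add, ← hl]; exact hxk
    have h2 : x - ∑ i ∈ Finset.range n, X i ω < maxWalk N fun k => X (n + k) ω :=
      lt_maxWalk.2 ⟨l, by omega, by linarith⟩
    linarith
  refine (measure_mono hsub).trans ((measure_iUnion_le _).trans ?_)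
  have hm : MeasurableSet {p : ℝ × ℝ | x < p.1 + p.2} := by measurability
  rw [Measure.prod_apply hm, crossingLaw, lintegral_sum_measure]
  refine ENNReal.tsum_le_tsum fun n => ?_
  rw [← Measure.prod_apply hm]
  -- The crossing event at `n` and the crossing value depend only on the first `n` steps; padding
  -- with zeros expresses both through those steps, which are independent of the later ones.
  have hind : IndepFun (fun ω => extendZero n fun i => X i ω)
      (fun ω => maxWalk N fun k => X (n + k) ω) μ :=
    (hX.indepFun_past_future n).comp (measurable_extendZero n) (measurable_maxWalk N)
  have hU : Measurable fun ω => extendZero n fun i : Fin n => X i ω :=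
    (measurable_extendZero n).comp (measurable_pi_lambda _ fun i => hX.meas _)
  have key := measure_mem_and_lt_add hU (hmw n) hind (measurableSet_firstCrossing b α n)
    (s := fun x => ∑ i ∈ Finset.range n, x i) (by fun_prop) x
  have hlaw : μ.map (fun ω => maxWalk N fun k => X (n + k) ω) =
      μ.map (fun ω => maxWalk N fun k => X k ω) :=
    ((hX.identDistrib_shift n).comp (measurable_maxWalk N)).map_eq
  rw [hlaw] at key
  have hpre : (fun ω => extendZero n fun i : Fin n => X i ω) ⁻¹' firstCrossing b α n =
      {ω | (fun k => X k ω) ∈ firstCrossing b α n} := by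
    ext ω
    exact extendZero_mem_firstCrossing (x := fun k => X k ω)
  have hsum : ∀ ω, ∑ i ∈ Finset.range n, extendZero n (fun i : Fin n => X i ω) i =
      ∑ i ∈ Finset.range n, X i ω := fun ω => sum_extendZero le_rfl (fun k => X k ω)
  simp only [hsum, hpre] at key
  rw [← key]
  refine measure_mono fun ω hω => ⟨?_, hω.2⟩
  exact extendZero_mem_firstCrossing.2 hω.1

/-- A random walk with negative drift is bounded above, uniformly with high probability. -/
theorem IsIID.exists_bound (hX : IsIID X μ) (hint : Integrable (X 0) μ) (hneg : μ[X 0] < 0)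
    {ε : ℝ} (hε : 0 < ε) :
    ∃ b : ℝ, 0 ≤ b ∧ μ.real {ω | ∃ n : ℕ, b < ∑ i ∈ Finset.range n, X i ω} ≤ ε := by
  have hS : ∀ n, Measurable fun ω => ∑ i ∈ Finset.range n, X i ω := fun n =>
    Finset.measurable_fun_sum _ fun i _ => hX.meas i
  -- By the strong law the partial sums are eventually nonpositive, so their supremum is a.s.
  -- finite; continuity from above then makes the exceedance probability small.
  have hlim := strong_law_ae_real X hint (fun i j hij => hX.indep.indepFun hij) hX.ident
  have hbdd : ∀ᵐ ω ∂μ, ∃ B : ℕ, ∀ n : ℕ, ∑ i ∈ Finset.range n, X i ω ≤ B := by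
    filter_upwards [hlim] with ω hω
    obtain ⟨N, hN⟩ := eventually_atTop.1 (hω.eventually (eventually_le_nhds hneg))
    obtain ⟨B, hB⟩ := ((Finset.range (N + 1)).image
      fun n => ∑ i ∈ Finset.range n, X i ω).exists_le
    obtain ⟨B', hB'⟩ := exists_nat_ge (max B 0)
    refine ⟨B', fun n => ?_⟩
    by_cases hn : n ≤ N
    · exact (hB _ (Finset.mem_image_of_mem _ (Finset.mem_range.2 (by omega)))).trans ((le_max_left _ _).trans hB')
    · have h1 := hN n (by omega)
      have hn0 : (0 : ℝ) < n := by exact_mod_cast (by omega : 0 < n)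
      have h2 : ∑ i ∈ Finset.range n, X i ω ≤ 0 := by
        rw [div_le_iff₀ hn0] at h1; linarith
      exact h2.trans ((le_max_right _ _).trans hB')
  have hanti : Antitone fun B : ℕ => {ω | ∃ n : ℕ, (B : ℝ) < ∑ i ∈ Finset.range n, X i ω} := by
    rintro B C hBC ω ⟨n, hn⟩
    exact ⟨n, lt_of_le_of_lt (by exact_mod_cast hBC) hn⟩
  have hmeas : ∀ B : ℕ,
      NullMeasurableSet {ω | ∃ n : ℕ, (B : ℝ) < ∑ i ∈ Finset.range n, X i ω} μ := by
    intro B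
    have : {ω | ∃ n : ℕ, (B : ℝ) < ∑ i ∈ Finset.range n, X i ω} =
        ⋃ n : ℕ, {ω | (B : ℝ) < ∑ i ∈ Finset.range n, X i ω} := by ext; simp
    rw [this]
    exact (MeasurableSet.iUnion fun n => measurableSet_lt measurable_const (hS n)).nullMeasurableSet
  have ht := tendsto_measure_iInter_atTop hmeas hanti ⟨0, measure_ne_top μ _⟩
  have hzero : μ (⋂ B : ℕ, {ω | ∃ n : ℕ, (B : ℝ) < ∑ i ∈ Finset.range n, X i ω}) = 0 := by
    refine measure_mono_null ?_ (ae_iff.1 hbdd)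
    intro ω hω
    simp only [Set.mem_iInter, Set.mem_ofPred_eq] at hω ⊢
    push Not
    exact hω
  rw [hzero] at ht
  have ht' := (ENNReal.tendsto_toReal ENNReal.zero_ne_top).comp ht
  obtain ⟨B, hB⟩ := (ht'.eventually (eventually_le_nhds (by simpa using hε))).exists
  exact ⟨B, by positivity, hB⟩

/-- Tail condition on the sums `∑ₙ p (x - y + n α)`: asymptotically at most `c / α` times the tail
of `ν`. -/
def SumTailLE (p : ℝ → ℝ) (ν : Measure ℝ) (c : ℝ) : Prop :=
  ∀ α > 0, ∀ y : ℝ, ∀ ε > 0, ∀ᶠ x in atTop, ∀ N : ℕ,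
    ∑ n ∈ Finset.range N, p (x - y + n * α) ≤ (c / α + ε) * ν.real (Set.Ioi x)

/-! ### Upper bound in Veraverbeke's theorem by iterating the renewal inequality -/

section Veraverbeke

variable {ν : Measure ℝ} {c m : ℝ}

/-- Since `α < m`, the walk with steps `X + α` still drifts down, so `b` can be taken with crossing
mass at most `η/2`. The convolution bound then multiplies `K` by at most `η`, which makes the
iteration a contraction. -/
theorem maxWalk_succ_tail_le (hν : SubexpLaw ν) (hX : IsIID X μ) (hint : Integrable (X 0) μ)
    (hmean : μ[X 0] = -m) (hc : 0 ≤ c)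
    (htail : SumTailLE (fun x => μ.real {ω | x < X 0 ω}) ν c) {α η : ℝ} (hα : 0 < α) (hαm : α < m)
    (hη : 0 < η) :
    ∃ A₀ : ℝ, ∀ A, A₀ ≤ A → ∀ᶠ x in atTop, ∀ (K : ℝ) (N : ℕ), 0 ≤ K →
      (∀ y, A ≤ y → μ.real {ω | y < maxWalk N (fun k => X k ω)} ≤ K * ν.real (Set.Ioi y)) →
      μ.real {ω | x < maxWalk (N + 1) (fun k => X k ω)} ≤
        (c / α + η + K * η) * ν.real (Set.Ioi x) := by
  have := hν.prob
  have hXα : IsIID (fun n ω => X n ω + α) μ := hX.comp (g := fun x => x + α) (by fun_prop)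
  have hmeanα : ∫ ω, X 0 ω + α ∂μ < 0 := by
    rw [integral_add hint (integrable_const _), hmean]
    simpa using hαm
  obtain ⟨b, hb, hbη⟩ := hXα.exists_bound (hint.add (integrable_const _)) hmeanα (half_pos hη)
  have hfin : IsFiniteMeasure (crossingLaw X μ b α) :=
    ⟨(crossingLaw_univ_le hX.meas b α).trans_lt (measure_lt_top _ _)⟩
  have hmass : (crossingLaw X μ b α).real Set.univ ≤ η / 2 := by
    refine le_trans (ENNReal.toReal_mono (measure_ne_top _ _) (crossingLaw_univ_le hX.meas b α)) ?_
    refine le_trans (le_of_eq ?_) hbη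
    rw [measureReal_def]
    congr 2
    ext ω
    refine exists_congr fun n => ?_
    rw [Finset.sum_add_distrib, Finset.sum_const, Finset.card_range, nsmul_eq_mul]
    exact sub_lt_iff_lt_add
  have hGtail : ∀ᶠ x in atTop, (crossingLaw X μ b α).real (Set.Ioi x) ≤
      (c / α + η / 2) * ν.real (Set.Ioi x) := by
    filter_upwards [htail α hα b (η / 2) (half_pos hη)] with x hx
    refine ENNReal.toReal_le_of_le_ofReal (by positivity) ((crossingLaw_Ioi_le hX hb x).trans ?_)
    refine ENNReal.tsum_le_of_sum_range_le fun N => ?_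
    refine le_trans (le_of_eq ?_) (ENNReal.ofReal_le_ofReal (hx N))
    rw [ENNReal.ofReal_sum_of_nonneg fun _ _ => measureReal_nonneg]
    exact Finset.sum_congr rfl fun n _ => by rw [ofReal_measureReal]
  obtain ⟨A₀, hA₀⟩ := hν.conv_tail_le (crossingLaw X μ b α) (by positivity) hGtail (half_pos hη)
  refine ⟨A₀, fun A hA => ?_⟩
  filter_upwards [hA₀ A hA, eventually_ge_atTop b] with x hx hbx K N hK hN
  have hmw0 : Measurable fun ω => maxWalk N fun k => X k ω :=
    (measurable_maxWalk N).comp (measurable_pi_lambda _ fun k => hX.meas _)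
  have hpr := Measure.isProbabilityMeasure_map hmw0.aemeasurable (μ := μ)
  have h1 := hx K (μ.map fun ω => maxWalk N fun k => X k ω) hK hpr fun y hy => by
    rw [map_measureReal_apply hmw0 measurableSet_Ioi]
    exact hN y hy
  have h2 := ENNReal.toReal_mono (measure_ne_top _ _)
    (measure_lt_maxWalk_succ_le hX hα.le hb hbx N)
  refine h2.trans (h1.trans ?_)
  have h3 := hν.pos x
  gcongr ?_ * _
  nlinarith

/-- Upper half of Veraverbeke's theorem. -/
theorem maxWalk_tail_le (hν : SubexpLaw ν) (hX : IsIID X μ) (hint : Integrable (X 0) μ)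
    (hmean : μ[X 0] = -m) (hm : 0 < m) (hc : 0 ≤ c)
    (htail : SumTailLE (fun x => μ.real {ω | x < X 0 ω}) ν c) {ε : ℝ} (hε : 0 < ε) :
    ∀ᶠ x in atTop, ∀ N : ℕ, μ.real {ω | x < maxWalk N (fun k => X k ω)} ≤
      (c / m + ε) * ν.real (Set.Ioi x) := by
  have := hν.prob
  obtain ⟨A₀, hA₀⟩ := maxWalk_succ_tail_le hν hX hint hmean hc htail (half_pos hm)
    (by linarith : m / 2 < m) (η := 1 / 2) (by norm_num)
  set A := max A₀ 0 with hA
  obtain ⟨x₀, hx₀⟩ := eventually_atTop.1 (hA₀ A (le_max_left _ _))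
  -- The second entry makes `K₀` stable under `K ↦ c/(m/2) + 1/2 + K/2`; the first covers `y < x₀`,
  -- where probabilities are just bounded by `1`.
  set K₀ := max (1 / ν.real (Set.Ioi x₀)) (2 * (c / (m / 2) + 1 / 2)) with hK₀
  have hK₀0 : 0 ≤ K₀ := le_trans (by positivity) (le_max_right _ _)
  have hbase : ∀ N : ℕ, ∀ y, A ≤ y →
      μ.real {ω | y < maxWalk N (fun k => X k ω)} ≤ K₀ * ν.real (Set.Ioi y) := by
    intro N
    induction N with
    | zero =>
      intro y hy
      rw [measureReal_lt_maxWalk_zero ((le_max_right _ _).trans hy)]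
      positivity
    | succ N ih =>
      intro y hy
      rcases le_or_gt x₀ y with h | h
      · refine (hx₀ y h K₀ N hK₀0 ih).trans ?_
        have h1 := hν.pos y
        have h2 : 2 * (c / (m / 2) + 1 / 2) ≤ K₀ := le_max_right _ _
        gcongr ?_ * _
        linarith
      · have h1 : ν.real (Set.Ioi x₀) ≤ ν.real (Set.Ioi y) := antitone_measureReal_Ioi ν h.le
        have h2 := hν.pos x₀
        calc _ ≤ 1 := measureReal_le_one
          _ = 1 / ν.real (Set.Ioi x₀) * ν.real (Set.Ioi x₀) := by field_simp
          _ ≤ _ := by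
            gcongr
            exact le_max_left _ _
  obtain ⟨α, hα0, hαm, hα⟩ : ∃ α, 0 < α ∧ α < m ∧ c / α ≤ c / m + ε / 3 := by
    have hcont : Tendsto (fun α => c / α) (𝓝[<] m) (𝓝 (c / m)) :=
      ((continuousAt_const.div continuousAt_id hm.ne').tendsto).mono_left nhdsWithin_le_nhds
    have h1 := hcont.eventually (eventually_le_nhds (show c / m < c / m + ε / 3 by linarith))
    obtain ⟨α, h2, h3, h4⟩ := (h1.and (Ioo_mem_nhdsLT hm)).exists
    exact ⟨α, h3, h4, h2⟩
  -- Because `K₀` is uniform in `N`, a single further application, now with `α` near `m`, suffices;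
  -- this `η` makes `η + K₀η = ε/3`.
  have hη : 0 < ε / (3 * (K₀ + 1)) := by positivity
  obtain ⟨A₁, hA₁⟩ := maxWalk_succ_tail_le hν hX hint hmean hc htail hα0 hαm hη
  filter_upwards [hA₁ (max A₁ A) (le_max_left _ _), eventually_ge_atTop 0] with x hx hx0 N
  have htx := hν.pos x
  cases N with
  | zero =>
    rw [measureReal_lt_maxWalk_zero hx0]
    positivity
  | succ N =>
    refine (hx K₀ N hK₀0 fun y hy => hbase N y ((le_max_right _ _).trans hy)).trans ?_
    gcongr ?_ * _
    have e1 : ε / (3 * (K₀ + 1)) + K₀ * (ε / (3 * (K₀ + 1))) = ε / 3 := by field_simp; ring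
    linarith

/-- Upper half of Veraverbeke's theorem, with an independent initial value of lighter tail. -/
theorem add_walk_tail_le (hν : SubexpLaw ν) (hX : IsIID X μ) (hint : Integrable (X 0) μ)
    (hmean : μ[X 0] = -m) (hm : 0 < m) (hc : 0 ≤ c)
    (htail : SumTailLE (fun x => μ.real {ω | x < X 0 ω}) ν c)
    {W : Ω → ℝ} (hWm : Measurable W) (hW : IndepFun W (fun ω k => X k ω) μ)
    (hWtail : ∀ ε > 0, ∀ᶠ x in atTop, μ.real {ω | x < W ω} ≤ ε * ν.real (Set.Ioi x))
    {ε : ℝ} (hε : 0 < ε) :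
    ∀ᶠ x in atTop, μ.real {ω | ∃ n : ℕ, x < W ω + ∑ i ∈ Finset.range n, X i ω} ≤
      (c / m + ε) * ν.real (Set.Ioi x) := by
  have := hν.prob
  have hWpr := Measure.isProbabilityMeasure_map hWm.aemeasurable (μ := μ)
  set K := c / m + ε / 2 with hK
  have hη : 0 < ε / (4 * (K + 1)) := by positivity
  have hG : ∀ᶠ x in atTop, (μ.map W).real (Set.Ioi x) ≤
      ε / (4 * (K + 1)) * ν.real (Set.Ioi x) := by
    filter_upwards [hWtail _ hη] with x hx
    rwa [map_measureReal_apply hWm measurableSet_Ioi]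
  -- The law of `W` plays the role of the crossing law, now with full mass: the coefficient `K` of
  -- the walk survives, and the tail of `W` adds only multiples of `η`.
  obtain ⟨A₀, hA₀⟩ := hν.conv_tail_le (μ.map W) hη.le hG hη
  obtain ⟨A₁, hA₁⟩ := eventually_atTop.1
    (maxWalk_tail_le hν hX hint hmean hm hc htail (half_pos hε))
  filter_upwards [hA₀ (max A₀ A₁) (le_max_left _ _)] with x hx
  refine measureReal_exists_le fun N => ?_
  have hmw0 : Measurable fun ω => maxWalk N fun k => X k ω :=
    (measurable_maxWalk N).comp (measurable_pi_lambda _ fun k => hX.meas _)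
  have hpr := Measure.isProbabilityMeasure_map hmw0.aemeasurable (μ := μ)
  have h1 := hx K (μ.map fun ω => maxWalk N fun k => X k ω) (by positivity) hpr fun y hy => by
    rw [map_measureReal_apply hmw0 measurableSet_Ioi]
    exact hA₁ y ((le_max_right _ _).trans hy) N
  have hind : IndepFun W (fun ω => maxWalk N fun k => X k ω) μ :=
    hW.comp measurable_id (measurable_maxWalk N)
  have hm2 : MeasurableSet {p : ℝ × ℝ | x < p.1 + p.2} := by measurability
  have e : {ω | ∃ n ≤ N, x < W ω + ∑ i ∈ Finset.range n, X i ω} =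
      (fun ω => (W ω, maxWalk N fun k => X k ω)) ⁻¹' {p : ℝ × ℝ | x < p.1 + p.2} := by
    ext ω
    change _ ↔ x < W ω + maxWalk N fun k => X k ω
    rw [← sub_lt_iff_lt_add', lt_maxWalk]
    simp only [sub_lt_iff_lt_add']
    rfl
  rw [e, ← map_measureReal_apply (hWm.prodMk hmw0) hm2,
    hind.map_prod_eq_prod_map_map hWm.aemeasurable hmw0.aemeasurable]
  refine h1.trans ?_
  rw [probReal_univ]
  have htx := hν.pos x
  gcongr ?_ * _
  have e1 : ε / (4 * (K + 1)) + ε / (4 * (K + 1)) + K * (ε / (4 * (K + 1))) ≤ ε / 2 := by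
    have : 0 ≤ K := by positivity
    have h4 : ε / (4 * (K + 1)) * (K + 1) = ε / 4 := by field_simp
    nlinarith
  linarith

end Veraverbeke

end Walk

/-! ## Tails and integrated tails -/

/-- `h` is a tail function whose integrated tail is, near infinity, the tail of a subexponential
law `ν`. -/
structure IsIntegratedTail (h : ℝ → ℝ) (ν : Measure ℝ) : Prop where
  subexp : SubexpLaw ν
  anti : Antitone h
  pos : ∀ x, 0 < h x
  int : IntegrableOn h (Set.Ioi 0)
  eq : ∀ᶠ x in atTop, ν.real (Set.Ioi x) = ∫ u in Set.Ioi x, h u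

theorem exists_isIntegratedTail {F : ℝ → ℝ} (hF : IsSubexponential F)
    (hint : IntegrableOn (tail F) (Set.Ioi 0))
    (hFs : IsSubexponential (integratedTailCDF F)) :
    ∃ ν : Measure ℝ, IsIntegratedTail (tail F) ν ∧
      ∀ x, tail (integratedTailCDF F) x = ν.real (Set.Ioi x) := by
  obtain ⟨νF, hνF, hF'⟩ := hF.exists_law
  obtain ⟨ν, hν, hν'⟩ := hFs.exists_law
  have := hνF.prob
  have := hν.prob
  refine ⟨ν, ⟨hν, ?_, fun x => hF' x ▸ hνF.pos x, hint, ?_⟩, hν'⟩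
  · intro x y hxy
    rw [hF', hF']
    exact antitone_measureReal_Ioi νF hxy
  -- The truncation by `1` in the integrated tail is inactive as soon as the tail of `ν` is below
  -- `1`.
  · filter_upwards [(tendsto_measureReal_Ioi ν).eventually (eventually_lt_nhds zero_lt_one),
      eventually_ge_atTop 0] with x hx hx0
    rw [← hν', tail, integratedTailCDF, if_neg (not_lt.2 hx0), sub_sub_cancel] at hx ⊢
    exact min_eq_right (by
      rcases min_lt_iff.1 hx with h | h
      · exact absurd h (lt_irrefl _)
      · exact h.le)

section

variable {h : ℝ → ℝ}

theorem integral_comp_affine (h : ℝ → ℝ) {α : ℝ} (hα : 0 < α) (x : ℝ) (N : ℕ) :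
    α * ∫ s in (0 : ℝ)..(0 + N), h (x + α * s) = ∫ u in x..(x + α * N), h u := by
  rw [intervalIntegral.integral_comp_add_mul h hα.ne' x, smul_eq_mul, mul_inv_cancel_left₀ hα.ne']
  simp

/-- By monotonicity `α h(x + nα)` is at most the integral of `h` over the cell of length `α` to the
left; this moves the lower limit to `x - α`. -/
theorem sum_le_integral_Ioi (hh : Antitone h) (h0 : ∀ x, 0 < h x) {α : ℝ} (hα : 0 < α) {x : ℝ}
    (hint : IntegrableOn h (Set.Ioi (x - α))) (N : ℕ) :
    α * ∑ n ∈ Finset.range N, h (x + n * α) ≤ ∫ u in Set.Ioi (x - α), h u := by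
  have hanti : AntitoneOn (fun s => h ((x - α) + α * s)) (Set.Icc (0 : ℝ) (0 + N)) :=
    fun a _ b _ hab => hh (by gcongr)
  have h1 := hanti.sum_le_integral
  calc α * ∑ n ∈ Finset.range N, h (x + n * α)
      = α * ∑ n ∈ Finset.range N, h ((x - α) + α * (0 + ((n + 1 : ℕ) : ℝ))) := by
        congr 1
        refine Finset.sum_congr rfl fun n _ => ?_
        congr 1
        push_cast
        ring
    _ ≤ α * ∫ s in (0 : ℝ)..(0 + N), h ((x - α) + α * s) := by gcongr
    _ = ∫ u in (x - α)..((x - α) + α * N), h u := integral_comp_affine h hα _ N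
    _ ≤ _ := by
        rw [intervalIntegral.integral_of_le (by linarith [show 0 ≤ α * N by positivity])]
        exact setIntegral_mono_set hint (Eventually.of_forall fun u => (h0 u).le)
          (Eventually.of_forall fun u hu => hu.1)

theorem integral_le_sum (hh : Antitone h) {α : ℝ} (hα : 0 < α) (x : ℝ) (N : ℕ) :
    ∫ u in x..(x + α * N), h u ≤ α * ∑ n ∈ Finset.range N, h (x + n * α) := by
  have hanti : AntitoneOn (fun s => h (x + α * s)) (Set.Icc (0 : ℝ) (0 + N)) :=
    fun a _ b _ hab => hh (by gcongr)
  have h1 := hanti.integral_le_sum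
  rw [← integral_comp_affine h hα]
  refine (mul_le_mul_of_nonneg_left h1 hα.le).trans (le_of_eq ?_)
  congr 1
  refine Finset.sum_congr rfl fun n _ => ?_
  congr 1
  ring

end

namespace IsIntegratedTail

variable {h : ℝ → ℝ} {ν : Measure ℝ}

theorem integrableOn_Ioi (hh : IsIntegratedTail h ν) {x : ℝ} (hx : 0 ≤ x) :
    IntegrableOn h (Set.Ioi x) := hh.int.mono_set (Set.Ioi_subset_Ioi hx)

/-- The tail is negligible with respect to the integrated tail. -/
theorem eventually_le (hh : IsIntegratedTail h ν) {ε : ℝ} (hε : 0 < ε) :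
    ∀ᶠ x in atTop, h x ≤ ε * ν.real (Set.Ioi x) := by
  have hshift : Tendsto (fun x : ℝ => x - 1) atTop atTop := tendsto_atTop_add_const_right _ _ tendsto_id
  filter_upwards [hh.subexp.long_tailed 1 hε, hh.eq, hshift.eventually hh.eq,
    eventually_ge_atTop 1] with x h1 h2 h3 h4
  have e : ∫ u in Set.Ioi (x - 1), h u =
      (∫ u in Set.Ioc (x - 1) x, h u) + ∫ u in Set.Ioi x, h u := by
    rw [← setIntegral_union (Set.Ioc_disjoint_Ioi le_rfl)
      measurableSet_Ioi ((hh.integrableOn_Ioi (by linarith : 0 ≤ x - 1)).mono_set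
        fun u hu => hu.1) (hh.integrableOn_Ioi (by linarith)), Set.Ioc_union_Ioi_eq_Ioi (by linarith)]
  -- Monotonicity bounds `h x` by the increment of the integrated tail over `(x - 1, x]`, which is
  -- negligible by long-tailedness.
  have h5 : h x ≤ ∫ u in Set.Ioc (x - 1) x, h u := by
    have : ∫ u in Set.Ioc (x - 1) x, h x = h x := by simp
    rw [← this]
    refine setIntegral_mono_on (by simp) ((hh.integrableOn_Ioi
      (by linarith : 0 ≤ x - 1)).mono_set fun u hu => hu.1) measurableSet_Ioc fun u hu => hh.anti hu.2
  rw [h2] at h1 ⊢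
  rw [h3] at h1
  linarith

theorem eventually_le_of_le (hh : IsIntegratedTail h ν) {p : ℝ → ℝ} {C : ℝ}
    (hp : ∀ᶠ x in atTop, p x ≤ C * h x) {ε : ℝ} (hε : 0 < ε) :
    ∀ᶠ x in atTop, p x ≤ ε * ν.real (Set.Ioi x) := by
  have hη : 0 < ε / (|C| + 1) := by positivity
  filter_upwards [hp, hh.eventually_le hη] with x h1 h2
  have h3 := hh.pos x
  have h4 := hh.subexp.pos x
  calc p x ≤ C * h x := h1
    _ ≤ (|C| + 1) * h x := by gcongr; linarith [le_abs_self C]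
    _ ≤ (|C| + 1) * (ε / (|C| + 1) * ν.real (Set.Ioi x)) := by gcongr
    _ = _ := by field_simp

/-- The sum is compared with `(d + δ)/α` times an integral from `x - y - α`, and long-tailedness of
the integrated tail absorbs the fixed shift. -/
theorem sumTailLE (hh : IsIntegratedTail h ν) {p : ℝ → ℝ} {d : ℝ} (hd : 0 ≤ d)
    (hp : ∀ δ > 0, ∀ᶠ x in atTop, p x ≤ (d + δ) * h x) : SumTailLE p ν d := by
  intro α hα y ε hε
  -- With `δ ≤ 1`, `(d + δ)(1 + δ) ≤ d + δ(d + 2) ≤ d + αε`.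
  set δ := min 1 (α * ε / (d + 2)) with hδ
  have hδ0 : 0 < δ := by positivity
  obtain ⟨x₁, hx₁⟩ := eventually_atTop.1 (hp δ hδ0)
  have hshift : Tendsto (fun x : ℝ => x - (y + α)) atTop atTop :=
    tendsto_atTop_add_const_right _ _ tendsto_id
  filter_upwards [hh.subexp.long_tailed (y + α) hδ0, hshift.eventually hh.eq,
    eventually_ge_atTop (x₁ + y), eventually_ge_atTop (y + α)] with x h1 h2 h3 h4 N
  have htx := hh.subexp.pos x
  have h5 : ∑ n ∈ Finset.range N, p (x - y + n * α) ≤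
      (d + δ) * ∑ n ∈ Finset.range N, h (x - y + n * α) := by
    rw [Finset.mul_sum]
    exact Finset.sum_le_sum fun n _ => hx₁ _ (by
      have : 0 ≤ n * α := by positivity
      linarith)
  have h6 := sum_le_integral_Ioi hh.anti hh.pos hα (x := x - y)
    (hh.integrableOn_Ioi (by linarith)) N
  rw [show x - y - α = x - (y + α) by ring, ← h2] at h6
  have h7 : ∑ n ∈ Finset.range N, h (x - y + n * α) ≤ (1 + δ) * ν.real (Set.Ioi x) / α := by
    rw [le_div_iff₀ hα]
    linarith
  refine h5.trans ((mul_le_mul_of_nonneg_left h7 (by positivity)).trans ?_)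
  have h8 : (d + δ) * (1 + δ) ≤ d + α * ε := by
    have e1 : δ ≤ 1 := min_le_left _ _
    have e2 : δ * (d + 2) ≤ α * ε := by
      have := min_le_right 1 (α * ε / (d + 2))
      rwa [← hδ, le_div_iff₀ (by positivity)] at this
    nlinarith
  calc (d + δ) * ((1 + δ) * ν.real (Set.Ioi x) / α)
      = (d + δ) * (1 + δ) * (ν.real (Set.Ioi x) / α) := by ring
    _ ≤ (d + α * ε) * (ν.real (Set.Ioi x) / α) := by gcongr
    _ = _ := by field_simp

/-- Lower bound for the sums `∑ₙ p (x + y + n α)`. -/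
theorem le_sum (hh : IsIntegratedTail h ν) {p : ℝ → ℝ} (hp0 : ∀ x, 0 ≤ p x) {d : ℝ}
    (hd : 0 ≤ d) (hp : ∀ δ > 0, ∀ᶠ x in atTop, (d - δ) * h x ≤ p x) {α : ℝ} (hα : 0 < α) {y : ℝ}
    (hy : 0 ≤ y) {ε : ℝ} (hε : 0 < ε) :
    ∀ᶠ x in atTop, ∀ᶠ N : ℕ in atTop,
      (d / α - ε) * ν.real (Set.Ioi x) ≤ ∑ n ∈ Finset.range N, p (x + y + n * α) := by
  rcases hd.eq_or_lt with rfl | hdpos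
  · refine Eventually.of_forall fun x => Eventually.of_forall fun N => ?_
    have h1 := hh.subexp.pos x
    have h2 : 0 ≤ ∑ n ∈ Finset.range N, p (x + y + n * α) := Finset.sum_nonneg fun _ _ => hp0 _
    rw [zero_div]
    nlinarith
  -- The errors `δ` and `ηd` each cost at most `αε/2`; the caps `d` and `1` keep both factors
  -- nonnegative. The case `d = 0` is separate because this `δ` would vanish.
  set δ := min d (α * ε / 2) with hδ
  set η := min 1 (α * ε / (2 * d)) with hη
  have hδ0 : 0 < δ := by positivity
  have hη0 : 0 < η := by positivity
  obtain ⟨x₁, hx₁⟩ := eventually_atTop.1 (hp δ hδ0)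
  have hshift : Tendsto (fun x : ℝ => x + y) atTop atTop :=
    tendsto_atTop_add_const_right _ _ tendsto_id
  filter_upwards [hshift.eventually (hh.subexp.long_tailed y (half_pos hη0)),
    hshift.eventually hh.eq, eventually_ge_atTop x₁, eventually_ge_atTop 0] with x h1 h2 h3 h4
  rw [add_sub_cancel_right] at h1
  have htx := hh.subexp.pos x
  have hη1 : η ≤ 1 := min_le_left _ _
  -- The strict inequality leaves room to truncate the integral at a finite `N` depending on `x`.
  have hlt : (1 - η) * ν.real (Set.Ioi x) < ∫ u in Set.Ioi (x + y), h u := by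
    rw [← h2]
    have hs := hh.subexp.pos (x + y)
    refine (mul_le_mul_of_nonneg_left h1 (sub_nonneg.2 hη1)).trans_lt ?_
    nlinarith [mul_pos hη0 hs, mul_pos hη0 (mul_pos hη0 hs)]
  have hconv : Tendsto (fun N : ℕ => ∫ u in (x + y)..(x + y + α * N), h u) atTop
      (𝓝 (∫ u in Set.Ioi (x + y), h u)) :=
    intervalIntegral_tendsto_integral_Ioi _ (hh.integrableOn_Ioi (by linarith))
      (tendsto_atTop_add_const_left _ _ (tendsto_natCast_atTop_atTop.const_mul_atTop hα))
  filter_upwards [hconv.eventually (eventually_gt_nhds hlt)] with N hN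
  have h5 := (hN.le).trans (integral_le_sum hh.anti hα (x + y) N)
  have hdδ : 0 ≤ d - δ := sub_nonneg.2 (min_le_left _ _)
  have h6 : (d - δ) * ∑ n ∈ Finset.range N, h (x + y + n * α) ≤
      ∑ n ∈ Finset.range N, p (x + y + n * α) := by
    rw [Finset.mul_sum]
    exact Finset.sum_le_sum fun n _ => hx₁ _ (by
      have : 0 ≤ n * α := by positivity
      linarith)
  refine le_trans ?_ h6
  have h7 : d - α * ε ≤ (d - δ) * (1 - η) := by
    have e1 : δ ≤ α * ε / 2 := min_le_right _ _
    have e2 : η * (2 * d) ≤ α * ε := by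
      have := min_le_right 1 (α * ε / (2 * d))
      rwa [← hη, le_div_iff₀ (by positivity)] at this
    nlinarith
  have h8 : (1 - η) * ν.real (Set.Ioi x) / α ≤ ∑ n ∈ Finset.range N, h (x + y + n * α) := by
    rw [div_le_iff₀ hα]; linarith
  calc (d / α - ε) * ν.real (Set.Ioi x) = (d - α * ε) * (ν.real (Set.Ioi x) / α) := by field_simp
    _ ≤ (d - δ) * (1 - η) * (ν.real (Set.Ioi x) / α) := by gcongr
    _ = (d - δ) * ((1 - η) * ν.real (Set.Ioi x) / α) := by ring
    _ ≤ _ := by gcongr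

end IsIntegratedTail

theorem TailEquiv.eventually_le {p h : ℝ → ℝ} {d : ℝ} (H : TailEquiv p d h) (hh : ∀ x, 0 < h x)
    {δ : ℝ} (hδ : 0 < δ) : ∀ᶠ x in atTop, p x ≤ (d + δ) * h x := by
  filter_upwards [H.eventually (eventually_le_nhds (show d < d + δ by linarith))] with x hx
  rwa [div_le_iff₀ (hh x)] at hx

theorem TailEquiv.eventually_ge {p h : ℝ → ℝ} {d : ℝ} (H : TailEquiv p d h) (hh : ∀ x, 0 < h x)
    {δ : ℝ} (hδ : 0 < δ) : ∀ᶠ x in atTop, (d - δ) * h x ≤ p x := by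
  filter_upwards [H.eventually (eventually_ge_nhds (show d - δ < d by linarith))] with x hx
  rwa [le_div_iff₀ (hh x)] at hx

theorem TailEquiv.nonneg {p h : ℝ → ℝ} {d : ℝ} (H : TailEquiv p d h) (hh : ∀ x, 0 < h x)
    (hp : ∀ x, 0 ≤ p x) : 0 ≤ d :=
  ge_of_tendsto' H fun x => div_nonneg (hp x) (hh x).le

/-- A nonnegative variable whose tail is dominated by an integrable function is integrable. -/
theorem integrable_of_tail_le {Ω : Type*} [MeasurableSpace Ω] {μ : Measure Ω} [IsFiniteMeasure μ]
    {Y : Ω → ℝ} (hY : Measurable Y) (hY0 : ∀ᵐ ω ∂μ, 0 ≤ Y ω) {h : ℝ → ℝ} {C : ℝ}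
    (hint : IntegrableOn h (Set.Ioi 0)) (hle : ∀ᶠ x in atTop, μ.real {ω | x < Y ω} ≤ C * h x) :
    Integrable Y μ := by
  refine ⟨hY.aestronglyMeasurable, ?_⟩
  rw [hasFiniteIntegral_iff_ofReal hY0, lintegral_eq_lintegral_meas_lt μ hY0 hY.aemeasurable]
  obtain ⟨x₁, hx₁⟩ := eventually_atTop.1 hle
  set B := max x₁ 0
  have hsplit : Set.Ioi (0 : ℝ) ⊆ Set.Ioc 0 B ∪ Set.Ioi B := fun u hu => by
    rcases le_or_gt u B with h | h
    · exact Or.inl ⟨hu, h⟩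
    · exact Or.inr h
  refine (lintegral_mono_set hsplit).trans_lt ((lintegral_union_le _ _ _).trans_lt
    (ENNReal.add_lt_top.2 ⟨?_, ?_⟩))
  · refine (setLIntegral_mono measurable_const
      (fun u _ => measure_mono (Set.subset_univ _))).trans_lt ?_
    rw [setLIntegral_const]
    exact ENNReal.mul_lt_top (measure_lt_top _ _) (by simp)
  · have h1 : IntegrableOn (fun x => C * h x) (Set.Ioi B) :=
      (hint.mono_set (Set.Ioi_subset_Ioi (le_max_right _ _))).const_mul C
    refine lt_of_le_of_lt (setLIntegral_mono' measurableSet_Ioi fun u hu => ?_)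
      h1.hasFiniteIntegral
    rw [← ofReal_measureReal, ← ofReal_norm]
    exact ENNReal.ofReal_le_ofReal
      ((hx₁ u ((le_max_left _ _).trans hu.le)).trans (le_abs_self _))

/-! ## Pathwise bounds for monotone separable networks -/

section Pathwise

variable {K : Type*} {f : (l : ℕ) → (Fin l → ℝ) → (Fin l → K) → ℝ}

theorem lastActivity_congr {T T' : ℤ → ℝ} {ζ : ℤ → K} {m n : ℤ}
    (h : ∀ k, m ≤ k → k ≤ n → T k = T' k) : lastActivity f T ζ m n = lastActivity f T' ζ m n := by
  unfold lastActivity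
  congr 1
  ext i
  have := i.2
  exact h _ (by omega) (by omega)

theorem lastActivity_zero {ζ : ℤ → K} {m n : ℤ} :
    lastActivity f (fun _ => 0) ζ m n = dater f (fun _ => 0) ζ m n := by
  simp [dater]

namespace IsMonotoneSeparable

theorem lastActivity_const (hf : IsMonotoneSeparable f) (ζ : ℤ → K) (c : ℝ) {m n : ℤ}
    (hmn : m ≤ n) :
    lastActivity f (fun _ => c) ζ m n = c + dater f (fun _ => 0) ζ m n := by
  have := hf.homogeneity (fun _ => 0) ζ monotone_const c m n hmn
  simp only [add_zero] at this
  rw [this, lastActivity_zero, add_comm]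

theorem dater_zero_nonneg (hf : IsMonotoneSeparable f) (ζ : ℤ → K) {m n : ℤ} (hmn : m ≤ n) :
    0 ≤ dater f (fun _ => 0) ζ m n :=
  sub_nonneg.2 (hf.causality _ ζ monotone_const m n hmn)

/-- Homogeneity removes the only arrival time involved, so (AA), stated for the actual input, also
describes the single-customer daters under `Q`. -/
theorem dater_self (hf : IsMonotoneSeparable f) (T : ℤ → ℝ) (ζ : ℤ → K) (i : ℤ) :
    dater f T ζ i i = dater f (fun _ => 0) ζ i i := by
  have h : lastActivity f T ζ i i = lastActivity f (fun _ => T i) ζ i i :=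
    lastActivity_congr fun k h1 h2 => by rw [le_antisymm h2 h1]
  rw [dater, h, hf.lastActivity_const ζ _ le_rfl]
  ring

/-- Starting earlier delays the last activity. -/
theorem lastActivity_succ_le (hf : IsMonotoneSeparable f) {T : ℤ → ℝ} (hT : Monotone T)
    (ζ : ℤ → K) {m n : ℤ} (hmn : m < n) :
    lastActivity f T ζ (m + 1) n ≤ lastActivity f T ζ m n := by
  -- `C` is the least advance of the points up to `m` that lets customer `m` finish before `T (m +
  -- 1)`. Separability then forgets it, and undoing the advance can only increase the last activity.
  set C := max 0 (lastActivity f T ζ m m - T (m + 1)) with hC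
  have hC0 : 0 ≤ C := le_max_left _ _
  set T' : ℤ → ℝ := fun k => if k ≤ m then T k - C else T k with hT'
  have hT'm : Monotone T' := by
    intro k l hkl
    have := hT hkl
    simp only [hT']
    split_ifs <;> linarith
  have hle : ∀ k, T' k ≤ T k := fun k => by
    simp only [hT']
    split_ifs <;> linarith
  have h1 : lastActivity f T' ζ m m = lastActivity f T ζ m m - C := by
    have e : lastActivity f T' ζ m m = lastActivity f (fun k => -C + T k) ζ m m :=
      lastActivity_congr fun k _ h => by simp only [hT', if_pos h]; ring
    rw [e, hf.homogeneity T ζ hT (-C) m m le_rfl]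
    ring
  have h2 : lastActivity f T' ζ m m ≤ T' (m + 1) := by
    have e : T' (m + 1) = T (m + 1) := if_neg (by omega)
    rw [h1, e]
    linarith [le_max_right 0 (lastActivity f T ζ m m - T (m + 1))]
  have h3 := hf.separability T' ζ hT'm m m n le_rfl hmn h2
  have h4 : lastActivity f T' ζ (m + 1) n = lastActivity f T ζ (m + 1) n :=
    lastActivity_congr fun k h _ => if_neg (by omega)
  rw [← h4, ← h3]
  exact hf.externalMonotonicity T' T ζ hT'm hT hle m n hmn.le

/-- Splitting the input at `l`: the part after `l` is delayed at most by the overshoot. -/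
theorem lastActivity_le_add_max (hf : IsMonotoneSeparable f) {T : ℤ → ℝ} (hT : Monotone T)
    (ζ : ℤ → K) {m l n : ℤ} (hml : m ≤ l) (hln : l < n) :
    lastActivity f T ζ m n ≤
      lastActivity f T ζ (l + 1) n + max 0 (lastActivity f T ζ m l - T (l + 1)) := by
  -- The dual perturbation: the points after `l` are delayed just enough for separability at `l`,
  -- and homogeneity charges exactly `C` for the delay.
  set C := max 0 (lastActivity f T ζ m l - T (l + 1)) with hC
  have hC0 : 0 ≤ C := le_max_left _ _
  set T' : ℤ → ℝ := fun k => if k ≤ l then T k else C + T k with hT'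
  have hT'm : Monotone T' := by
    intro k l hkl
    have := hT hkl
    simp only [hT']
    split_ifs <;> linarith
  have hle : ∀ k, T k ≤ T' k := fun k => by
    simp only [hT']
    split_ifs <;> linarith
  have h1 : lastActivity f T' ζ m l = lastActivity f T ζ m l :=
    lastActivity_congr fun k _ h => if_pos h
  have h2 : lastActivity f T' ζ m l ≤ T' (l + 1) := by
    have e : T' (l + 1) = C + T (l + 1) := if_neg (by omega)
    rw [h1, e]
    linarith [le_max_right 0 (lastActivity f T ζ m l - T (l + 1))]
  have h3 := hf.separability T' ζ hT'm m l n hml hln h2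
  have h4 : lastActivity f T' ζ (l + 1) n = lastActivity f (fun k => C + T k) ζ (l + 1) n :=
    lastActivity_congr fun k h _ => if_neg (by omega)
  rw [hf.homogeneity T ζ hT C (l + 1) n (by omega)] at h4
  rw [← h4, ← h3]
  exact hf.externalMonotonicity T T' ζ hT hT'm hle m n (by omega)

theorem dater_zero_subadditive (hf : IsMonotoneSeparable f) (ζ : ℤ → K) {m l n : ℤ}
    (hml : m ≤ l) (hln : l < n) :
    dater f (fun _ => 0) ζ m n ≤ dater f (fun _ => 0) ζ m l + dater f (fun _ => 0) ζ (l + 1) n := by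
  have h := hf.lastActivity_le_add_max (T := fun _ => 0) monotone_const ζ hml hln
  have h0 := hf.dater_zero_nonneg ζ hml
  simp only [lastActivity_zero, sub_zero, max_eq_right h0] at h
  linarith

/-- All points of the window are moved back to `T m`; outside it `min (T m) (T k)` keeps the
modified input monotone and below `T`. -/
theorem add_dater_zero_le_lastActivity (hf : IsMonotoneSeparable f) {T : ℤ → ℝ} (hT : Monotone T)
    (ζ : ℤ → K) {m n : ℤ} (hmn : m ≤ n) :
    T m + dater f (fun _ => 0) ζ m n ≤ lastActivity f T ζ m n := by
  rw [← hf.lastActivity_const ζ (T m) hmn]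
  have e : lastActivity f (fun _ => T m) ζ m n = lastActivity f (fun k => min (T m) (T k)) ζ m n :=
    lastActivity_congr fun k h _ => (min_eq_left (hT h)).symm
  rw [e]
  exact hf.externalMonotonicity _ T ζ (fun _ _ h => min_le_min le_rfl (hT h)) hT
    (fun _ => min_le_right _ _) m n hmn

/-- Moving the input after `l` to its last point. -/
theorem lastActivity_le_dater_zero_add_max (hf : IsMonotoneSeparable f) {T : ℤ → ℝ}
    (hT : Monotone T) (ζ : ℤ → K) {m l n : ℤ} (hml : m ≤ l) (hln : l < n) :
    lastActivity f T ζ m n ≤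
      dater f (fun _ => 0) ζ (l + 1) n + max (T n) (lastActivity f T ζ m l) := by
  set T' : ℤ → ℝ := fun k => if k ≤ l then T k else max (T n) (T k) with hT'
  have hT'm : Monotone T' := by
    intro k l hkl
    simp only [hT']
    split_ifs
    · exact hT hkl
    · exact (hT hkl).trans (le_max_right _ _)
    · omega
    · exact max_le_max le_rfl (hT hkl)
  have hle : ∀ k, T k ≤ T' k := fun k => by
    simp only [hT']
    split_ifs
    · exact le_rfl
    · exact le_max_right _ _
  have h1 := hf.externalMonotonicity T T' ζ hT hT'm hle m n (by omega)
  have h2 := hf.lastActivity_le_add_max hT'm ζ hml hln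
  have h3 : lastActivity f T' ζ m l = lastActivity f T ζ m l :=
    lastActivity_congr fun k _ h => if_pos h
  have h4 : lastActivity f T' ζ (l + 1) n = lastActivity f (fun _ => T n) ζ (l + 1) n :=
    lastActivity_congr fun k h h' => by
      simp only [hT', if_neg (show ¬ k ≤ l by omega), max_eq_left (hT h')]
  have h5 : T' (l + 1) = T n := by
    simp only [hT', if_neg (show ¬ l + 1 ≤ l by omega), max_eq_left (hT (show l + 1 ≤ n by omega))]
  rw [h3, h4, h5, hf.lastActivity_const ζ _ (by omega)] at h2
  have h6 : T n + max 0 (lastActivity f T ζ m l - T n) = max (T n) (lastActivity f T ζ m l) := by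
    rw [← max_add_add_left]; simp
  linarith

theorem lastActivity_le_add_dater_zero (hf : IsMonotoneSeparable f) {T : ℤ → ℝ} (hT : Monotone T)
    (ζ : ℤ → K) {m n : ℤ} (hmn : m ≤ n) :
    lastActivity f T ζ m n ≤ T n + dater f (fun _ => 0) ζ m n := by
  rw [← hf.lastActivity_const ζ (T n) hmn]
  have e : lastActivity f (fun _ => T n) ζ m n = lastActivity f (fun k => max (T n) (T k)) ζ m n :=
    lastActivity_congr fun k _ h => (max_eq_left (hT h)).symm
  rw [e]
  exact hf.externalMonotonicity T _ ζ hT (fun _ _ h => max_le_max le_rfl (hT h))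
    (fun _ => le_max_right _ _) m n hmn

theorem monotone_dater_neg (hf : IsMonotoneSeparable f) {T : ℤ → ℝ} (hT : Monotone T)
    (ζ : ℤ → K) : Monotone fun n : ℕ => dater f T ζ (-(n : ℤ)) 0 := by
  refine monotone_nat_of_le_succ fun n => ?_
  have h := hf.lastActivity_succ_le hT ζ (m := -((n + 1 : ℕ) : ℤ)) (n := 0) (by omega)
  rw [show -((n + 1 : ℕ) : ℤ) + 1 = -(n : ℤ) by push_cast; ring] at h
  exact sub_le_sub_right h _

/-- The service time of the `k`-th block of `L` customers, counted backwards from time `0`, and the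
interarrival time between the last customers of consecutive blocks dominate the network. -/
theorem exists_dater_le_block_walk (hf : IsMonotoneSeparable f) {T : ℤ → ℝ} (hT : Monotone T)
    (ζ : ℤ → K) {L : ℕ} (hL : 0 < L) (N : ℕ) :
    ∀ k : ℕ, ∃ n : ℕ,
      dater f T ζ (-((L * (k + N + 1) : ℕ) : ℤ) + 1) (-((L * k : ℕ) : ℤ)) ≤
        dater f (fun _ => 0) ζ (-((L * (k + 1) : ℕ) : ℤ) + 1) (-((L * k : ℕ) : ℤ)) +
        ∑ i ∈ Finset.range n,
          (dater f (fun _ => 0) ζ (-((L * (k + i + 1 + 1) : ℕ) : ℤ) + 1)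
              (-((L * (k + i + 1) : ℕ) : ℤ)) -
            (T (-((L * (k + i) : ℕ) : ℤ)) - T (-((L * (k + i + 1) : ℕ) : ℤ)))) := by
  induction N with
  | zero =>
    intro k
    refine ⟨0, ?_⟩
    rw [Finset.sum_range_zero, add_zero, add_zero, dater]
    have := hf.lastActivity_le_add_dater_zero hT ζ
      (m := -((L * (k + 1) : ℕ) : ℤ) + 1) (n := -((L * k : ℕ) : ℤ)) (by push_cast; nlinarith)
    linarith
  | succ N ih =>
    intro k
    obtain ⟨n, hn⟩ := ih (k + 1)
    have hlt : (L * k : ℤ) < L * (k + 1) := by nlinarith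
    have hle : (L * (k + 1) : ℤ) < L * (k + (N + 1) + 1) := by
      have : (0 : ℤ) < L := by exact_mod_cast hL
      nlinarith [mul_nonneg this.le (Nat.cast_nonneg (α := ℤ) N)]
    -- This is Lindley's recursion for blocks. Either the previous blocks are done by the last
    -- arrival of block `k` and the walk stops, or their overshoot adds one increment and the
    -- induction hypothesis for block `k + 1` applies.
    have hrec := hf.lastActivity_le_dater_zero_add_max hT ζ
      (m := -((L * (k + (N + 1) + 1) : ℕ) : ℤ) + 1) (l := -((L * (k + 1) : ℕ) : ℤ))
      (n := -((L * k : ℕ) : ℤ)) (by push_cast; linarith) (by push_cast; linarith)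
    rw [show k + 1 + N + 1 = k + (N + 1) + 1 by ring] at hn
    rcases le_total (lastActivity f T ζ (-((L * (k + (N + 1) + 1) : ℕ) : ℤ) + 1)
      (-((L * (k + 1) : ℕ) : ℤ))) (T (-((L * k : ℕ) : ℤ))) with h | h
    · refine ⟨0, ?_⟩
      rw [max_eq_left h] at hrec
      rw [Finset.sum_range_zero, add_zero, dater]
      linarith
    · refine ⟨n + 1, ?_⟩
      rw [max_eq_right h] at hrec
      rw [Finset.sum_range_succ', dater]
      rw [dater] at hn
      have e : ∀ i, k + 1 + i = k + (i + 1) := fun i => by ring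
      simp only [e] at hn
      simp only [add_zero]
      linarith

end IsMonotoneSeparable

end Pathwise

/-! ### Pathwise bounds for the stationary dater -/

section Stationary

variable {Ω K : Type*} {f : (l : ℕ) → (Fin l → ℝ) → (Fin l → K) → ℝ}
  {T : ℤ → Ω → ℝ} {ζ : ℤ → Ω → K}

/-- Daters increase as the starting point recedes, so the limit exists and `limUnder` has its
intended value. -/
theorem stationaryDater_eq_iSup (hf : IsMonotoneSeparable f) {ω : Ω}
    (hT : Monotone fun n => T n ω) :
    stationaryDater f T ζ ω =
      ⨆ n : ℕ, ((dater f (fun k => T k ω) (fun k => ζ k ω) (-(n : ℤ)) 0 : ℝ) : EReal) :=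
  (tendsto_atTop_iSup fun _ _ h =>
    EReal.coe_le_coe_iff.2 (hf.monotone_dater_neg hT _ h)).limUnder_eq

theorem sum_interarrival_Icc (T : ℤ → Ω → ℝ) (ω : Ω) (n : ℕ) :
    ∑ i ∈ Finset.Icc (-(n : ℤ)) (-1), interarrival T i ω = T 0 ω - T (-(n : ℤ)) ω := by
  induction n with
  | zero => simp
  | succ n ih =>
    have e : Finset.Icc (-((n + 1 : ℕ) : ℤ)) (-1) =
        insert (-((n + 1 : ℕ) : ℤ)) (Finset.Icc (-(n : ℤ)) (-1)) := by
      ext i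
      simp only [Finset.mem_Icc, Finset.mem_insert]
      omega
    rw [e, Finset.sum_insert (by simp), ih, interarrival,
      show -((n + 1 : ℕ) : ℤ) + 1 = -(n : ℤ) by push_cast; ring]
    ring

theorem lt_stationaryDater_imp_block (hf : IsMonotoneSeparable f) {ω : Ω}
    (hT : Monotone fun n => T n ω) {L : ℕ} (hL : 0 < L) {x : ℝ}
    (hx : (x : EReal) < stationaryDater f T ζ ω) :
    ∃ n : ℕ, x < degenerateDater f ζ (-((L * (0 + 1) : ℕ) : ℤ) + 1) (-((L * 0 : ℕ) : ℤ)) ω +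
        ∑ i ∈ Finset.range n,
          (degenerateDater f ζ (-((L * (i + 1 + 1) : ℕ) : ℤ) + 1) (-((L * (i + 1) : ℕ) : ℤ)) ω -
            (T (-((L * i : ℕ) : ℤ)) ω - T (-((L * (i + 1) : ℕ) : ℤ)) ω)) := by
  rw [stationaryDater_eq_iSup hf hT, lt_iSup_iff] at hx
  obtain ⟨N, hN⟩ := hx
  obtain ⟨n, hn⟩ := hf.exists_dater_le_block_walk hT (fun k => ζ k ω) hL N 0
  refine ⟨n, ?_⟩
  -- The start `-N` is moved back to a block boundary, which can only increase the dater.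
  have h1 : N ≤ L * (0 + N + 1) - 1 := by
    have : 1 * (N + 1) ≤ L * (N + 1) := Nat.mul_le_mul_right _ hL
    rw [zero_add]
    omega
  have h2 := hf.monotone_dater_neg hT (fun k => ζ k ω) h1
  have h3 : -((L * (0 + N + 1) - 1 : ℕ) : ℤ) = -((L * (0 + N + 1) : ℕ) : ℤ) + 1 := by
    have : 1 ≤ L * (0 + N + 1) := Nat.mul_pos hL (by omega)
    push_cast [Nat.cast_sub this]
    ring
  beta_reduce at h2
  rw [h3] at h2
  refine (EReal.coe_lt_coe_iff.1 hN).trans_le (h2.trans ?_)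
  simp only [zero_add, mul_zero, Nat.cast_zero, neg_zero] at hn ⊢
  exact hn

/-- Placing all customers of `[-k,0]` at `T_{-k}` gives `Z ≥ Z_{[-k,0]}(Q) - (T_0 - T_{-k})`, and
the sum of the interarrival times telescopes to this difference. -/
theorem forkJoin_le_stationaryDater {r : ℕ} (hf : IsMonotoneSeparable f) {ω : Ω}
    (hT : Monotone fun n => T n ω) {Y : ℤ → Fin r → Ω → ℝ}
    (hY : ∀ n : ℤ, n ≤ 0 → (⨆ j : Fin r, ∑ i ∈ Finset.Icc n 0, Y i j ω) ≤ degenerateDater f ζ n 0 ω) :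
    forkJoinResponseTime T Y ω ≤ stationaryDater f T ζ ω := by
  refine iSup_le fun j => iSup_le fun ⟨n, hn⟩ => ?_
  rw [stationaryDater_eq_iSup hf hT]
  obtain ⟨k, rfl⟩ : ∃ k : ℕ, n = -(k : ℤ) := ⟨(-n).toNat, by omega⟩
  refine le_trans (EReal.coe_le_coe_iff.2 ?_) (le_iSup (fun k : ℕ =>
    ((dater f (fun k => T k ω) (fun k => ζ k ω) (-(k : ℤ)) 0 : ℝ) : EReal)) k)
  have h1 := hf.add_dater_zero_le_lastActivity hT (fun k => ζ k ω) hn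
  have h2 := (le_ciSup (f := fun j : Fin r => ∑ i ∈ Finset.Icc (-(k : ℤ)) 0, Y i j ω)
    (Set.finite_range _).bddAbove j).trans (hY _ hn)
  simp only [sum_interarrival_Icc, dater, degenerateDater] at *
  linarith

end Stationary

/-! ## Pairing and grouping independent sequences -/

section

variable {Ω ι κ E E' : Type*} [MeasurableSpace Ω] [MeasurableSpace E] [MeasurableSpace E']
  {μ : Measure Ω}

/-- Pairing two mutually independent sequences of independent variables. -/
theorem iIndepFun_prodMk {U : ι → Ω → E} {V : ι → Ω → E'} (hUm : ∀ i, Measurable (U i))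
    (hVm : ∀ i, Measurable (V i)) (hU : iIndepFun U μ) (hV : iIndepFun V μ)
    (hUV : IndepFun (fun ω i => U i ω) (fun ω i => V i ω) μ) :
    iIndepFun (fun i ω => (U i ω, V i ω)) μ := by
  have := hU.isProbabilityMeasure
  -- Intersections `U⁻¹ s ∩ V⁻¹ t` form a π-system generating the σ-algebra of each pair, and on it
  -- independence is a product computation.
  set π : ι → Set (Set Ω) := fun i =>
    {A | ∃ s t, MeasurableSet s ∧ MeasurableSet t ∧ A = U i ⁻¹' s ∩ V i ⁻¹' t} with hπ
  have hUV' : ∀ i, IndepFun (U i) (V i) μ := fun i =>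
    hUV.comp (measurable_pi_apply i) (measurable_pi_apply i)
  refine iIndepSets.iIndep (m := fun i => MeasurableSpace.comap (fun ω => (U i ω, V i ω)) inferInstance)
    (fun i => (Measurable.prodMk (hUm i) (hVm i)).comap_le) π ?_ ?_ ?_
  · rintro i _ ⟨s, t, hs, ht, rfl⟩ _ ⟨s', t', hs', ht', rfl⟩ _
    refine ⟨s ∩ s', t ∩ t', hs.inter hs', ht.inter ht', ?_⟩
    ext ω
    simp only [Set.mem_inter_iff, Set.mem_preimage]
    tauto
  · intro i
    rw [← generateFrom_prod, MeasurableSpace.comap_generateFrom]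
    congr 1
    ext A
    constructor
    · rintro ⟨_, ⟨s, hs, t, ht, rfl⟩, rfl⟩
      exact ⟨s, t, hs, ht, rfl⟩
    · rintro ⟨s, t, hs, ht, rfl⟩
      exact ⟨s ×ˢ t, ⟨s, hs, t, ht, rfl⟩, rfl⟩
  · rw [iIndepSets_iff]
    intro S A hA
    classical
    choose! s t hs ht hst using hA
    have e1 : ⋂ i ∈ S, A i = (fun ω i => U i ω) ⁻¹' (⋂ i ∈ S, (fun x => x i) ⁻¹' s i) ∩
        (fun ω i => V i ω) ⁻¹' (⋂ i ∈ S, (fun x => x i) ⁻¹' t i) := by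
      ext ω
      simp only [Set.mem_iInter, Set.mem_inter_iff, Set.mem_preimage]
      constructor
      · intro h
        refine ⟨fun i hi => ?_, fun i hi => ?_⟩
        · have := h i hi
          rw [hst i hi] at this
          exact this.1
        · have := h i hi
          rw [hst i hi] at this
          exact this.2
      · rintro ⟨h1, h2⟩ i hi
        rw [hst i hi]
        exact ⟨h1 i hi, h2 i hi⟩
    have hms : MeasurableSet (⋂ i ∈ S, (fun x : ι → E => x i) ⁻¹' s i) :=
      S.measurableSet_biInter fun i hi => (measurable_pi_apply i) (hs i hi)
    have hmt : MeasurableSet (⋂ i ∈ S, (fun x : ι → E' => x i) ⁻¹' t i) :=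
      S.measurableSet_biInter fun i hi => (measurable_pi_apply i) (ht i hi)
    rw [e1, hUV.measure_inter_preimage_eq_mul _ _ hms hmt]
    have e2 : (fun ω i => U i ω) ⁻¹' (⋂ i ∈ S, (fun x => x i) ⁻¹' s i) = ⋂ i ∈ S, U i ⁻¹' s i := by
      ext ω; simp
    have e3 : (fun ω i => V i ω) ⁻¹' (⋂ i ∈ S, (fun x => x i) ⁻¹' t i) = ⋂ i ∈ S, V i ⁻¹' t i := by
      ext ω; simp
    rw [e2, e3, hU.measure_inter_preimage_eq_mul S hs, hV.measure_inter_preimage_eq_mul S ht,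
      ← Finset.prod_mul_distrib]
    refine Finset.prod_congr rfl fun i hi => ?_
    rw [hst i hi, (hUV' i).measure_inter_preimage_eq_mul _ _ (hs i hi) (ht i hi)]

/-- Grouping independent variables. -/
theorem iIndepFun.curry {X : ι × κ → Ω → E} (hX : ∀ p, Measurable (X p)) (h : iIndepFun X μ) :
    iIndepFun (fun i ω j => X (i, j) ω) μ := by
  have := h.isProbabilityMeasure
  have : ∀ i j, IsProbabilityMeasure (μ.map (X (i, j))) := fun i j =>
    Measure.isProbabilityMeasure_map (hX _).aemeasurable
  have hm : ∀ i, Measurable fun ω j => X (i, j) ω := fun i => measurable_pi_lambda _ fun j => hX _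
  rw [iIndepFun_iff_map_fun_eq_infinitePi_map hm]
  have e : (fun ω i j => X (i, j) ω) = MeasurableEquiv.curry ι κ E ∘ fun ω p => X p ω := rfl
  rw [e, ← Measure.map_map (MeasurableEquiv.measurable _) (measurable_pi_lambda _ hX),
    h.map_fun_eq_infinitePi_map hX]
  have e2 : ∀ i, μ.map (fun ω j => X (i, j) ω) =
      Measure.infinitePi fun j => μ.map (X (i, j)) := fun i =>
    iIndepFun.map_fun_eq_infinitePi_map (fun j => hX (i, j))
      (h.precomp (g := fun j => (i, j)) (Prod.mk_right_injective i))
  simp only [e2]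
  exact Measure.infinitePi_map_curry fun i j => μ.map (X (i, j))

theorem IsIID.prodMk {U : ℕ → Ω → E} {V : ℕ → Ω → E'} (hU : IsIID U μ) (hV : IsIID V μ)
    (hUV : IndepFun (fun ω k => U k ω) (fun ω k => V k ω) μ) :
    IsIID (fun k ω => (U k ω, V k ω)) μ := by
  have := hU.indep.isProbabilityMeasure
  have hpair : ∀ k, IndepFun (U k) (V k) μ := fun k =>
    hUV.comp (measurable_pi_apply k) (measurable_pi_apply k)
  exact ⟨fun k => (hU.meas k).prodMk (hV.meas k),
    iIndepFun_prodMk hU.meas hV.meas hU.indep hV.indep hUV,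
    fun k => IdentDistrib.prodMk (hU.ident k) (hV.ident k) (hpair k) (hpair 0)⟩

theorem isIID_of_injective {X : ι → Ω → E} (hX : ∀ i, Measurable (X i)) (h : iIndepFun X μ)
    (i₀ : ι) (hid : ∀ i, IdentDistrib (X i) (X i₀) μ μ) {e : ℕ → ι} (he : e.Injective) :
    IsIID (fun k => X (e k)) μ :=
  ⟨fun _ => hX _, h.precomp he, fun _ => (hid _).trans (hid _).symm⟩

theorem isIID_block {X : ι → Ω → E} (hX : ∀ i, Measurable (X i)) (h : iIndepFun X μ)
    (i₀ : ι) (hid : ∀ i, IdentDistrib (X i) (X i₀) μ μ) {L : ℕ} {e : ℕ × Fin L → ι}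
    (he : e.Injective) :
    IsIID (fun k ω j => X (e (k, j)) ω) μ := by
  refine ⟨fun k => measurable_pi_lambda _ fun j => hX _,
    iIndepFun.curry (fun p => hX (e p)) (h.precomp he), fun k => ?_⟩
  exact IdentDistrib.pi (fun j => (hid _).trans (hid _).symm)
    (h.precomp (he.comp (Prod.mk_right_injective k)))
    (h.precomp (he.comp (Prod.mk_right_injective 0)))

/-- Bonferroni's inequality for a finite family. -/
theorem sum_measureReal_sub_le_biUnion [IsFiniteMeasure μ] [DecidableEq ι] {A : ι → Set Ω}
    (hA : ∀ i, MeasurableSet (A i)) (s : Finset ι) :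
    ∑ i ∈ s, μ.real (A i) - ∑ i ∈ s, ∑ j ∈ s with j ≠ i, μ.real (A i ∩ A j) ≤
      μ.real (⋃ i ∈ s, A i) := by
  induction s using Finset.induction_on with
  | empty => simp
  | insert a s ha ih =>
    -- The double sum counts each pair in both orders; one of the two is simply discarded here.
    have e1 : ∑ j ∈ s, μ.real (A a ∩ A j) + ∑ i ∈ s, ∑ j ∈ s with j ≠ i, μ.real (A i ∩ A j) ≤
        ∑ i ∈ insert a s, ∑ j ∈ insert a s with j ≠ i, μ.real (A i ∩ A j) := by
      rw [Finset.sum_insert ha]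
      refine add_le_add ?_ (Finset.sum_le_sum fun i _ => ?_)
      · refine Finset.sum_le_sum_of_subset_of_nonneg ?_ fun _ _ _ => measureReal_nonneg
        intro j hj
        exact Finset.mem_filter.2 ⟨Finset.mem_insert_of_mem hj, fun h => ha (h ▸ hj)⟩
      · refine Finset.sum_le_sum_of_subset_of_nonneg ?_ fun _ _ _ => measureReal_nonneg
        exact Finset.filter_subset_filter _ (Finset.subset_insert a s)
    rw [Finset.sum_insert ha, Finset.set_biUnion_insert]
    have h1 := measureReal_union_add_inter (μ := μ) (s := A a) (t := ⋃ i ∈ s, A i)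
      (s.measurableSet_biUnion fun i _ => hA i) (measure_ne_top _ _)
      (measure_ne_top _ _)
    have h2 : μ.real (A a ∩ ⋃ i ∈ s, A i) ≤ ∑ j ∈ s, μ.real (A a ∩ A j) := by
      rw [Set.inter_iUnion₂]
      exact measureReal_biUnion_finset_le s _
    linarith

end

section

variable {Ω : Type*} [MeasurableSpace Ω] {μ : Measure Ω} [IsProbabilityMeasure μ]

/-! ## Upper bounds -/

/-- The stationary response time of a single server queue with independent service and interarrival
times, when the service time has tail at most `c h`. -/
theorem IsIID.response_tail_le {h : ℝ → ℝ} {ν : Measure ℝ} (hh : IsIntegratedTail h ν)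
    {P : ℕ → Ω → ℝ × ℝ} (hP : IsIID P μ) (h1 : Integrable (fun ω => (P 0 ω).1) μ)
    (h2 : Integrable (fun ω => (P 0 ω).2) μ) (h0 : ∀ᵐ ω ∂μ, 0 ≤ (P 0 ω).2) {m c : ℝ} (hm : 0 < m)
    (hmean : ∫ ω, (P 0 ω).1 ∂μ - ∫ ω, (P 0 ω).2 ∂μ = -m) (hc : 0 ≤ c)
    (htail : ∀ δ > 0, ∀ᶠ x in atTop, μ.real {ω | x < (P 0 ω).1} ≤ (c + δ) * h x)
    {ε : ℝ} (hε : 0 < ε) :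
    ∀ᶠ x in atTop, μ.real {ω | ∃ n : ℕ, x < (P 0 ω).1 +
      ∑ i ∈ Finset.range n, ((P (i + 1) ω).1 - (P (i + 1) ω).2)} ≤
      (c / m + ε) * ν.real (Set.Ioi x) := by
  have hX : IsIID (fun k ω => (P (1 + k) ω).1 - (P (1 + k) ω).2) μ :=
    (hP.shift 1).comp (g := fun p => p.1 - p.2) (by fun_prop)
  have hid : IdentDistrib (fun ω => (P (1 + 0) ω).1 - (P (1 + 0) ω).2)
      (fun ω => (P 0 ω).1 - (P 0 ω).2) μ μ :=
    (hP.ident (1 + 0)).comp (u := fun p : ℝ × ℝ => p.1 - p.2) (by fun_prop)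
  have hX0 : SumTailLE (fun x => μ.real {ω | x < (P (1 + 0) ω).1 - (P (1 + 0) ω).2}) ν c := by
    refine hh.sumTailLE hc fun δ hδ => ?_
    filter_upwards [htail δ hδ] with x hx
    refine le_trans ?_ hx
    have e := hid.measure_mem_eq (measurableSet_Ioi (a := x))
    have e' : μ.real {ω | x < (P (1 + 0) ω).1 - (P (1 + 0) ω).2} =
        μ.real {ω | x < (P 0 ω).1 - (P 0 ω).2} := congrArg ENNReal.toReal e
    rw [e']
    refine ENNReal.toReal_mono (measure_ne_top _ _) (measure_mono_ae ?_)
    filter_upwards [h0] with ω hω (hx : x < (P 0 ω).1 - (P 0 ω).2)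
    exact show x < (P 0 ω).1 by linarith
  -- The service of customer `0` is the independent initial value: its tail is `O(h)`, hence
  -- negligible against the integrated tail, and the walk starts at index `1`.
  have hind : IndepFun (fun ω => (P 0 ω).1)
      (fun ω k => (P (1 + k) ω).1 - (P (1 + k) ω).2) μ :=
    (hP.indepFun_past_future 1).comp (φ := fun y : Fin 1 → ℝ × ℝ => (y 0).1)
      (ψ := fun (y : ℕ → ℝ × ℝ) k => (y k).1 - (y k).2)
      (by fun_prop) (by fun_prop)
  have hmean' : ∫ ω, (P (1 + 0) ω).1 - (P (1 + 0) ω).2 ∂μ = -m := by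
    rw [hid.integral_eq, integral_sub h1 h2, hmean]
  filter_upwards [add_walk_tail_le hh.subexp hX (hid.symm.integrable_snd (h1.sub h2)) hmean' hm hc
    hX0 (measurable_fst.comp (hP.meas 0)) hind
    (fun ε hε => hh.eventually_le_of_le (htail 1 one_pos) hε) hε] with x hx
  simpa only [add_comm 1, Function.comp_apply] using hx

/-- Finite sums of independent variables with tails of the order of a subexponential tail. -/
theorem IsIID.sum_tail_le {ν : Measure ℝ} (hν : SubexpLaw ν) {A : ℕ → Ω → ℝ} (hA : IsIID A μ)
    {C : ℝ} (hC : 0 ≤ C)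
    (htail : ∀ᶠ x in atTop, μ.real {ω | x < A 0 ω} ≤ C * ν.real (Set.Ioi x)) (L : ℕ) :
    ∃ C' : ℝ, 0 ≤ C' ∧ ∀ᶠ x in atTop,
      μ.real {ω | x < ∑ i ∈ Finset.range L, A i ω} ≤ C' * ν.real (Set.Ioi x) := by
  have := hν.prob
  induction L with
  | zero =>
    refine ⟨0, le_rfl, ?_⟩
    filter_upwards [eventually_ge_atTop 0] with x hx
    have : {ω | x < ∑ i ∈ Finset.range 0, A i ω} = ∅ := by
      ext ω; simp [hx]
    rw [this, measureReal_empty, zero_mul]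
  | succ L ih =>
    obtain ⟨C', hC', hS⟩ := ih
    have hSm : Measurable fun ω => ∑ i ∈ Finset.range L, A i ω :=
      Finset.measurable_fun_sum _ fun i _ => hA.meas i
    have hSpr := Measure.isProbabilityMeasure_map hSm.aemeasurable (μ := μ)
    have hApr := Measure.isProbabilityMeasure_map (hA.meas L).aemeasurable (μ := μ)
    have hG : ∀ᶠ x in atTop, (μ.map fun ω => ∑ i ∈ Finset.range L, A i ω).real (Set.Ioi x) ≤
        C' * ν.real (Set.Ioi x) := by
      filter_upwards [hS] with x hx
      rwa [map_measureReal_apply hSm measurableSet_Ioi]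
    obtain ⟨A₀, hA₀⟩ := hν.conv_tail_le _ hC' hG one_pos
    obtain ⟨A₁, hA₁⟩ := eventually_atTop.1 htail
    refine ⟨C' + 1 + C * (1 + 1), by positivity, ?_⟩
    filter_upwards [hA₀ (max A₀ A₁) (le_max_left _ _)] with x hx
    have h1 := hx C (μ.map (A L)) hC hApr fun y hy => by
      rw [(hA.ident L).map_eq, map_measureReal_apply (hA.meas 0) measurableSet_Ioi]
      exact hA₁ y ((le_max_right _ _).trans hy)
    rw [probReal_univ] at h1
    have hind : IndepFun (fun ω => ∑ i ∈ Finset.range L, A i ω) (A L) μ := by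
      have := hA.indep.indepFun_finsetSum_of_notMem hA.meas (s := Finset.range L) (i := L) (by simp)
      simpa [Finset.sum_fn] using this
    have hm2 : MeasurableSet {p : ℝ × ℝ | x < p.1 + p.2} := by measurability
    have e : {ω | x < ∑ i ∈ Finset.range (L + 1), A i ω} =
        (fun ω => (∑ i ∈ Finset.range L, A i ω, A L ω)) ⁻¹' {p : ℝ × ℝ | x < p.1 + p.2} := by
      ext ω
      simp [Finset.sum_range_succ]
    rw [e, ← map_measureReal_apply (hSm.prodMk (hA.meas L)) hm2,
      hind.map_prod_eq_prod_map_map hSm.aemeasurable (hA.meas L).aemeasurable]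
    exact h1

end

/-! ## Lower bound for parallel queues -/

section

variable {Ω : Type*} {r : ℕ}

/-- The past drift of the queue `j` stays above a line, the `n`-th service time is large: an event
that forces a large response time. -/
def bigJump (P : ℕ → Ω → (Fin r → ℝ) × ℝ) (y α : ℝ) (x : ℝ) (n : ℕ) (j : Fin r) : Set Ω :=
  {ω | x + y + n * α < (P n ω).1 j ∧
    ∑ i ∈ Finset.range n, (-((P i ω).1 j - (P i ω).2) - α) ≤ y}

theorem lt_of_mem_bigJump {P : ℕ → Ω → (Fin r → ℝ) × ℝ} {y α x : ℝ} {n : ℕ} {j : Fin r} {ω : Ω}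
    (h : ω ∈ bigJump P y α x n j) :
    x < (P n ω).1 j + ∑ i ∈ Finset.range n, ((P i ω).1 j - (P i ω).2) := by
  obtain ⟨h1, h2⟩ := h
  rw [Finset.sum_sub_distrib, Finset.sum_neg_distrib, Finset.sum_const, Finset.card_range,
    nsmul_eq_mul] at h2
  linarith

variable [MeasurableSpace Ω] {μ : Measure Ω}

theorem IsIID.measurableSet_bigJump {P : ℕ → Ω → (Fin r → ℝ) × ℝ} (hP : IsIID P μ) (y α x : ℝ)
    (n : ℕ) (j : Fin r) : MeasurableSet (bigJump P y α x n j) := by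
  have h1 : ∀ i, Measurable fun ω => (P i ω).1 j := fun i =>
    (measurable_pi_apply j).comp (measurable_fst.comp (hP.meas i))
  have h2 : ∀ i, Measurable fun ω => (P i ω).2 := fun i => measurable_snd.comp (hP.meas i)
  exact (measurableSet_lt measurable_const (h1 n)).inter (measurableSet_le
    (Finset.measurable_fun_sum _ fun i _ => ((h1 i).sub (h2 i)).neg.sub_const _) measurable_const)

variable [IsProbabilityMeasure μ]

/-- The `n`-th service is independent of the first `n` increments, so the probability factorizes,
and the walk condition fails with probability at most `η` whatever `n` is. -/
theorem IsIID.le_measureReal_bigJump {P : ℕ → Ω → (Fin r → ℝ) × ℝ} (hP : IsIID P μ) {y α η : ℝ}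
    {j : Fin r}
    (hy : μ.real {ω | ∃ n : ℕ, y < ∑ i ∈ Finset.range n, (-((P i ω).1 j - (P i ω).2) - α)} ≤ η)
    (x : ℝ) (n : ℕ) :
    (1 - η) * μ.real {ω | x + y + n * α < (P 0 ω).1 j} ≤ μ.real (bigJump P y α x n j) := by
  have hm : ∀ i, Measurable fun ω => -((P i ω).1 j - (P i ω).2) - α := fun i =>
    (((measurable_pi_apply j).comp (measurable_fst.comp (hP.meas i))).sub
      (measurable_snd.comp (hP.meas i))).neg.sub_const _
  have hSm : Measurable fun ω => ∑ i ∈ Finset.range n, (-((P i ω).1 j - (P i ω).2) - α) :=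
    Finset.measurable_fun_sum _ fun i _ => hm i
  have hind : IndepFun (fun ω => (P n ω).1 j)
      (fun ω => ∑ i ∈ Finset.range n, (-((P i ω).1 j - (P i ω).2) - α)) μ := by
    have h := (hP.indepFun_past_future n).comp
      (φ := fun z : Fin n → (Fin r → ℝ) × ℝ => ∑ i, (-((z i).1 j - (z i).2) - α))
      (ψ := fun z : ℕ → (Fin r → ℝ) × ℝ => (z 0).1 j) (by fun_prop) (by fun_prop)
    refine (h.symm).congr (Eventually.of_forall fun ω => ?_) (Eventually.of_forall fun ω => ?_)
    · simp
    · simp [Finset.sum_range]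
  have h1 := hind.measure_inter_preimage_eq_mul _ _
    (measurableSet_Ioi (a := x + y + n * α)) (measurableSet_Iic (a := y))
  have h2 : μ.real (bigJump P y α x n j) = μ.real {ω | x + y + n * α < (P n ω).1 j} *
      μ.real {ω | ∑ i ∈ Finset.range n, (-((P i ω).1 j - (P i ω).2) - α) ≤ y} := by
    have := congrArg ENNReal.toReal h1
    rw [ENNReal.toReal_mul] at this
    exact this
  have h3 : μ.real {ω | x + y + n * α < (P n ω).1 j} =
      μ.real {ω | x + y + n * α < (P 0 ω).1 j} :=
    congrArg ENNReal.toReal (((hP.ident n).comp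
      (u := fun p : (Fin r → ℝ) × ℝ => p.1 j) (by fun_prop)).measure_mem_eq
      (measurableSet_Ioi (a := x + y + n * α)))
  have h4 : 1 - η ≤
      μ.real {ω | ∑ i ∈ Finset.range n, (-((P i ω).1 j - (P i ω).2) - α) ≤ y} := by
    have e : {ω | ∑ i ∈ Finset.range n, (-((P i ω).1 j - (P i ω).2) - α) ≤ y} =
        {ω | y < ∑ i ∈ Finset.range n, (-((P i ω).1 j - (P i ω).2) - α)}ᶜ := by
      ext ω; simp
    rw [e, probReal_compl_eq_one_sub (measurableSet_lt measurable_const hSm)]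
    have : μ.real {ω | y < ∑ i ∈ Finset.range n, (-((P i ω).1 j - (P i ω).2) - α)} ≤ η :=
      (measureReal_mono (Set.ofPred_subset_ofPred.2 fun ω hω => ⟨n, hω⟩)).trans hy
    linarith
  rw [h2, h3, mul_comm]
  exact mul_le_mul_of_nonneg_left h4 measureReal_nonneg

/-- Lower bound for the union of the big jump events over the first `N` indices. -/
theorem IsIID.sum_sub_le_measureReal_iUnion_bigJump {P : ℕ → Ω → (Fin r → ℝ) × ℝ}
    (hP : IsIID P μ) {y α : Fin r → ℝ} {η α₀ : ℝ} (hy0 : ∀ j, 0 ≤ y j)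
    (hα : ∀ j, α₀ ≤ α j)
    (hy : ∀ j, μ.real {ω | ∃ n : ℕ, y j <
      ∑ i ∈ Finset.range n, (-((P i ω).1 j - (P i ω).2) - α j)} ≤ η) (x : ℝ) (N : ℕ) :
    (1 - η) * ∑ j, ∑ n ∈ Finset.range N, μ.real {ω | x + y j + n * α j < (P 0 ω).1 j} -
      ∑ n ∈ Finset.range N, ∑ j : Fin r, ∑ k : Fin r with k ≠ j,
        μ.real {ω | x + n * α₀ < (P 0 ω).1 j ∧ x + n * α₀ < (P 0 ω).1 k} -
      (∑ j, ∑ n ∈ Finset.range N, μ.real {ω | x + n * α₀ < (P 0 ω).1 j}) ^ 2 ≤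
    μ.real {ω | ∃ j, ∃ n : ℕ, x < (P n ω).1 j +
      ∑ i ∈ Finset.range n, ((P i ω).1 j - (P i ω).2)} := by
  set B : ℕ → Fin r → Set Ω := fun n j => bigJump P (y j) (α j) x n j with hB
  have hBm : ∀ n j, MeasurableSet (B n j) := fun n j => hP.measurableSet_bigJump _ _ _ _ _
  set E : ℕ → Set Ω := fun n => ⋃ j ∈ (Finset.univ : Finset (Fin r)), B n j with hE
  have hEm : ∀ n, MeasurableSet (E n) := fun n => Finset.univ.measurableSet_biUnion fun j _ => hBm n j
  have hBsub : ∀ n j, B n j ⊆ {ω | x + n * α₀ < (P n ω).1 j} := by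
    rintro n j ω ⟨h1, -⟩
    have : n * α₀ ≤ n * α j := mul_le_mul_of_nonneg_left (hα j) (Nat.cast_nonneg n)
    have := hy0 j
    change x + n * α₀ < (P n ω).1 j
    linarith
  have hpair : ∀ n (j k : Fin r), μ.real (B n j ∩ B n k) ≤
      μ.real {ω | x + n * α₀ < (P 0 ω).1 j ∧ x + n * α₀ < (P 0 ω).1 k} := by
    intro n j k
    refine (measureReal_mono (Set.inter_subset_inter (hBsub n j) (hBsub n k))).trans (le_of_eq ?_)
    have hm : MeasurableSet {p : (Fin r → ℝ) × ℝ | x + n * α₀ < p.1 j ∧ x + n * α₀ < p.1 k} :=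
      (measurableSet_lt (f := fun _ => x + n * α₀) (g := fun p : (Fin r → ℝ) × ℝ => p.1 j)
        measurable_const (by fun_prop)).inter
        (measurableSet_lt (f := fun _ => x + n * α₀) (g := fun p : (Fin r → ℝ) × ℝ => p.1 k)
          measurable_const (by fun_prop))
    exact congrArg ENNReal.toReal ((hP.ident n).measure_mem_eq hm)
  have hElow : ∀ n : ℕ, (1 - η) * ∑ j, μ.real {ω | x + y j + n * α j < (P 0 ω).1 j} -
      ∑ j : Fin r, ∑ k : Fin r with k ≠ j,
        μ.real {ω | x + n * α₀ < (P 0 ω).1 j ∧ x + n * α₀ < (P 0 ω).1 k} ≤ μ.real (E n) := by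
    intro n
    refine le_trans (sub_le_sub ?_ ?_) (sum_measureReal_sub_le_biUnion (hBm n) Finset.univ)
    · rw [Finset.mul_sum]
      exact Finset.sum_le_sum fun j _ => hP.le_measureReal_bigJump (hy j) x n
    · exact Finset.sum_le_sum fun j _ => Finset.sum_le_sum fun k _ => hpair n j k
  -- Big-jump events at different `n` share their past and are dependent. The larger `D n` looks
  -- only at the `n`-th service vector, so pairs of them factorize.
  set D : ℕ → Set Ω := fun n => {ω | ∃ j, x + n * α₀ < (P n ω).1 j} with hD
  have hEsub : ∀ n, E n ⊆ D n := by
    intro n ω hω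
    obtain ⟨j, _, hj⟩ := Set.mem_iUnion₂.1 hω
    exact ⟨j, hBsub n j hj⟩
  set q : ℕ → ℝ := fun n => ∑ j, μ.real {ω | x + n * α₀ < (P 0 ω).1 j} with hq
  have hq0 : ∀ n, 0 ≤ q n := fun n => Finset.sum_nonneg fun _ _ => measureReal_nonneg
  have hset : ∀ z : ℝ, MeasurableSet {p : (Fin r → ℝ) × ℝ | ∃ j, z < p.1 j} := by
    intro z
    have : {p : (Fin r → ℝ) × ℝ | ∃ j, z < p.1 j} = ⋃ j, {p | z < p.1 j} := by ext; simp
    rw [this]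
    exact MeasurableSet.iUnion fun j => measurableSet_lt measurable_const (by fun_prop)
  have hDle : ∀ n, μ.real (D n) ≤ q n := by
    intro n
    have e : D n = ⋃ j, {ω | x + n * α₀ < (P n ω).1 j} := by ext; simp [hD]
    rw [e]
    refine (measureReal_iUnion_fintype_le _).trans (le_of_eq (Finset.sum_congr rfl fun j _ => ?_))
    exact congrArg ENNReal.toReal (((hP.ident n).comp
      (u := fun p : (Fin r → ℝ) × ℝ => p.1 j) (by fun_prop)).measure_mem_eq
      (measurableSet_Ioi (a := x + n * α₀)))
  have hEpair : ∀ n k, k ≠ n → μ.real (E n ∩ E k) ≤ q n * q k := by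
    intro n k hnk
    refine (measureReal_mono (Set.inter_subset_inter (hEsub n) (hEsub k))).trans ?_
    have h1 := (hP.indep.indepFun hnk.symm).measure_inter_preimage_eq_mul _ _
      (hset (x + n * α₀)) (hset (x + k * α₀))
    have h2 := congrArg ENNReal.toReal h1
    rw [ENNReal.toReal_mul] at h2
    have h3 : μ.real (D n ∩ D k) = μ.real (D n) * μ.real (D k) := h2
    rw [h3]
    exact mul_le_mul (hDle n) (hDle k) measureReal_nonneg (hq0 n)
  have hmain := sum_measureReal_sub_le_biUnion (μ := μ) hEm (Finset.range N)
  have hsub : (⋃ n ∈ Finset.range N, E n) ⊆ {ω | ∃ j, ∃ n : ℕ, x < (P n ω).1 j +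
      ∑ i ∈ Finset.range n, ((P i ω).1 j - (P i ω).2)} := by
    intro ω hω
    obtain ⟨n, _, hn⟩ := Set.mem_iUnion₂.1 hω
    obtain ⟨j, _, hj⟩ := Set.mem_iUnion₂.1 hn
    exact ⟨j, n, lt_of_mem_bigJump hj⟩
  refine le_trans ?_ (hmain.trans (measureReal_mono hsub))
  have hS1 : ∑ n ∈ Finset.range N, ((1 - η) * ∑ j, μ.real {ω | x + y j + n * α j < (P 0 ω).1 j} -
      ∑ j : Fin r, ∑ k : Fin r with k ≠ j,
        μ.real {ω | x + n * α₀ < (P 0 ω).1 j ∧ x + n * α₀ < (P 0 ω).1 k}) ≤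
      ∑ n ∈ Finset.range N, μ.real (E n) := Finset.sum_le_sum fun n _ => hElow n
  rw [Finset.sum_sub_distrib, ← Finset.mul_sum, Finset.sum_comm] at hS1
  have hS2 : ∑ n ∈ Finset.range N, ∑ k ∈ Finset.range N with k ≠ n, μ.real (E n ∩ E k) ≤
      (∑ n ∈ Finset.range N, q n) ^ 2 := by
    rw [sq, Finset.sum_mul_sum]
    refine Finset.sum_le_sum fun n _ => ?_
    refine (Finset.sum_le_sum fun k hk => hEpair n k (Finset.mem_filter.1 hk).2).trans ?_
    exact Finset.sum_le_sum_of_subset_of_nonneg (Finset.filter_subset _ _)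
      fun k _ _ => mul_nonneg (hq0 n) (hq0 k)
  have hS3 : ∑ j, ∑ n ∈ Finset.range N, μ.real {ω | x + n * α₀ < (P 0 ω).1 j} =
      ∑ n ∈ Finset.range N, q n := Finset.sum_comm
  rw [hS3]
  linarith

/-- Lower bound for the maximum of the response times of parallel queues. -/
theorem IsIID.le_response_tail {h : ℝ → ℝ} {ν : Measure ℝ} (hh : IsIntegratedTail h ν)
    {P : ℕ → Ω → (Fin r → ℝ) × ℝ} (hP : IsIID P μ)
    (h1 : ∀ j, Integrable (fun ω => (P 0 ω).1 j) μ)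
    (h2 : Integrable (fun ω => (P 0 ω).2) μ) {a : ℝ} {b d : Fin r → ℝ}
    (ha : ∫ ω, (P 0 ω).2 ∂μ = a) (hb : ∀ j, ∫ ω, (P 0 ω).1 j ∂μ = b j) (hab : ∀ j, b j < a)
    (htail : ∀ j, TailEquiv (fun x => μ.real {ω | x < (P 0 ω).1 j}) (d j) h)
    (hpair : ∀ δ > 0, ∀ᶠ x in atTop, ∑ j : Fin r, ∑ k : Fin r with k ≠ j,
      μ.real {ω | x < (P 0 ω).1 j ∧ x < (P 0 ω).1 k} ≤ δ * h x)
    {ε : ℝ} (hε : 0 < ε) :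
    ∀ᶠ x in atTop, (∑ j, d j / (a - b j) - ε) * ν.real (Set.Ioi x) ≤
      μ.real {ω | ∃ j, ∃ n : ℕ, x < (P n ω).1 j +
        ∑ i ∈ Finset.range n, ((P i ω).1 j - (P i ω).2)} := by
  have := hh.subexp.prob
  have hd : ∀ j, 0 ≤ d j := fun j => (htail j).nonneg hh.pos fun _ => measureReal_nonneg
  set S := ∑ j, d j / (a - b j) with hS
  have hS0 : 0 ≤ S := Finset.sum_nonneg fun j _ => div_nonneg (hd j) (sub_pos.2 (hab j)).le
  -- The slope must exceed `a - b j` strictly for the compensated walk to drift down; the sum is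
  -- continuous in the slope, so the loss is at most `ε/8`.
  obtain ⟨ε', hε'0, hε'⟩ : ∃ ε' : ℝ, 0 < ε' ∧ S - ε / 8 ≤ ∑ j, d j / (a - b j + ε') := by
    have hcont : Tendsto (fun e : ℝ => ∑ j, d j / (a - b j + e)) (𝓝[>] 0) (𝓝 S) := by
      have h3 : ∀ j, Tendsto (fun e : ℝ => d j / (a - b j + e)) (𝓝[>] 0) (𝓝 (d j / (a - b j))) := by
        intro j
        have h4 : ContinuousAt (fun e : ℝ => d j / (a - b j + e)) 0 :=
          continuousAt_const.div (by fun_prop) (by linarith [hab j])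
        have h5 := h4.tendsto
        rw [add_zero] at h5
        exact h5.mono_left nhdsWithin_le_nhds
      exact tendsto_finsetSum _ fun j _ => h3 j
    obtain ⟨e, h3, h4⟩ := ((hcont.eventually (eventually_ge_nhds
      (show S - ε / 8 < S by linarith))).and self_mem_nhdsWithin).exists
    exact ⟨e, h4, h3⟩
  set α : Fin r → ℝ := fun j => a - b j + ε' with hα
  have hα0 : ∀ j, 0 < α j := fun j => by have := hab j; simp only [hα]; linarith
  have hαmin : ∀ j, ε' ≤ α j := fun j => by have := hab j; simp only [hα]; linarith
  set η := min 1 (ε / (8 * (S + 1))) with hη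
  have hη0 : 0 < η := by positivity
  have hηS : η * S ≤ ε / 8 := by
    have : η * (8 * (S + 1)) ≤ ε := (le_div_iff₀ (by positivity)).1 (min_le_right _ _)
    nlinarith
  have hex : ∀ j, ∃ y : ℝ, 0 ≤ y ∧ μ.real {ω | ∃ n : ℕ, y <
      ∑ i ∈ Finset.range n, (-((P i ω).1 j - (P i ω).2) - α j)} ≤ η := by
    intro j
    have hX : IsIID (fun n ω => -((P n ω).1 j - (P n ω).2) - α j) μ :=
      hP.comp (g := fun p : (Fin r → ℝ) × ℝ => -(p.1 j - p.2) - α j) (by fun_prop)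
    refine hX.exists_bound ((((h1 j).sub h2).neg).sub (integrable_const _)) ?_ hη0
    have e : ∫ ω, (-((P 0 ω).1 j - (P 0 ω).2) - α j) ∂μ = -ε' := by
      have h3 : Integrable (fun ω => -((P 0 ω).1 j - (P 0 ω).2)) μ := ((h1 j).sub h2).neg
      rw [integral_sub h3 (integrable_const _), integral_neg, integral_sub (h1 j) h2, ha, hb]
      simp [hα]
    rw [e]
    linarith
  choose y hy0 hy using hex
  set M := ∑ j, (d j / ε' + 1) with hM
  have hM0 : 0 ≤ M := Finset.sum_nonneg fun j _ => by have := hd j; positivity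
  have hε1 : 0 < ε / (8 * (r + 1)) := by positivity
  have hlow : ∀ᶠ x in atTop, ∀ j, ∀ᶠ N : ℕ in atTop,
      (d j / α j - ε / (8 * (r + 1))) * ν.real (Set.Ioi x) ≤
        ∑ n ∈ Finset.range N, μ.real {ω | x + y j + n * α j < (P 0 ω).1 j} :=
    eventually_all.2 fun j => hh.le_sum (p := fun z => μ.real {ω | z < (P 0 ω).1 j})
      (fun _ => measureReal_nonneg) (hd j)
      (fun δ hδ => (htail j).eventually_ge hh.pos hδ) (hα0 j) (hy0 j) hε1
  have hup : ∀ᶠ x in atTop, ∀ j, ∀ N : ℕ,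
      ∑ n ∈ Finset.range N, μ.real {ω | x + n * ε' < (P 0 ω).1 j} ≤
        (d j / ε' + 1) * ν.real (Set.Ioi x) :=
    eventually_all.2 fun j => by
      have h3 := hh.sumTailLE (p := fun z => μ.real {ω | z < (P 0 ω).1 j}) (hd j)
        (fun δ hδ => (htail j).eventually_le hh.pos hδ) ε' hε'0 0 1 one_pos
      simpa only [sub_zero] using h3
  have hpr : ∀ᶠ x in atTop, ∀ N : ℕ, ∑ n ∈ Finset.range N, ∑ j : Fin r, ∑ k : Fin r with k ≠ j,
      μ.real {ω | x + n * ε' < (P 0 ω).1 j ∧ x + n * ε' < (P 0 ω).1 k} ≤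
        ε / 8 * ν.real (Set.Ioi x) := by
    have h3 := hh.sumTailLE (p := fun z => ∑ j : Fin r, ∑ k : Fin r with k ≠ j,
      μ.real {ω | z < (P 0 ω).1 j ∧ z < (P 0 ω).1 k}) le_rfl
      (fun δ hδ => by simpa only [zero_add] using hpair δ hδ) ε' hε'0 0 (ε / 8) (by positivity)
    simpa only [sub_zero, zero_div, zero_add] using h3
  -- The square of the summed tails is at most `M²` times the squared tail of `ν`; once that tail is
  -- below this constant, the square is at most `ε/8` times the tail.
  have hsq : 0 < ε / (8 * (M ^ 2 + 1)) := by positivity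
  filter_upwards [hlow, hup, hpr, (tendsto_measureReal_Ioi ν).eventually (eventually_le_nhds hsq)]
    with x hx1 hx2 hx3 hx4
  have htx := hh.subexp.pos x
  obtain ⟨N, hN⟩ := (eventually_all.2 hx1).exists
  refine le_trans ?_ (hP.sum_sub_le_measureReal_iUnion_bigJump hy0 hαmin hy x N)
  have e1 : (∑ j, d j / α j - ε / 8) * ν.real (Set.Ioi x) ≤
      ∑ j, ∑ n ∈ Finset.range N, μ.real {ω | x + y j + n * α j < (P 0 ω).1 j} := by
    refine le_trans ?_ (Finset.sum_le_sum fun j _ => hN j)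
    rw [← Finset.sum_mul, Finset.sum_sub_distrib, Finset.sum_const, Finset.card_univ,
      Fintype.card_fin, nsmul_eq_mul]
    gcongr
    rw [mul_div_assoc', div_le_div_iff₀ (by positivity) (by positivity)]
    nlinarith
  have e2 : ∑ j, ∑ n ∈ Finset.range N, μ.real {ω | x + n * ε' < (P 0 ω).1 j} ≤
      M * ν.real (Set.Ioi x) := by
    rw [hM, Finset.sum_mul]
    exact Finset.sum_le_sum fun j _ => hx2 j N
  have e3 : (∑ j, ∑ n ∈ Finset.range N, μ.real {ω | x + n * ε' < (P 0 ω).1 j}) ^ 2 ≤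
      ε / 8 * ν.real (Set.Ioi x) := by
    have h3 : 0 ≤ ∑ j, ∑ n ∈ Finset.range N, μ.real {ω | x + n * ε' < (P 0 ω).1 j} :=
      Finset.sum_nonneg fun _ _ => Finset.sum_nonneg fun _ _ => measureReal_nonneg
    have h4 : (M * ν.real (Set.Ioi x)) ^ 2 = M ^ 2 * ν.real (Set.Ioi x) * ν.real (Set.Ioi x) := by
      ring
    refine (pow_le_pow_left₀ h3 e2 2).trans (h4 ▸ ?_)
    gcongr
    calc M ^ 2 * ν.real (Set.Ioi x) ≤ (M ^ 2 + 1) * (ε / (8 * (M ^ 2 + 1))) := by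
          gcongr; linarith
      _ = ε / 8 := by field_simp
  have hη1 : 0 ≤ 1 - η := sub_nonneg.2 (min_le_left _ _)
  have e4 : (S - ε / 8 - ε / 8) * ν.real (Set.Ioi x) ≤
      ∑ j, ∑ n ∈ Finset.range N, μ.real {ω | x + y j + n * α j < (P 0 ω).1 j} :=
    le_trans (by gcongr) e1
  have e5 := mul_le_mul_of_nonneg_left e4 hη1
  have e6 : (S - ε / 2) * ν.real (Set.Ioi x) ≤
      (1 - η) * ((S - ε / 8 - ε / 8) * ν.real (Set.Ioi x)) := by
    rw [← mul_assoc]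
    gcongr
    nlinarith
  have e7 := hx3 N
  nlinarith

end

/-! ## Moments of the daters for the degenerate input -/

section Degenerate

variable {Ω K : Type*} {f : (l : ℕ) → (Fin l → ℝ) → (Fin l → K) → ℝ}

theorem lastActivity_eq {T : ℤ → ℝ} {ζ : ℤ → K} {m n : ℤ} {l : ℕ} (h : (n - m + 1).toNat = l) :
    lastActivity f T ζ m n = f l (fun i => T (m + (i : ℕ))) fun i => ζ (m + (i : ℕ)) := by
  subst h
  rfl

theorem dater_zero_shift (ζ : ℤ → K) (m n c : ℤ) :
    dater f (fun _ => 0) ζ (m + c) (n + c) = dater f (fun _ => 0) (fun k => ζ (k + c)) m n := by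
  unfold dater
  rw [lastActivity_eq (l := (n - m + 1).toNat) (by congr 1; ring), lastActivity]
  congr 2
  ext i
  congr 1
  ring

/-- Iterated subadditivity, peeling off the oldest customer; it serves both integrability and the
tail of a block. -/
theorem degenerateDater_le_sum (hf : IsMonotoneSeparable f) (ζ : ℤ → Ω → K) (ω : Ω) (m : ℤ)
    (l : ℕ) :
    degenerateDater f ζ (m - l) m ω ≤
      ∑ i ∈ Finset.range (l + 1), degenerateDater f ζ (m - i) (m - i) ω := by
  induction l with
  | zero => simp
  | succ l ih =>
    rw [Finset.sum_range_succ]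
    have h := hf.dater_zero_subadditive (fun k => ζ k ω) (m := m - (l + 1 : ℕ))
      (l := m - (l + 1 : ℕ)) (n := m) le_rfl (by push_cast; omega)
    rw [show m - ((l + 1 : ℕ) : ℤ) + 1 = m - l by push_cast; ring] at h
    simp only [degenerateDater] at *
    linarith

variable [MeasurableSpace Ω] [MeasurableSpace K] {μ : Measure Ω}

theorem measurable_dater_zero
    (hf_meas : ∀ l, Measurable (fun p : (Fin l → ℝ) × (Fin l → K) => f l p.1 p.2)) (m n : ℤ) :
    Measurable fun z : ℤ → K => dater f (fun _ => 0) z m n :=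
  ((hf_meas _).comp (measurable_const.prodMk (measurable_pi_lambda _ fun _ =>
    measurable_pi_apply _))).sub_const _

theorem measurable_degenerateDater
    (hf_meas : ∀ l, Measurable (fun p : (Fin l → ℝ) × (Fin l → K) => f l p.1 p.2))
    {ζ : ℤ → Ω → K} (hζ : ∀ n, Measurable (ζ n)) (m n : ℤ) :
    Measurable (degenerateDater f ζ m n) :=
  (measurable_dater_zero hf_meas m n).comp (measurable_pi_lambda _ hζ)

theorem identDistrib_degenerateDater
    (hf_meas : ∀ l, Measurable (fun p : (Fin l → ℝ) × (Fin l → K) => f l p.1 p.2))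
    {ζ : ℤ → Ω → K} (hind : iIndepFun ζ μ)
    (hid : ∀ n, IdentDistrib (ζ n) (ζ 0) μ μ) (m n c : ℤ) :
    IdentDistrib (degenerateDater f ζ (m + c) (n + c)) (degenerateDater f ζ m n) μ μ := by
  have h : IdentDistrib (fun ω k => ζ (k + c) ω) (fun ω k => ζ k ω) μ μ :=
    IdentDistrib.pi (fun k => (hid (k + c)).trans (hid k).symm)
      (hind.precomp (add_left_injective c)) hind
  have e : degenerateDater f ζ (m + c) (n + c) =
      fun ω => dater f (fun _ => 0) (fun k => ζ (k + c) ω) m n := by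
    ext ω
    exact dater_zero_shift _ m n c
  rw [e]
  exact h.comp (measurable_dater_zero hf_meas m n)

theorem integrable_degenerateDater (hf : IsMonotoneSeparable f)
    (hf_meas : ∀ l, Measurable (fun p : (Fin l → ℝ) × (Fin l → K) => f l p.1 p.2))
    {ζ : ℤ → Ω → K} (hζ : ∀ n, Measurable (ζ n))
    (hint : ∀ i, Integrable (degenerateDater f ζ i i) μ) {m n : ℤ} (hmn : m ≤ n) :
    Integrable (degenerateDater f ζ m n) μ := by
  obtain ⟨l, rfl⟩ : ∃ l : ℕ, m = n - l := ⟨(n - m).toNat, by omega⟩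
  refine Integrable.mono' (integrable_finsetSum (Finset.range (l + 1)) fun i _ => hint (n - i))
    (measurable_degenerateDater hf_meas hζ _ _).aestronglyMeasurable
    (Eventually.of_forall fun ω => ?_)
  rw [Real.norm_of_nonneg (show 0 ≤ degenerateDater f ζ _ _ ω from hf.dater_zero_nonneg _ hmn)]
  exact degenerateDater_le_sum hf ζ ω n l

/-- Under stability, the mean service time of a long block is less than its mean duration. -/
theorem exists_block_of_gammaZero_lt (hf : IsMonotoneSeparable f)
    (hf_meas : ∀ l, Measurable (fun p : (Fin l → ℝ) × (Fin l → K) => f l p.1 p.2))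
    {ζ : ℤ → Ω → K} (hζ : ∀ n, Measurable (ζ n)) (hind : iIndepFun ζ μ)
    (hid : ∀ n, IdentDistrib (ζ n) (ζ 0) μ μ)
    (hint : ∀ i, Integrable (degenerateDater f ζ i i) μ) {a : ℝ} (ha : gammaZero f ζ μ < a) :
    ∃ L : ℕ, 0 < L ∧ ∫ ω, degenerateDater f ζ (-(L : ℤ) + 1) 0 ω ∂μ < L * a := by
  set u : ℕ → ℝ := fun n => ∫ ω, degenerateDater f ζ (-(n : ℤ)) (-1) ω ∂μ with hu
  -- At `n = 0` the window is empty and the network properties say nothing about `u 0`; setting the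
  -- value to `0` gives a subadditive sequence with the same quotients.
  set v : ℕ → ℝ := fun n => if n = 0 then 0 else u n with hv
  have hu0 : ∀ n : ℕ, n ≠ 0 → 0 ≤ u n := fun n hn =>
    integral_nonneg fun ω => hf.dater_zero_nonneg _ (by omega)
  have hv0 : ∀ n, 0 ≤ v n := fun n => by
    simp only [hv]
    split_ifs with h
    · exact le_rfl
    · exact hu0 n h
  have hshift : ∀ m n c : ℤ, ∫ ω, degenerateDater f ζ (m + c) (n + c) ω ∂μ =
      ∫ ω, degenerateDater f ζ m n ω ∂μ := fun m n c =>
    (identDistrib_degenerateDater hf_meas hind hid m n c).integral_eq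
  have hsub : Subadditive v := by
    intro m n
    rcases eq_or_ne m 0 with rfl | hm
    · simp [hv]
    rcases eq_or_ne n 0 with rfl | hn
    · simp [hv]
    simp only [hv, hm, hn, if_false, show m + n ≠ 0 by omega]
    have h1 : u m = ∫ ω, degenerateDater f ζ (-((m + n : ℕ) : ℤ)) (-(n : ℤ) - 1) ω ∂μ := by
      rw [show -((m + n : ℕ) : ℤ) = -(m : ℤ) + -(n : ℤ) by push_cast; ring,
        show -(n : ℤ) - 1 = -1 + -(n : ℤ) by ring]
      exact (hshift _ _ _).symm
    rw [h1, hu, ← integral_add (integrable_degenerateDater hf hf_meas hζ hint (by omega))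
      (integrable_degenerateDater hf hf_meas hζ hint (by omega))]
    refine integral_mono (integrable_degenerateDater hf hf_meas hζ hint (by omega))
      ((integrable_degenerateDater hf hf_meas hζ hint (by omega)).add
        (integrable_degenerateDater hf hf_meas hζ hint (by omega))) fun ω => ?_
    have h2 := hf.dater_zero_subadditive (fun k => ζ k ω) (m := -((m + n : ℕ) : ℤ))
      (l := -(n : ℤ) - 1) (n := -1) (by omega) (by omega)
    rw [sub_add_cancel] at h2
    exact h2
  have hbdd : BddBelow (Set.range fun n => v n / n) :=
    ⟨0, by rintro _ ⟨n, rfl⟩; exact div_nonneg (hv0 n) (Nat.cast_nonneg n)⟩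
  have hlim := hsub.tendsto_lim hbdd
  have huv : (fun n : ℕ => v n / (n : ℝ)) = fun n : ℕ => u n / (n : ℝ) := by
    ext n
    rcases eq_or_ne n 0 with rfl | hn
    · simp
    · simp [hv, hn]
  rw [huv] at hlim
  -- Convergence comes from Fekete's lemma; only then is `gammaZero` known to be the limit.
  have hγ : Tendsto (fun n : ℕ => u n / (n : ℝ)) atTop (𝓝 (gammaZero f ζ μ)) := by
    rw [gammaZero, hlim.limUnder_eq]
    exact hlim
  obtain ⟨L, hL, hL0⟩ := ((hγ.eventually (eventually_lt_nhds ha)).and (eventually_gt_atTop 0)).exists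
  refine ⟨L, hL0, ?_⟩
  rw [div_lt_iff₀ (by exact_mod_cast hL0), mul_comm] at hL
  have h3 := hshift (-(L : ℤ)) (-1) 1
  rw [show (-1 : ℤ) + 1 = 0 by ring] at h3
  rw [h3]
  exact hL

end Degenerate

/-! ## Tails of the service vectors -/

section Tails

theorem TailEquiv.eventually_le_two_mul {p g : ℝ → ℝ} (H : TailEquiv p 1 g) (hg : ∀ x, 0 ≤ g x) :
    ∀ᶠ x in atTop, p x ≤ 2 * g x := by
  filter_upwards [H.eventually (eventually_gt_nhds (show (1 / 2 : ℝ) < 1 by norm_num)),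
    H.eventually (eventually_lt_nhds (show (1 : ℝ) < 2 by norm_num))] with x h1 h2
  -- If `g x = 0` the quotient is `0` by convention, against its being above `1/2`.
  rcases (hg x).eq_or_lt with h | h
  · rw [← h, div_zero] at h1
    norm_num at h1
  · exact ((div_lt_iff₀ h).1 h2).le

variable {Ω : Type*} [MeasurableSpace Ω] {μ : Measure Ω} {r : ℕ}
  {F : ℝ → ℝ} {d : Fin r → ℝ} {Y : ℤ → Fin r → Ω → ℝ}

/-- In covering the union, `A j` may be replaced by `A j \ A k`, since `A k` is covered anyway. The
saving bounds the intersection by the defect of the union bound. -/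
theorem measureReal_inter_le_sum_sub [IsFiniteMeasure μ] {ι : Type*} [Fintype ι] {A : ι → Set Ω}
    (hA : ∀ i, MeasurableSet (A i)) {j k : ι} (hjk : k ≠ j) :
    μ.real (A j ∩ A k) ≤ ∑ i, μ.real (A i) - μ.real (⋃ i, A i) := by
  classical
  have hsub : ⋃ i, A i ⊆ (⋃ i ∈ Finset.univ.erase j, A i) ∪ (A j \ A k) := by
    intro ω hω
    obtain ⟨i, hi⟩ := Set.mem_iUnion.1 hω
    by_cases hk : ω ∈ A k
    · exact Or.inl (Set.mem_iUnion₂.2 ⟨k, Finset.mem_erase.2 ⟨hjk, Finset.mem_univ _⟩, hk⟩)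
    by_cases hij : i = j
    · exact Or.inr ⟨hij ▸ hi, hk⟩
    · exact Or.inl (Set.mem_iUnion₂.2 ⟨i, Finset.mem_erase.2 ⟨hij, Finset.mem_univ _⟩, hi⟩)
  have h1 := (measureReal_mono (μ := μ) hsub).trans (measureReal_union_le _ _)
  have h2 := measureReal_biUnion_finset_le (μ := μ) (Finset.univ.erase j) A
  have h3 := measureReal_sdiff_add_inter (μ := μ) (s := A j) (hA k)
  have h4 := Finset.add_sum_erase Finset.univ (fun i => μ.real (A i)) (Finset.mem_univ j)
  linarith

/-- By (H) the union bound for the maximum is asymptotically sharp, and its defect dominates the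
probability that two given components are both large. -/
theorem AssumptionH.pair_tail_le [IsProbabilityMeasure μ] (hF : ∀ x, 0 < tail F x) (hH : AssumptionH F d Y μ)
    (hY_meas : ∀ i j, Measurable (Y i j)) {δ : ℝ} (hδ : 0 < δ) :
    ∀ᶠ x in atTop, ∑ j : Fin r, ∑ k : Fin r with k ≠ j,
      μ.real {ω | x < Y 1 j ω ∧ x < Y 1 k ω} ≤ δ * tail F x := by
  rcases Nat.eq_zero_or_pos r with rfl | hr
  · refine Eventually.of_forall fun x => ?_
    have := hF x
    simp only [Finset.univ_eq_empty, Finset.sum_empty]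
    positivity
  have : Nonempty (Fin r) := ⟨⟨0, hr⟩⟩
  have hD : 0 ≤ ∑ j, d j := hH.sum_tails.nonneg hF fun x => Finset.sum_nonneg fun _ _ => measureReal_nonneg
  set D := ∑ j, d j
  have hη : 0 < δ / (r * r * (D + 1)) := by positivity
  filter_upwards [hH.sum_tails.eventually_le hF one_pos,
    hH.max_sum_tails.eventually (eventually_gt_nhds
      (show 1 - δ / (r * r * (D + 1)) < 1 by linarith))] with x h1 h2
  have hsup : {ω | x < ⨆ j, Y 1 j ω} = ⋃ j, {ω | x < Y 1 j ω} := by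
    ext ω
    simp only [Set.mem_ofPred_eq, Set.mem_iUnion]
    exact lt_ciSup_iff (Set.finite_range _).bddAbove
  have hsum0 : 0 ≤ ∑ j, μ.real {ω | x < Y 1 j ω} := Finset.sum_nonneg fun _ _ => measureReal_nonneg
  have hdiff : ∑ j, μ.real {ω | x < Y 1 j ω} - μ.real (⋃ j, {ω | x < Y 1 j ω}) ≤
      δ / (r * r * (D + 1)) * ∑ j, μ.real {ω | x < Y 1 j ω} := by
    rw [← hsup]
    rcases hsum0.eq_or_lt with h | h
    · rw [← h]
      linarith [measureReal_nonneg (μ := μ) (s := {ω | x < ⨆ j, Y 1 j ω})]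
    · rw [lt_div_iff₀ h] at h2
      linarith
  have hFx := hF x
  have hpair : ∀ j k : Fin r, k ≠ j → μ.real {ω | x < Y 1 j ω ∧ x < Y 1 k ω} ≤
      δ / (r * r * (D + 1)) * ((D + 1) * tail F x) := by
    intro j k hjk
    refine le_trans (measureReal_inter_le_sum_sub (A := fun j => {ω | x < Y 1 j ω})
      (fun i => measurableSet_lt measurable_const (hY_meas 1 i)) hjk) (hdiff.trans ?_)
    gcongr
  calc ∑ j : Fin r, ∑ k : Fin r with k ≠ j, μ.real {ω | x < Y 1 j ω ∧ x < Y 1 k ω}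
      ≤ ∑ _j : Fin r, ∑ _k : Fin r, δ / (r * r * (D + 1)) * ((D + 1) * tail F x) := by
        refine Finset.sum_le_sum fun j _ => ?_
        refine (Finset.sum_le_sum fun k hk => hpair j k (Finset.mem_filter.1 hk).2).trans ?_
        exact Finset.sum_le_sum_of_subset_of_nonneg (Finset.filter_subset _ _)
          fun _ _ _ => by positivity
    _ = δ * tail F x := by
        simp only [Finset.sum_const, Finset.card_univ, Fintype.card_fin, nsmul_eq_mul]
        field_simp

theorem AssumptionH.sum_tail_le (hF : ∀ x, 0 < tail F x) (hH : AssumptionH F d Y μ) :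
    ∃ C : ℝ, 0 ≤ C ∧ ∀ᶠ x in atTop, μ.real {ω | x < ∑ j, Y 1 j ω} ≤ C * tail F x := by
  have hD : 0 ≤ ∑ j, d j := hH.sum_tails.nonneg hF fun x => Finset.sum_nonneg fun _ _ => measureReal_nonneg
  refine ⟨2 * (2 * (∑ j, d j + 1)), by positivity, ?_⟩
  filter_upwards [hH.sum_max.eventually_le_two_mul fun _ => measureReal_nonneg,
    hH.max_sum_tails.eventually_le_two_mul fun _ => Finset.sum_nonneg fun _ _ => measureReal_nonneg,
    hH.sum_tails.eventually_le hF one_pos] with x h1 h2 h3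
  linarith

end Tails

/-! ### Parallel queues on the time-reversed indices -/

section Queues

theorem sum_Icc_neg_zero (g : ℤ → ℝ) (n : ℕ) :
    ∑ i ∈ Finset.Icc (-(n : ℤ)) 0, g i = ∑ k ∈ Finset.range (n + 1), g (-(k : ℤ)) := by
  induction n with
  | zero => simp
  | succ n ih =>
    have e : Finset.Icc (-((n + 1 : ℕ) : ℤ)) 0 =
        insert (-((n + 1 : ℕ) : ℤ)) (Finset.Icc (-(n : ℤ)) 0) := by
      ext i
      simp only [Finset.mem_Icc, Finset.mem_insert]
      omega
    rw [e, Finset.sum_insert (by simp), ih, Finset.sum_range_succ _ (n + 1), add_comm]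

theorem sum_Icc_neg_neg_one (g : ℤ → ℝ) (n : ℕ) :
    ∑ i ∈ Finset.Icc (-(n : ℤ)) (-1), g i = ∑ k ∈ Finset.range n, g (-((k + 1 : ℕ) : ℤ)) := by
  induction n with
  | zero => simp
  | succ n ih =>
    have e : Finset.Icc (-((n + 1 : ℕ) : ℤ)) (-1) =
        insert (-((n + 1 : ℕ) : ℤ)) (Finset.Icc (-(n : ℤ)) (-1)) := by
      ext i
      simp only [Finset.mem_Icc, Finset.mem_insert]
      omega
    rw [e, Finset.sum_insert (by simp), ih, Finset.sum_range_succ, add_comm]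

variable {Ω : Type*} {r : ℕ} {T : ℤ → Ω → ℝ} {Y : ℤ → Fin r → Ω → ℝ}

theorem lt_forkJoinResponseTime_iff {x : ℝ} {ω : Ω} :
    (x : EReal) < forkJoinResponseTime T Y ω ↔
      ∃ j, ∃ n : ℕ, x < ∑ k ∈ Finset.range (n + 1), Y (-(k : ℤ)) j ω -
        ∑ k ∈ Finset.range n, interarrival T (-((k + 1 : ℕ) : ℤ)) ω := by
  simp only [forkJoinResponseTime, responseTime, lt_iSup_iff, EReal.coe_lt_coe_iff]
  refine exists_congr fun j => ⟨?_, ?_⟩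
  · rintro ⟨⟨n, hn⟩, h⟩
    obtain ⟨k, rfl⟩ : ∃ k : ℕ, n = -(k : ℤ) := ⟨(-n).toNat, by omega⟩
    refine ⟨k, ?_⟩
    rwa [sum_Icc_neg_zero fun i => Y i j ω, sum_Icc_neg_neg_one fun i => interarrival T i ω] at h
  · rintro ⟨k, h⟩
    refine ⟨⟨-(k : ℤ), by omega⟩, ?_⟩
    rwa [sum_Icc_neg_zero fun i => Y i j ω, sum_Icc_neg_neg_one fun i => interarrival T i ω]

variable [MeasurableSpace Ω] {μ : Measure Ω} [IsProbabilityMeasure μ]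

/-- Independent i.i.d. service vectors and interarrival times, with comparable tails. -/
structure IsParallelQueueInput (T : ℤ → Ω → ℝ) (Y : ℤ → Fin r → Ω → ℝ) (F : ℝ → ℝ)
    (d b : Fin r → ℝ) (a : ℝ) (μ : Measure Ω) : Prop where
  measY : ∀ i j, Measurable (Y i j)
  measT : ∀ n, Measurable (interarrival T n)
  nonnegT : ∀ n, ∀ᵐ ω ∂μ, 0 ≤ interarrival T n ω
  indepY : iIndepFun (fun i ω j => Y i j ω) μ
  indepT : iIndepFun (interarrival T) μ
  indep : IndepFun (fun ω i j => Y i j ω) (fun ω n => interarrival T n ω) μ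
  identY : ∀ i, IdentDistrib (fun ω j => Y i j ω) (fun ω j => Y 0 j ω) μ μ
  identT : ∀ n, IdentDistrib (interarrival T n) (interarrival T 0) μ μ
  intY : ∀ j, Integrable (Y 0 j) μ
  intT : Integrable (interarrival T 0) μ
  meanY : ∀ j, ∫ ω, Y 0 j ω ∂μ = b j
  meanT : ∫ ω, interarrival T 0 ω ∂μ = a
  tails : ∀ j, TailEquiv (fun x => μ.real {ω | x < Y 0 j ω}) (d j) (tail F)
  pairs : ∀ δ > 0, ∀ᶠ x in atTop, ∑ j : Fin r, ∑ k : Fin r with k ≠ j,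
      μ.real {ω | x < Y 0 j ω ∧ x < Y 0 k ω} ≤ δ * tail F x

theorem IsParallelQueueInput.lower_bound {F : ℝ → ℝ} {d b : Fin r → ℝ} {a : ℝ}
    (H : IsParallelQueueInput T Y F d b a μ) {ν : Measure ℝ} (hh : IsIntegratedTail (tail F) ν)
    (hab : ∀ j, b j < a) {ε : ℝ} (hε : 0 < ε) :
    ∀ᶠ x : ℝ in atTop, (∑ j, d j / (a - b j) - ε) * ν.real (Set.Ioi x) ≤
      μ.real {ω | (x : EReal) < forkJoinResponseTime T Y ω} := by
  have hinj : Function.Injective fun k : ℕ => -(k : ℤ) := fun k l h => by simpa using h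
  have hinj' : Function.Injective fun k : ℕ => -((k + 1 : ℕ) : ℤ) := fun k l h => by simpa using h
  have hU : IsIID (fun (k : ℕ) ω j => Y (-(k : ℤ)) j ω) μ :=
    isIID_of_injective (X := fun i ω j => Y i j ω) (fun i => measurable_pi_lambda _ (H.measY i))
      H.indepY 0 H.identY hinj
  -- `Y_{-k}` is paired with `τ_{-(k+1)}`: the jump of customer `-n` then comes after `n` complete
  -- increments of indices below `n`.
  have hV : IsIID (fun (k : ℕ) => interarrival T (-((k + 1 : ℕ) : ℤ))) μ :=
    isIID_of_injective H.measT H.indepT 0 H.identT hinj'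
  have hP := hU.prodMk hV (H.indep.comp (φ := fun (z : ℤ → Fin r → ℝ) (k : ℕ) => z (-(k : ℤ)))
    (ψ := fun (z : ℤ → ℝ) (k : ℕ) => z (-((k + 1 : ℕ) : ℤ))) (by fun_prop) (by fun_prop))
  have hT1 := H.identT (-((0 + 1 : ℕ) : ℤ))
  filter_upwards [hP.le_response_tail hh (a := a) (b := b) (d := d) H.intY
    (hT1.symm.integrable_snd H.intT) (by rw [← H.meanT]; exact hT1.integral_eq)
    H.meanY hab H.tails H.pairs hε] with x hx
  refine hx.trans (le_of_eq (congrArg _ ?_))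
  ext ω
  change _ ↔ (x : EReal) < forkJoinResponseTime T Y ω
  rw [lt_forkJoinResponseTime_iff]
  refine exists_congr fun j => exists_congr fun n => ?_
  rw [Finset.sum_range_succ, Finset.sum_sub_distrib]
  refine iff_of_eq (congrArg _ ?_)
  ring

theorem IsParallelQueueInput.upper_bound {F : ℝ → ℝ} {d b : Fin r → ℝ} {a : ℝ}
    (H : IsParallelQueueInput T Y F d b a μ) {ν : Measure ℝ} (hh : IsIntegratedTail (tail F) ν)
    (hab : ∀ j, b j < a) {ε : ℝ} (hε : 0 < ε) :
    ∀ᶠ x : ℝ in atTop, μ.real {ω | (x : EReal) < forkJoinResponseTime T Y ω} ≤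
      (∑ j, d j / (a - b j) + ε) * ν.real (Set.Ioi x) := by
  have hinj : Function.Injective fun k : ℕ => -(k : ℤ) := fun k l h => by simpa using h
  have hε' : 0 < ε / (r + 1) := by positivity
  have key : ∀ᶠ x : ℝ in atTop, ∀ j, μ.real {ω | ∃ n : ℕ, x <
      ∑ k ∈ Finset.range (n + 1), Y (-(k : ℤ)) j ω -
        ∑ k ∈ Finset.range n, interarrival T (-((k + 1 : ℕ) : ℤ)) ω} ≤
      (d j / (a - b j) + ε / (r + 1)) * ν.real (Set.Ioi x) := by
    refine eventually_all.2 fun j => ?_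
    have hU : IsIID (fun (k : ℕ) => Y (-(k : ℤ)) j) μ :=
      (isIID_of_injective (X := fun i ω j => Y i j ω) (fun i => measurable_pi_lambda _ (H.measY i))
        H.indepY 0 H.identY hinj).comp (measurable_pi_apply j)
    -- Here the pairing is `Y_{-k}` with `τ_{-k}`, so that `Y_0` is the initial value and the
    -- increments start at index `1`.
    have hV : IsIID (fun (k : ℕ) => interarrival T (-(k : ℤ))) μ :=
      isIID_of_injective H.measT H.indepT 0 H.identT hinj
    have hP := hU.prodMk hV (H.indep.comp
      (φ := fun (z : ℤ → Fin r → ℝ) (k : ℕ) => z (-(k : ℤ)) j)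
      (ψ := fun (z : ℤ → ℝ) (k : ℕ) => z (-(k : ℤ))) (by fun_prop) (by fun_prop))
    filter_upwards [hP.response_tail_le hh (H.intY j) H.intT (H.nonnegT 0) (sub_pos.2 (hab j))
      (by rw [neg_sub]; exact congrArg₂ _ (H.meanY j) H.meanT)
      ((H.tails j).nonneg hh.pos fun _ => measureReal_nonneg)
      (fun δ hδ => (H.tails j).eventually_le hh.pos hδ) hε'] with x hx
    refine le_trans (le_of_eq (congrArg _ ?_)) hx
    ext ω
    refine exists_congr fun n => ?_
    rw [Finset.sum_range_succ', Finset.sum_sub_distrib]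
    refine iff_of_eq (congrArg _ ?_)
    ring
  filter_upwards [key] with x hx
  have e : {ω | (x : EReal) < forkJoinResponseTime T Y ω} = ⋃ j, {ω | ∃ n : ℕ, x <
      ∑ k ∈ Finset.range (n + 1), Y (-(k : ℤ)) j ω -
        ∑ k ∈ Finset.range n, interarrival T (-((k + 1 : ℕ) : ℤ)) ω} := by
    ext ω
    simp only [Set.mem_iUnion]
    exact lt_forkJoinResponseTime_iff
  rw [e]
  refine (measureReal_iUnion_fintype_le _).trans ((Finset.sum_le_sum fun j _ => hx j).trans ?_)
  rw [← Finset.sum_mul, Finset.sum_add_distrib, Finset.sum_const, Finset.card_univ,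
    Fintype.card_fin, nsmul_eq_mul]
  have := hh.subexp.pos x
  gcongr
  rw [mul_div_assoc', div_le_iff₀ (by positivity)]
  nlinarith

/-- Exact tail asymptotics of the stationary response time of parallel queues. -/
theorem IsParallelQueueInput.tendsto {F : ℝ → ℝ} {d b : Fin r → ℝ} {a : ℝ}
    (H : IsParallelQueueInput T Y F d b a μ) {ν : Measure ℝ} (hh : IsIntegratedTail (tail F) ν)
    (hab : ∀ j, b j < a) :
    Tendsto (fun x : ℝ => μ.real {ω | (x : EReal) < forkJoinResponseTime T Y ω} /
      ν.real (Set.Ioi x)) atTop (𝓝 (∑ j, d j / (a - b j))) := by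
  rw [Metric.tendsto_nhds]
  intro ε hε
  filter_upwards [H.lower_bound hh hab (half_pos hε), H.upper_bound hh hab (half_pos hε)]
    with x h1 h2
  have h3 := hh.subexp.pos x
  rw [← le_div_iff₀ h3] at h1
  rw [← div_le_iff₀ h3] at h2
  rw [Real.dist_eq, abs_lt]
  constructor <;> linarith

end Queues

/-! ### Order of the tail of the stationary dater, by blocks -/

section Upper

variable {Ω K : Type*} [MeasurableSpace Ω] [MeasurableSpace K] {μ : Measure Ω}
  [IsProbabilityMeasure μ] {f : (l : ℕ) → (Fin l → ℝ) → (Fin l → K) → ℝ}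
  {T : ℤ → Ω → ℝ} {ζ : ℤ → Ω → K}

/-- The stationary maximal dater has a tail at most of the order of the integrated tail. -/
theorem stationaryDater_tail_le (hf : IsMonotoneSeparable f)
    (hf_meas : ∀ l, Measurable (fun p : (Fin l → ℝ) × (Fin l → K) => f l p.1 p.2))
    (hT_meas : ∀ n, Measurable (T n)) (hT_mono : ∀ᵐ ω ∂μ, Monotone (fun n => T n ω))
    (hζ : ∀ n, Measurable (ζ n)) (hτ_int : Integrable (interarrival T 0) μ)
    (hIA : AssumptionIA T ζ μ)
    (hstab : gammaZero f ζ μ < ∫ ω, interarrival T 0 ω ∂μ)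
    (hint : ∀ i, Integrable (degenerateDater f ζ i i) μ) {h : ℝ → ℝ} {νF ν : Measure ℝ}
    (hνF : SubexpLaw νF) (hF : ∀ x, h x = νF.real (Set.Ioi x)) (hh : IsIntegratedTail h ν)
    {C : ℝ} (hC : 0 ≤ C)
    (htail : ∀ᶠ x in atTop, μ.real {ω | x < degenerateDater f ζ 0 0 ω} ≤ C * h x) :
    ∃ C' : ℝ, ∀ᶠ x : ℝ in atTop,
      μ.real {ω | (x : EReal) < stationaryDater f T ζ ω} ≤ C' * ν.real (Set.Ioi x) := by
  obtain ⟨L, hL, hmean⟩ := exists_block_of_gammaZero_lt hf hf_meas hζ hIA.indep_marks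
    hIA.ident_marks hint hstab
  have hτm : ∀ n, Measurable (interarrival T n) := fun n => (hT_meas _).sub (hT_meas _)
  -- Block variables
  have hblock : ∀ c : ℤ, Function.Injective
      fun p : ℕ × Fin L => -((L * p.1 : ℕ) : ℤ) + c + ((p.2 : ℕ) : ℤ) := by
    rintro c ⟨k, i⟩ ⟨l, j⟩ h
    have h1 : ((L * k : ℕ) : ℤ) - (i : ℕ) = ((L * l : ℕ) : ℤ) - (j : ℕ) := by
      simp only at h; linarith
    have hi := i.2
    have hj := j.2
    have hkl : k = l := by
      rcases lt_trichotomy k l with hlt | heq | hlt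
      · have : L * (k + 1) ≤ L * l := Nat.mul_le_mul_left _ hlt
        rw [mul_add] at this
        omega
      · exact heq
      · have : L * (l + 1) ≤ L * k := Nat.mul_le_mul_left _ hlt
        rw [mul_add] at this
        omega
    subst hkl
    have : (i : ℕ) = j := by omega
    exact Prod.ext rfl (Fin.ext this)
  have hU := isIID_block hζ hIA.indep_marks 0 hIA.ident_marks (hblock (-(L : ℤ) + 1))
  have hV := isIID_block hτm hIA.indep_interarrival 0 hIA.ident_interarrival (hblock 0)
  have hUV := hU.prodMk hV (hIA.indep.comp
    (φ := fun (z : ℤ → K) (k : ℕ) (j : Fin L) =>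
      z (-((L * k : ℕ) : ℤ) + (-(L : ℤ) + 1) + ((j : ℕ) : ℤ)))
    (ψ := fun (z : ℤ → ℝ) (k : ℕ) (j : Fin L) => z (-((L * k : ℕ) : ℤ) + 0 + ((j : ℕ) : ℤ)))
    (by fun_prop) (by fun_prop))
  have hP := hUV.comp (g := fun p : (Fin L → K) × (Fin L → ℝ) =>
    (f L (fun _ => 0) p.1, ∑ i, p.2 i))
    (((hf_meas L).comp (measurable_const.prodMk measurable_fst)).prodMk (by fun_prop))
  -- Block `k` consists of the customers `-L(k+1)+1, …, -Lk`, and the second component is the gap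
  -- from its last point to that of block `k - 1`. For `k = 0` this gap lies in the future; it only
  -- completes the i.i.d. sequence and does not enter the walk.
  set P : ℕ → Ω → ℝ × ℝ := fun k ω =>
    (degenerateDater f ζ (-((L * (k + 1) : ℕ) : ℤ) + 1) (-((L * k : ℕ) : ℤ)) ω,
      T (-((L * k : ℕ) : ℤ) + L) ω - T (-((L * k : ℕ) : ℤ)) ω) with hPdef
  have hPeq : P = fun k ω => (f L (fun _ => 0)
      (fun j : Fin L => ζ (-((L * k : ℕ) : ℤ) + (-(L : ℤ) + 1) + ((j : ℕ) : ℤ)) ω),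
      ∑ i : Fin L, interarrival T (-((L * k : ℕ) : ℤ) + 0 + ((i : ℕ) : ℤ)) ω) := by
    ext k ω
    · simp only [hPdef, degenerateDater, dater, sub_zero]
      rw [lastActivity_eq (l := L) (by push_cast; ring_nf; omega)]
      congr 1
      ext j
      congr 1
      push_cast
      ring
    · simp only [hPdef]
      rw [Fin.sum_univ_eq_sum_range (fun i : ℕ =>
        interarrival T (-((L * k : ℕ) : ℤ) + 0 + (i : ℤ)) ω) L]
      have := Finset.sum_range_sub (fun i : ℕ => T (-((L * k : ℕ) : ℤ) + (i : ℤ)) ω) L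
      simp only [Nat.cast_zero, add_zero] at this
      rw [← this]
      refine Finset.sum_congr rfl fun i _ => ?_
      simp only [interarrival, add_zero]
      push_cast
      ring_nf
  rw [← hPeq] at hP
  have hP1 : Integrable (fun ω => (P 0 ω).1) μ :=
    integrable_degenerateDater hf hf_meas hζ hint (by push_cast; omega)
  have hτi : ∀ n, Integrable (interarrival T n) μ := fun n =>
    (hIA.ident_interarrival n).symm.integrable_snd hτ_int
  have hP2e : (fun ω => (P 0 ω).2) =
      fun ω => ∑ i : Fin L, interarrival T (-((L * 0 : ℕ) : ℤ) + 0 + ((i : ℕ) : ℤ)) ω := by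
    rw [hPeq]
  have hP2 : Integrable (fun ω => (P 0 ω).2) μ := by
    rw [hP2e]
    exact integrable_finsetSum _ fun i _ => hτi _
  have hP2m : ∫ ω, (P 0 ω).2 ∂μ = L * ∫ ω, interarrival T 0 ω ∂μ := by
    rw [hP2e, integral_finsetSum _ fun i _ => hτi _]
    simp [fun n => (hIA.ident_interarrival n).integral_eq]
  have hP20 : ∀ᵐ ω ∂μ, 0 ≤ (P 0 ω).2 := by
    filter_upwards [hT_mono] with ω hω
    exact sub_nonneg.2 (hω (by omega))
  have hP1m : ∫ ω, (P 0 ω).1 ∂μ < L * ∫ ω, interarrival T 0 ω ∂μ := by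
    simpa [hPdef] using hmean
  -- Tail of the block service time
  have hA : IsIID (fun (k : ℕ) => degenerateDater f ζ (0 - (k : ℤ)) (0 - (k : ℤ))) μ := by
    have h1 := (isIID_of_injective hζ hIA.indep_marks 0 hIA.ident_marks
      (e := fun k : ℕ => 0 - (k : ℤ)) fun k l h => by simpa using h).comp
      (g := fun z => f 1 (fun _ => 0) fun _ => z)
      ((hf_meas 1).comp (measurable_const.prodMk (measurable_pi_lambda _ fun _ => measurable_id)))
    convert h1 using 1
    ext k ω
    simp only [degenerateDater, dater, sub_zero]
    rw [lastActivity_eq (l := 1) (by simp)]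
    congr 1
    ext j
    simp
  -- Subexponentiality of `F` itself is used here, to keep the sum of `L` single daters at order
  -- `F̄`.
  obtain ⟨C', hC', hsum⟩ := hA.sum_tail_le hνF hC (by simpa only [Nat.cast_zero, sub_zero, ← hF] using htail) L
  have hPtail : ∀ δ > 0, ∀ᶠ x in atTop, μ.real {ω | x < (P 0 ω).1} ≤ (C' + δ) * h x := by
    intro δ hδ
    filter_upwards [hsum] with x hx
    rw [← hF] at hx
    refine (measureReal_mono ?_).trans (hx.trans ?_)
    · intro ω (hω : x < degenerateDater f ζ (-((L * (0 + 1) : ℕ) : ℤ) + 1) (-((L * 0 : ℕ) : ℤ)) ω)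
      obtain ⟨l, rfl⟩ : ∃ l, L = l + 1 := ⟨L - 1, by omega⟩
      have h1 := degenerateDater_le_sum hf ζ ω 0 l
      have e1 : -(((l + 1) * (0 + 1) : ℕ) : ℤ) + 1 = 0 - l := by push_cast; ring
      have e2 : -(((l + 1) * 0 : ℕ) : ℤ) = 0 := by simp
      rw [e1, e2] at hω
      exact hω.trans_le h1
    · have := hh.pos x
      gcongr
      linarith
  have hm : 0 < L * ∫ ω, interarrival T 0 ω ∂μ - ∫ ω, (P 0 ω).1 ∂μ := sub_pos.2 hP1m
  refine ⟨C' / (L * ∫ ω, interarrival T 0 ω ∂μ - ∫ ω, (P 0 ω).1 ∂μ) + 1, ?_⟩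
  filter_upwards [hP.response_tail_le hh hP1 hP2 hP20 hm (by rw [hP2m]; ring) hC' hPtail one_pos]
    with x hx
  refine le_trans (ENNReal.toReal_mono (measure_ne_top _ _) (measure_mono_ae ?_)) hx
  filter_upwards [hT_mono] with ω hω (hω2 : (x : EReal) < stationaryDater f T ζ ω)
  obtain ⟨n, hn⟩ := lt_stationaryDater_imp_block hf hω hL hω2
  refine ⟨n, hn.trans_le (le_of_eq ?_)⟩
  refine congrArg₂ _ rfl (Finset.sum_congr rfl fun i _ => ?_)
  simp only [hPdef]
  rw [show -((L * (i + 1) : ℕ) : ℤ) + L = -((L * i : ℕ) : ℤ) by push_cast; ring]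

end Upper

end MonSep

/-! ### Assembly of the bounds -/

theorem theorem6 {Ω K : Type*} [MeasurableSpace Ω] [MeasurableSpace K]
    (μ : Measure Ω) [IsProbabilityMeasure μ]
    -- the network
    (f : (l : ℕ) → (Fin l → ℝ) → (Fin l → K) → ℝ)
    (hf_meas : ∀ l, Measurable (fun p : (Fin l → ℝ) × (Fin l → K) => f l p.1 p.2))
    (hf : MonSep.IsMonotoneSeparable f)
    -- arrival times and marks
    (T : ℤ → Ω → ℝ) (hT_meas : ∀ n, Measurable (T n))
    (hT_mono : ∀ᵐ ω ∂μ, Monotone (fun n => T n ω))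
    (ζ : ℤ → Ω → K) (hζ_meas : ∀ n, Measurable (ζ n))
    (hτ_int : Integrable (MonSep.interarrival T 0) μ)
    (a : ℝ) (ha : a = ∫ ω, MonSep.interarrival T 0 ω ∂μ)
    -- stability
    (hstab : MonSep.gammaZero f ζ μ < a)
    -- the assumptions (IA), (AA), (SE), (H)
    {r : ℕ} (Y : ℤ → Fin r → Ω → ℝ) (hY_meas : ∀ i j, Measurable (Y i j))
    (F : ℝ → ℝ) (d : Fin r → ℝ)
    (hIA : MonSep.AssumptionIA T ζ μ)
    (hAA : MonSep.AssumptionAA f T ζ Y μ)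
    (hSE : MonSep.AssumptionSE F d Y μ)
    (hH : MonSep.AssumptionH F d Y μ)
    (b : Fin r → ℝ) (hb : ∀ j, b j = ∫ ω, Y 1 j ω ∂μ) :
    -- the lower bound fork-join queue has exact asymptotics
    Tendsto (fun x : ℝ =>
        μ.real {ω | (x : EReal) < MonSep.forkJoinResponseTime T Y ω} /
          MonSep.tail (MonSep.integratedTailCDF F) x)
      atTop (𝓝 (∑ j, d j / (a - b j))) ∧
    -- which bound the tail of the stationary maximal dater from below
    ((∑ j, d j / (a - b j) : ℝ) : EReal) ≤
      liminf (fun x : ℝ =>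
        ((μ.real {ω | (x : EReal) < MonSep.stationaryDater f T ζ ω} /
          MonSep.tail (MonSep.integratedTailCDF F) x : ℝ) : EReal)) atTop ∧
    -- and the order of magnitude is exact
    (fun x : ℝ => μ.real {ω | (x : EReal) < MonSep.stationaryDater f T ζ ω})
      =Θ[atTop] MonSep.tail (MonSep.integratedTailCDF F) := by
  open MonSep in
  obtain ⟨νF, hνF, hF⟩ := hSE.subexp.exists_law
  obtain ⟨ν, hh, hν⟩ := exists_isIntegratedTail hSE.subexp hSE.finite_moment hSE.subexp_integrated
  have hYid : ∀ i j, IdentDistrib (Y i j) (Y 0 j) μ μ := fun i j =>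
    (hAA.ident_vectors i).comp (u := fun z : Fin r → ℝ => z j) (measurable_pi_apply j)
  have hY1int : ∀ j, Integrable (Y 1 j) μ := fun j =>
    integrable_of_tail_le (hY_meas 1 j) (hAA.nonneg 1 j) hSE.finite_moment
      ((hSE.tails j).eventually_le hh.pos one_pos)
  have hY0int : ∀ j, Integrable (Y 0 j) μ := fun j => (hYid 1 j).integrable_snd (hY1int j)
  have hYint : ∀ i j, Integrable (Y i j) μ := fun i j => (hYid i j).symm.integrable_snd (hY0int j)
  have hYmean : ∀ i j, ∫ ω, Y i j ω ∂μ = b j := fun i j => by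
    rw [hb, (hYid i j).integral_eq, (hYid 1 j).integral_eq]
  have hself : ∀ i, degenerateDater f ζ i i =ᵐ[μ] fun ω => ∑ j, Y i j ω := fun i => by
    filter_upwards [hAA.dater_eq_sum i] with ω hω
    rw [← hω]
    exact (hf.dater_self _ _ _).symm
  have hint : ∀ i, Integrable (degenerateDater f ζ i i) μ := fun i =>
    (integrable_finsetSum _ fun j _ => hYint i j).congr (hself i).symm
  -- Stability of each queue of the lower bound: by (AA), `L b_j ≤ E Z_{[-L+1,0]}(Q) < L a` for a
  -- suitable block length.
  have hab : ∀ j, b j < a := by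
    intro j
    obtain ⟨L, hL, hLa⟩ := exists_block_of_gammaZero_lt hf hf_meas hζ_meas hIA.indep_marks
      hIA.ident_marks hint hstab
    have hle : ∫ ω, ∑ i ∈ Finset.Icc (-(L : ℤ) + 1) 0, Y i j ω ∂μ ≤
        ∫ ω, degenerateDater f ζ (-(L : ℤ) + 1) 0 ω ∂μ := by
      refine integral_mono_ae (integrable_finsetSum _ fun i _ => hYint i j)
        (integrable_degenerateDater hf hf_meas hζ_meas hint (by omega)) ?_
      filter_upwards [hAA.max_le_dater (-(L : ℤ) + 1) (by omega)] with ω hω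
      exact (le_ciSup (f := fun j : Fin r => ∑ i ∈ Finset.Icc (-(L : ℤ) + 1) 0, Y i j ω)
        (Set.finite_range _).bddAbove j).trans hω
    rw [integral_finsetSum _ fun i _ => hYint i j] at hle
    simp only [hYmean, Finset.sum_const, Int.card_Icc, nsmul_eq_mul] at hle
    rw [show (0 + 1 - (-(L : ℤ) + 1)).toNat = L by omega] at hle
    have hL' : (0 : ℝ) < L := by exact_mod_cast hL
    exact lt_of_mul_lt_mul_left (hle.trans_lt hLa) hL'.le
  -- (SE) and (H) concern `Y_1`, while the queues use the vector at time `0`; equality in law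
  -- transfers the tails.
  have htail01 : ∀ j x, μ.real {ω | x < Y 1 j ω} = μ.real {ω | x < Y 0 j ω} := fun j x =>
    congrArg ENNReal.toReal ((hYid 1 j).measure_mem_eq (measurableSet_Ioi (a := x)))
  have hpair01 : ∀ j k x, μ.real {ω | x < Y 1 j ω ∧ x < Y 1 k ω} =
      μ.real {ω | x < Y 0 j ω ∧ x < Y 0 k ω} := fun j k x =>
    congrArg ENNReal.toReal ((hAA.ident_vectors 1).measure_mem_eq
      (s := {z : Fin r → ℝ | x < z j ∧ x < z k})
      ((measurableSet_lt measurable_const (measurable_pi_apply j)).inter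
        (measurableSet_lt measurable_const (measurable_pi_apply k))))
  have hsum01 : ∀ x, μ.real {ω | x < ∑ j, Y 1 j ω} = μ.real {ω | x < ∑ j, Y 0 j ω} := fun x =>
    congrArg ENNReal.toReal (((hAA.ident_vectors 1).comp (u := fun z : Fin r → ℝ => ∑ j, z j)
      (by fun_prop)).measure_mem_eq (measurableSet_Ioi (a := x)))
  have hQ : IsParallelQueueInput T Y F d b a μ :=
    { measY := hY_meas
      measT := fun n => (hT_meas _).sub (hT_meas _)
      nonnegT := fun n => by
        filter_upwards [hT_mono] with ω hω
        exact sub_nonneg.2 (hω (by omega))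
      indepY := hAA.indep_vectors
      indepT := hIA.indep_interarrival
      indep := hAA.indep
      identY := hAA.ident_vectors
      identT := hIA.ident_interarrival
      intY := hY0int
      intT := hτ_int
      meanY := hYmean 0
      meanT := ha.symm
      tails := fun j => by simpa only [htail01] using hSE.tails j
      pairs := fun δ hδ => by
        simpa only [hpair01] using hH.pair_tail_le hh.pos hY_meas hδ }
  have hlim := hQ.tendsto hh hab
  have hlim' : Tendsto (fun x : ℝ => μ.real {ω | (x : EReal) < forkJoinResponseTime T Y ω} /
      tail (integratedTailCDF F) x) atTop (𝓝 (∑ j, d j / (a - b j))) := by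
    simpa only [hν] using hlim
  have hle : ∀ x : ℝ, μ.real {ω | (x : EReal) < forkJoinResponseTime T Y ω} ≤
      μ.real {ω | (x : EReal) < stationaryDater f T ζ ω} := by
    intro x
    refine ENNReal.toReal_mono (measure_ne_top _ _) (measure_mono_ae ?_)
    have hall : ∀ᵐ ω ∂μ, ∀ n : ℤ, n ≤ 0 →
        (⨆ j : Fin r, ∑ i ∈ Finset.Icc n 0, Y i j ω) ≤ degenerateDater f ζ n 0 ω := by
      rw [ae_all_iff]
      intro n
      by_cases hn : n ≤ 0
      · filter_upwards [hAA.max_le_dater n hn] with ω hω _ using hω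
      · exact Eventually.of_forall fun ω h => absurd h hn
    filter_upwards [hT_mono, hall] with ω h1 h2 (h3 : (x : EReal) < forkJoinResponseTime T Y ω)
    exact h3.trans_le (forkJoin_le_stationaryDater hf h1 h2)
  have hνpos : ∀ x, 0 < tail (integratedTailCDF F) x := fun x => by
    rw [hν]; exact hh.subexp.pos x
  refine ⟨hlim', ?_, ?_, ?_⟩
  · have hE : Tendsto (fun x : ℝ => ((μ.real {ω | (x : EReal) < forkJoinResponseTime T Y ω} /
        tail (integratedTailCDF F) x : ℝ) : EReal)) atTop
        (𝓝 ((∑ j, d j / (a - b j) : ℝ) : EReal)) := EReal.tendsto_coe.2 hlim'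
    rw [← hE.liminf_eq]
    refine liminf_le_liminf (Eventually.of_forall fun x => EReal.coe_le_coe_iff.2 ?_)
    exact div_le_div_of_nonneg_right (hle x) (hνpos x).le
  · obtain ⟨C, hC, hCt⟩ := hH.sum_tail_le hh.pos
    have htail : ∀ᶠ x in atTop, μ.real {ω | x < degenerateDater f ζ 0 0 ω} ≤ C * tail F x := by
      filter_upwards [hCt] with x hx
      rw [hsum01] at hx
      refine le_trans (le_of_eq (measureReal_congr ?_)) hx
      filter_upwards [hself 0] with ω hω
      exact congrArg (fun y => x < y) hω
    obtain ⟨C', hC'⟩ := stationaryDater_tail_le hf hf_meas hT_meas hT_mono hζ_meas hτ_int hIA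
      (ha ▸ hstab) hint hνF hF hh hC htail
    refine IsBigO.of_bound C' ?_
    filter_upwards [hC'] with x hx
    rw [Real.norm_of_nonneg measureReal_nonneg, Real.norm_of_nonneg (hνpos x).le, hν]
    exact hx
  -- Some `d j` is positive since their sum is, so the limit is positive and the ratio is eventually
  -- above half of it.
  · have hS : 0 < ∑ j, d j / (a - b j) := by
      have hd : ∀ j, 0 ≤ d j := fun j => (hSE.tails j).nonneg hh.pos fun _ => measureReal_nonneg
      obtain ⟨j, _, hj⟩ := Finset.exists_lt_of_sum_lt (s := Finset.univ)
        (f := fun _ : Fin r => (0 : ℝ)) (g := d) (by simpa using hSE.sum_pos)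
      exact Finset.sum_pos' (fun j _ => div_nonneg (hd j) (sub_pos.2 (hab j)).le)
        ⟨j, Finset.mem_univ _, div_pos hj (sub_pos.2 (hab j))⟩
    refine IsBigO.of_bound (2 / ∑ j, d j / (a - b j)) ?_
    filter_upwards [hlim'.eventually (eventually_gt_nhds (half_lt_self hS))] with x hx
    rw [Real.norm_of_nonneg measureReal_nonneg, Real.norm_of_nonneg (hνpos x).le]
    rw [lt_div_iff₀ (hνpos x)] at hx
    have h1 := hx.le.trans (hle x)
    rw [div_mul_eq_mul_div, le_div_iff₀ hS]
    linarith
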